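/- Let $q\ge 0$, $\Omega\subseteq\mathbb R^d$, and let $X=\{x_1,\dots,x_N\}\subset\Omega$ be $N$ distinct points. Let $V=\mathrm{span}\{\delta_{x_1},\dots,\delta_{x_N}\}$ be the space of combinations of point evaluations with the inner product that makes the $\delta_{x_i}$ orthonormal. For $u=\sum_i\omega_i\delta_{x_i}$ put $(f,u)_\Omega=\sum_i\omega_i f(x_i)$, and let $\omega$ be the coefficient vector and $\mathrm{supp}\,u=\{x_i:\omega_i\ne0\}$ the support of $u$. Let $m_q$ be the number of multi-indices $\alpha\in\mathbb N_0^d$ with $|\alpha|\le q$. Let $\mathcal T$ be a binary cluster tree for $X$: its nodes (clusters) are nonempty subsets of $X$, the root is $X$, and every node either has no sons (a leaf) or is the disjoint union of its two sons; the level of a node is its distance from the root. For each cluster $v$ define scaling functions $\Phi^v$ and samplets $\Sigma^v$ recursively. If $v$ is a leaf, $\Phi^v=\{\delta_x: x\in v\}$ and $\Sigma^v=\emptyset$. Otherwise let $\Phi$ be the row of the $n$ scaling functions of the two sons of $v$, $M=[(z^\alpha,\Phi)_\Omega]_{|\alpha|\le q}\in\mathbb R^{m_q\times n}$ the moment matrix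 (rows in any order), and $M^T=Q^vR$ any QR decomposition ($Q^v\in\mathbb R^{n\times n}$ orthogonal, $R\in\mathbb R^{n\times m_q}$ upper triangular); the first $\min(m_q,n)$ entries of $\Phi Q^v$ are the scaling functions $\Phi^v$ and the remaining ones are the samplets $\Sigma^v$. Let $V_j$ and $S_j$ be the spans of the scaling functions and of the samplets, respectively, of the clusters on level $j$. Then: (a) If $\mathcal T$ is balanced with depth $J$, that is, the nodes without sons are exactly the nodes on level $J$, then $V_0\subseteq V_1\subseteq\dots\subseteq V_J=V$, and $V_j\oplus S_j=V_{j+1}$ is an orthogonal direct sum for all $0\le j<J$. (b) The samplet basis, that is, the scaling functions of the root cluster together with the samplets of all clusters, is an orthonormal basis of $V$. (1) Every samplet $\sigma$ has vanishing moments up to degree $q$: $(p,\sigma)_\Omega=0$ for all polynomials $p$ of total degree at most $q$. (2) Every samplet of a cluster $v$ on level $j$ is supported in $v$. (3) Let $\Omega$ be convex with $\mathrm{Vol}_d(\Omega)>0$, and let $c\ge 0$ and $\tau\in\mathbb N$. There are constants $C_1,C_2>0$, depending only on $d,q,\Omega,c,\tau$, such that the following holds for every $N$ and all distinct points $x_1,\dots,x_N\in\Omega$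 with $h_{X,\Omega}\le c\,q_X$, where $h_{X,\Omega}=\sup_{y\in\Omega}\min_i\|y-x_i\|_2$ and $q_X=\frac12\min_{i\ne j}\|x_i-x_j\|_2$ (a sequence of point sets is quasi-uniform if this holds with one $c$ for all of them). Suppose that in the cluster tree every cluster with sons is split perpendicularly to a longest edge of its bounding box at a median of the respective coordinates of its $n$ points, the points whose coordinate equals the median being distributed such that the first son, which consists of points with coordinate at least the median, has between $n/2$ and $n/2+1$ elements, while the coordinates in the second son are at most the median, and suppose that every leaf has fewer than $\tau$ elements. Then every samplet $\sigma$ of a cluster on level $j$, from any choice of QR decompositions, satisfies $C_1 2^{-j/d}\le\mathrm{diam}(\mathrm{supp}\,\sigma)\le C_2 2^{-j/d}$. (4) If a samplet with coefficient vector $\omega$ is supported in $v\subseteq X$ (for instance in a cluster $v$), then $\|\omega\|_1\le\sqrt{|v|}$. (5) Let $\Omega$ be open and convex, $f\in C^{q+1}(\Omega)$, and let $\sigma$ be a samplet with coefficient vector $\omega$ that is supported in $v\subseteq X$ (for instance in a cluster $v$). Then $$|(f,\sigma)_\Omega|\le\Big(\frac d2\Big)^{q+1}\frac{\mathrm{diam}(v)^{q+1}}{(q+1)!}\,\|f\|_{C^{q+1}(\Omega)}\,\|\omega\|_1,$$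 where $\|f\|_{C^{q+1}(\Omega)}=\max_{|\alpha|\le q+1}\sup_\Omega|\partial^\alpha f|\in[0,\infty]$. -/

import Mathlib

open scoped ENNReal NNReal

namespace Samplet

noncomputable section

/-- The ambient space `ℝ^d` with the Euclidean norm. -/
abbrev Pt (d : ℕ) := EuclideanSpace ℝ (Fin d)

/-- The space `V = span {δ_{x_1}, …, δ_{x_N}}` with the inner product that makes the `δ_{x_i}`
orthonormal. An element `u = ∑ i, u i • δ_{x_i}` is identified with its coefficient vector. -/
abbrev V (N : ℕ) := EuclideanSpace ℝ (Fin N)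

/-- The point evaluation `δ_{x_i}` as an element of `V`. -/
def delta {N : ℕ} (i : Fin N) : V N := EuclideanSpace.single i 1

/-- `(f, u)_Ω = ∑ i, u i * f (x_i)` for `u = ∑ i, u i • δ_{x_i}`. -/
def pairing {d N : ℕ} (x : Fin N → Pt d) (f : Pt d → ℝ) (u : V N) : ℝ :=
  ∑ i, u i * f (x i)

/-- The indices of the points in the support of `u ∈ V`. -/
def supp {N : ℕ} (u : V N) : Finset (Fin N) := Finset.univ.filter fun i => u i ≠ 0

/-- The diameter of the set of points `x_i`, `i ∈ v`. -/
def diam {d N : ℕ} (x : Fin N → Pt d) (v : Finset (Fin N)) : ℝ :=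
  Metric.diam (x '' (v : Set (Fin N)))

/-! ### Monomials -/

/-- Multi-indices `α ∈ ℕ^d` with `|α| ≤ q`. -/
abbrev MultiIndex (d q : ℕ) : Type :=
  {α : Fin d → Fin (q + 1) // ∑ i, (α i : ℕ) ≤ q}

/-- The number `m_q` of multi-indices `α ∈ ℕ^d` with `|α| ≤ q`. -/
def mq (d q : ℕ) : ℕ := Fintype.card (MultiIndex d q)

/-- The monomial `z ↦ z^α`. -/
def monomial {d q : ℕ} (α : MultiIndex d q) (z : Pt d) : ℝ := ∏ i, z i ^ (α.1 i : ℕ)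

/-! ### Cluster trees -/

/-- Binary trees in which every node without sons carries a set of points (given by their indices)
and every other node has exactly two sons. -/
inductive ClusterTree (N : ℕ) : Type
  | leaf (v : Finset (Fin N)) : ClusterTree N
  | node (l r : ClusterTree N) : ClusterTree N

namespace ClusterTree

variable {N : ℕ}

/-- The cluster at the root of the tree. -/
def cluster : ClusterTree N → Finset (Fin N)
  | leaf v => v
  | node l r => l.cluster ∪ r.cluster

/-- Clusters are nonempty, and every cluster with sons is the disjoint union of its sons. -/
def Valid : ClusterTree N → Prop
  | leaf v => v.Nonempty
  | node l r => l.Valid ∧ r.Valid ∧ Disjoint l.cluster r.cluster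

/-- A (binary) cluster tree for `X = {x_1, …, x_N}`. -/
def IsClusterTree (T : ClusterTree N) : Prop := T.Valid ∧ T.cluster = Finset.univ

/-- The tree consists of its root only, that is, the root has no sons. -/
def IsLeaf : ClusterTree N → Prop
  | leaf _ => True
  | node _ _ => False

/-- The nodes of a cluster tree, described by the way to them from the root. -/
inductive Node : ClusterTree N → Type
  | root (T : ClusterTree N) : Node T
  | left {l r : ClusterTree N} (p : Node l) : Node (node l r)
  | right {l r : ClusterTree N} (p : Node r) : Node (node l r)

/-- The level of a node. -/
def Node.level : {T : ClusterTree N} → Node T → ℕ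
  | _, root _ => 0
  | _, left p => p.level + 1
  | _, right p => p.level + 1

/-- The subtree below a node. -/
def Node.subtree : {T : ClusterTree N} → Node T → ClusterTree N
  | _, root T => T
  | _, left p => p.subtree
  | _, right p => p.subtree

/-- The cluster of a node. -/
def Node.cluster {T : ClusterTree N} (p : Node T) : Finset (Fin N) := p.subtree.cluster

/-- A node has no sons if it is on level `J`, and it has exactly two sons otherwise. -/
def IsBalanced (T : ClusterTree N) (J : ℕ) : Prop :=
  ∀ p : Node T, p.subtree.IsLeaf ↔ p.level = J

/-! ### Scaling functions and samplets -/

/-- The number of scaling functions of the root cluster, when each cluster with sons keeps (at most)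
the first `m` functions as scaling functions. -/
def numScaling (m : ℕ) : ClusterTree N → ℕ
  | leaf v => v.card
  | node l r => min m (l.numScaling m + r.numScaling m)

/-- The number of samplets of the root cluster. -/
def numSamplets (m : ℕ) : ClusterTree N → ℕ
  | leaf _ => 0
  | node l r => (l.numScaling m + r.numScaling m) - m

/-- A choice of a square matrix `Q^v` for every cluster `v` with sons, whose size is the number of
scaling functions of the sons of `v` taken together. -/
def Transforms (m : ℕ) : ClusterTree N → Type
  | leaf _ => Unit
  | node l r => l.Transforms m × r.Transforms m ×
      Matrix (Fin (l.numScaling m + r.numScaling m)) (Fin (l.numScaling m + r.numScaling m)) ℝ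

/-- The part of the matrices that belongs to the subtree below a node. -/
def Node.transforms {m : ℕ} :
    {T : ClusterTree N} → (p : Node T) → T.Transforms m → p.subtree.Transforms m
  | _, root _, Q => Q
  | _, left p, Q => p.transforms Q.1
  | _, right p, Q => p.transforms Q.2.1

/-- The scaling functions `Φ^v` of the root cluster `v`: the point evaluations if `v` is a leaf, and
otherwise the first `m` entries of the row `Φ^{sons} Q^v`. -/
def scaling (m : ℕ) : (T : ClusterTree N) → T.Transforms m → Fin (T.numScaling m) → V N
  | leaf v, _ => fun k => delta (v.orderEmbOfFin rfl k)
  | node l r, Q => fun k =>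
      ∑ i, Q.2.2 i (Fin.castLE (min_le_right _ _) k) •
        Fin.append (l.scaling m Q.1) (r.scaling m Q.2.1) i

/-- The samplets `Σ^v` of the root cluster `v`: none if `v` is a leaf, and otherwise the entries of
the row `Φ^{sons} Q^v` after the first `m`. -/
def samplets (m : ℕ) : (T : ClusterTree N) → T.Transforms m → Fin (T.numSamplets m) → V N
  | leaf _, _ => fun k => k.elim0
  | node l r, Q => fun k =>
      ∑ i, Q.2.2 i ⟨m + k.1, Nat.add_lt_of_lt_sub' k.2⟩ •
        Fin.append (l.scaling m Q.1) (r.scaling m Q.2.1) i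

/-- The matrices come from QR decompositions: for each cluster with sons, with `Φ` the row of the
scaling functions of the sons and `M = [(z^α, Φ)]_{|α| ≤ q}` the moment matrix (rows in any order),
`Mᵀ = Q R` with `Q` orthogonal and `R` upper triangular. -/
def IsQR {d : ℕ} (x : Fin N → Pt d) (q : ℕ) : (T : ClusterTree N) → T.Transforms (mq d q) → Prop
  | leaf _, _ => True
  | node l r, Q =>
      l.IsQR x q Q.1 ∧ r.IsQR x q Q.2.1 ∧
      Q.2.2 ∈ Matrix.orthogonalGroup (Fin (l.numScaling (mq d q) + r.numScaling (mq d q))) ℝ ∧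
      ∃ (e : Fin (mq d q) ≃ MultiIndex d q)
        (R : Matrix (Fin (l.numScaling (mq d q) + r.numScaling (mq d q))) (Fin (mq d q)) ℝ),
        (∀ i a, a.1 < i.1 → R i a = 0) ∧
        (Matrix.of fun (a : Fin (mq d q)) i => pairing x (monomial (e a))
          (Fin.append (l.scaling (mq d q) Q.1) (r.scaling (mq d q) Q.2.1) i)).transpose = Q.2.2 * R

variable {m : ℕ} {T : ClusterTree N}

/-- The scaling functions of the cluster at a node. -/
def Node.scaling (Q : T.Transforms m) (p : Node T) : Fin (p.subtree.numScaling m) → V N :=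
  p.subtree.scaling m (p.transforms Q)

/-- The samplets of the cluster at a node. -/
def Node.samplets (Q : T.Transforms m) (p : Node T) : Fin (p.subtree.numSamplets m) → V N :=
  p.subtree.samplets m (p.transforms Q)

/-- `V_j`, spanned by the scaling functions of the clusters on level `j`. -/
def scalingSpace (Q : T.Transforms m) (j : ℕ) : Submodule ℝ (V N) :=
  Submodule.span ℝ {φ | ∃ p : Node T, p.level = j ∧ ∃ k, p.scaling Q k = φ}

/-- `S_j`, spanned by the samplets of the clusters on level `j`. -/
def detailSpace (Q : T.Transforms m) (j : ℕ) : Submodule ℝ (V N) :=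
  Submodule.span ℝ {σ | ∃ p : Node T, p.level = j ∧ ∃ k, p.samplets Q k = σ}

/-- The samplet basis: the scaling functions of the root cluster together with the samplets of all
clusters, as an indexed family. -/
def sampletBasis (Q : T.Transforms m) :
    Fin (T.numScaling m) ⊕ (Σ p : Node T, Fin (p.subtree.numSamplets m)) → V N
  | Sum.inl k => T.scaling m Q k
  | Sum.inr s => s.1.samplets Q s.2

/-! ### Splitting along the longest edge of the bounding box -/

/-- The length of the bounding box of `v` in direction `ℓ`. -/
def edgeLength {d : ℕ} (x : Fin N → Pt d) (v : Finset (Fin N)) (ℓ : Fin d) : ℝ :=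
  sSup ((fun i => x i ℓ) '' (v : Set (Fin N))) - sInf ((fun i => x i ℓ) '' (v : Set (Fin N)))

/-- `c` is a median of the `ℓ`-th coordinates of the points of `v`. -/
def IsMedian {d : ℕ} (x : Fin N → Pt d) (v : Finset (Fin N)) (ℓ : Fin d) (c : ℝ) : Prop :=
  2 * (v.filter fun i => c < x i ℓ).card ≤ v.card ∧ 2 * (v.filter fun i => x i ℓ < c).card ≤ v.card

/-- `v₁ ∪ v₂` is split into `v₁` and `v₂` at a median `c` in the direction of a longest edge of its
bounding box; points whose coordinate is equal to `c` may go to either side, such that `v₁` has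
between `n / 2` and `n / 2 + 1` of the `n` elements. -/
def IsMedianSplit {d : ℕ} (x : Fin N → Pt d) (v₁ v₂ : Finset (Fin N)) : Prop :=
  ∃ (ℓ : Fin d) (c : ℝ),
    (∀ k, edgeLength x (v₁ ∪ v₂) k ≤ edgeLength x (v₁ ∪ v₂) ℓ) ∧
    IsMedian x (v₁ ∪ v₂) ℓ c ∧
    (∀ i ∈ v₁, c ≤ x i ℓ) ∧ (∀ i ∈ v₂, x i ℓ ≤ c) ∧
    v₂.card ≤ v₁.card ∧ v₁.card ≤ v₂.card + 2

/-- Every cluster with sons is split at a median along a longest edge of its bounding box, and every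
leaf has fewer than `τ` elements. -/
def IsSplitTree {d : ℕ} (x : Fin N → Pt d) (τ : ℕ) : ClusterTree N → Prop
  | leaf v => v.card < τ
  | node l r => l.IsSplitTree x τ ∧ r.IsSplitTree x τ ∧ IsMedianSplit x l.cluster r.cluster

end ClusterTree

/-! ### Quasi-uniform points and the `C^k` norm -/

/-- The fill distance `h = sup_{y ∈ Ω} min_i ‖y - x_i‖`. -/
def fillDistance {d N : ℕ} (Ω : Set (Pt d)) (x : Fin N → Pt d) : ℝ≥0∞ :=
  ⨆ y ∈ Ω, ⨅ i, edist y (x i)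

/-- The separation radius `min_{i ≠ j} ‖x_i - x_j‖ / 2`. -/
def separationRadius {d N : ℕ} (x : Fin N → Pt d) : ℝ≥0∞ :=
  ⨅ (i : Fin N) (j : Fin N) (_ : i ≠ j), edist (x i) (x j) / 2

/-- The points `x_1, …, x_N ∈ Ω` are pairwise distinct, and their fill distance in `Ω` is at most `c`
times their separation radius. A sequence of point sets in `Ω` is quasi-uniform if this holds with
one `c` for all its members. -/
structure IsQuasiUniform {d N : ℕ} (Ω : Set (Pt d)) (c : ℝ≥0) (x : Fin N → Pt d) : Prop where
  mem : ∀ i, x i ∈ Ω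
  injective : Function.Injective x
  fill_le : fillDistance Ω x ≤ c * separationRadius x

/-- `‖f‖_{C^k(Ω)}`: the supremum over `Ω` of the absolute values of all partial derivatives of `f` of
order at most `k`, where `Ω` is open. -/
def cNorm {d : ℕ} (k : ℕ) (Ω : Set (Pt d)) (f : Pt d → ℝ) : ℝ≥0∞ :=
  ⨆ (n : ℕ) (_ : n ≤ k) (ι : Fin n → Fin d) (y ∈ Ω),
    ‖iteratedFDeriv ℝ n f y fun a => EuclideanSpace.single (ι a) (1 : ℝ)‖ₑ

end

end Samplet

namespace Samplet

/-! ### Coordinate subspaces -/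

/-! The algebraic statements rest on one relation. Since `Q^v` is orthogonal, the scaling functions
and the samplets of a cluster together span the same space as the scaling functions of its two sons
(`span_transformed_eq`), and they are orthonormal if those are. Sons have disjoint clusters, so
everything that lives on one son is orthogonal to everything on the other. Induction on the tree
then gives the multiresolution analysis and the orthonormal basis. The moments vanish because `Qᵀ Mᵀ
= R` is upper triangular: the rows of `R` beyond the first `m_q` are zero, and they list the moments
of the samplets. The `ℓ¹` bound is Cauchy–Schwarz for a unit vector. For smooth `f`, subtract the
Taylor polynomial at a point of the convex hull whose `ℓ¹` distance to all points of `v` is at most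
`d / 2` times the diameter (`exists_centre`).

Localization needs geometry. A cluster on level `j` has about `N / 2 ^ j` points, and comparing
volumes turns such counts into lengths, provided that bounding boxes do not degenerate. The
invariant is that a cluster either has edges that are long compared to the fill distance and
mutually comparable, or has only edges of the order of the fill distance. Convexity enters twice.
Contracting an earlier cluster towards a point deep in the box of a later one shows that an edge
cannot shrink much through cuts in other directions (`IsSpread.edgeLength_le`). And a balanced split
cannot cut off a thin slab, since shifting the points of the slab into the other half would produce
too many points there (`IsSpread.edgeLength_le_of_split`). As a longest edge is always the one that
is cut, the edges stay comparable (`IsFat`).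

For the lower bound, a samplet has at least two points in its support, which suffices if the
separation radius is of order `2 ^ (-j / d)`. Otherwise the sons are large and polynomials of degree
at most `q` are determined by their values there. A son then has exactly the restricted polynomials
as its scaling space, by counting dimensions (`exists_polyVec_eq`), so the samplet is a polynomial
on each son and not zero on one of them. Such a polynomial cannot vanish at all cluster points near
either of two opposite parts of a ball of radius of order `2 ^ (-j / d)` (`exists_far_nonzeros`). -/

/-- The subspace of all `u ∈ V` that are supported in `v`. -/
def supportedIn {N : ℕ} (v : Finset (Fin N)) : Submodule ℝ (V N) where
  carrier := {u | ∀ i ∉ v, u i = 0}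
  add_mem' {a b} ha hb i hi := by simp [ha i hi, hb i hi]
  zero_mem' := by simp
  smul_mem' c a ha i hi := by simp [ha i hi]

section Coordinates

variable {N : ℕ} {v w : Finset (Fin N)}

theorem mem_supportedIn {u : V N} : u ∈ supportedIn v ↔ ∀ i ∉ v, u i = 0 := Iff.rfl

theorem supportedIn_mono (h : v ⊆ w) : supportedIn v ≤ supportedIn w :=
  fun _ hu i hi => hu i fun hv => hi (h hv)

theorem inner_eq_sum (a b : V N) : inner ℝ a b = ∑ i, a i * b i := by
  simp [PiLp.inner_apply, mul_comm]

theorem supportedIn_isOrtho (h : Disjoint v w) : supportedIn v ⟂ supportedIn w := by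
  rw [Submodule.isOrtho_iff_inner_eq]
  intro a ha b hb
  rw [inner_eq_sum]
  refine Finset.sum_eq_zero fun i _ => ?_
  by_cases hi : i ∈ v
  · rw [hb i (Finset.disjoint_left.1 h hi), mul_zero]
  · rw [ha i hi, zero_mul]

theorem delta_apply (i j : Fin N) : delta i j = if j = i then 1 else 0 := by
  simp [delta, PiLp.single_apply]

theorem delta_mem_supportedIn {i : Fin N} (hi : i ∈ v) : delta i ∈ supportedIn v := by
  intro j hj
  rw [delta_apply, if_neg]
  rintro rfl
  exact hj hi

theorem eq_sum_delta {u : V N} (hu : u ∈ supportedIn v) : u = ∑ i ∈ v, u i • delta i := by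
  ext j
  simp only [WithLp.ofLp_sum, WithLp.ofLp_smul, Finset.sum_apply, Pi.smul_apply, delta_apply,
    smul_eq_mul, mul_ite, mul_one, mul_zero, Finset.sum_ite_eq]
  split_ifs with h
  · rfl
  · exact hu j h

theorem supportedIn_le_of_delta_mem {U : Submodule ℝ (V N)} (h : ∀ i ∈ v, delta i ∈ U) :
    supportedIn v ≤ U := by
  intro u hu
  rw [eq_sum_delta hu]
  exact U.sum_mem fun i hi => U.smul_mem _ (h i hi)

theorem supp_subset_iff {u : V N} : supp u ⊆ v ↔ u ∈ supportedIn v := by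
  simp only [supp, Finset.subset_iff, Finset.mem_filter, Finset.mem_univ, true_and,
    mem_supportedIn]
  exact forall_congr' fun i => not_imp_comm

theorem orthonormal_delta : Orthonormal ℝ (delta : Fin N → V N) := by
  have h := (EuclideanSpace.basisFun (Fin N) ℝ).orthonormal
  have e : (delta : Fin N → V N) = EuclideanSpace.basisFun (Fin N) ℝ := by
    ext1 i; simp [delta]
  rwa [e]

end Coordinates

/-! ### The pairing -/

section Pairing

variable {d N : ℕ} (x : Fin N → Pt d)

theorem pairing_sum_smul (f : Pt d → ℝ) {ι : Type*} (s : Finset ι) (c : ι → ℝ) (u : ι → V N) :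
    pairing x f (∑ k ∈ s, c k • u k) = ∑ k ∈ s, c k * pairing x f (u k) := by
  simp only [pairing, WithLp.ofLp_sum, WithLp.ofLp_smul, Finset.sum_apply, Pi.smul_apply,
    smul_eq_mul, Finset.sum_mul, Finset.mul_sum]
  rw [Finset.sum_comm]
  simp only [mul_assoc]

theorem pairing_finset_sum (u : V N) {ι : Type*} (s : Finset ι) (c : ι → ℝ) (f : ι → Pt d → ℝ) :
    pairing x (fun z => ∑ k ∈ s, c k * f k z) u = ∑ k ∈ s, c k * pairing x (f k) u := by
  simp only [pairing, Finset.mul_sum]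
  rw [Finset.sum_comm]
  refine Finset.sum_congr rfl fun k _ => Finset.sum_congr rfl fun i _ => by ring

theorem pairing_sub (f g : Pt d → ℝ) (u : V N) :
    pairing x (fun z => f z - g z) u = pairing x f u - pairing x g u := by
  simp only [pairing, mul_sub, Finset.sum_sub_distrib]

theorem pairing_eq_sum_of_supp {v : Finset (Fin N)} {u : V N} (hu : u ∈ supportedIn v)
    (f : Pt d → ℝ) : pairing x f u = ∑ i ∈ v, u i * f (x i) := by
  symm
  refine Finset.sum_subset (Finset.subset_univ v) fun i _ hi => ?_
  rw [hu i hi, zero_mul]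

end Pairing

/-! ### Orthogonal transformations of orthonormal families -/

section Rotate

variable {E : Type*} [NormedAddCommGroup E] [InnerProductSpace ℝ E] {n : ℕ}

/-- The row `Φ A`. -/
noncomputable def rotate (A : Matrix (Fin n) (Fin n) ℝ) (Φ : Fin n → E) (k : Fin n) : E := ∑ i, A i k • Φ i

theorem orthonormal_rotate {A : Matrix (Fin n) (Fin n) ℝ}
    (hA : A ∈ Matrix.orthogonalGroup (Fin n) ℝ) {Φ : Fin n → E} (hΦ : Orthonormal ℝ Φ) :
    Orthonormal ℝ (rotate A Φ) := by
  rw [orthonormal_iff_ite]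
  intro a b
  have h := congrFun (congrFun ((Matrix.mem_orthogonalGroup_iff' (Fin n) ℝ).1 hA) a) b
  rw [rotate, rotate, hΦ.inner_sum]
  simpa [Matrix.mul_apply, Matrix.one_apply] using h

theorem rotate_mem_span (A : Matrix (Fin n) (Fin n) ℝ) (Φ : Fin n → E) (k : Fin n) :
    rotate A Φ k ∈ Submodule.span ℝ (Set.range Φ) :=
  Submodule.sum_mem _ fun i _ => Submodule.smul_mem _ _ (Submodule.subset_span ⟨i, rfl⟩)

theorem rotate_transpose_rotate {A : Matrix (Fin n) (Fin n) ℝ}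
    (hA : A ∈ Matrix.orthogonalGroup (Fin n) ℝ) (Φ : Fin n → E) :
    rotate A.transpose (rotate A Φ) = Φ := by
  have h := (Matrix.mem_orthogonalGroup_iff (Fin n) ℝ).1 hA
  funext i
  simp only [rotate, Finset.smul_sum, smul_smul, Matrix.transpose_apply]
  rw [Finset.sum_comm]
  simp only [← Finset.sum_smul]
  rw [Finset.sum_eq_single i]
  · have h2 := congrFun (congrFun h i) i
    simp only [Matrix.mul_apply, Matrix.one_apply_eq, Matrix.transpose_apply] at h2
    rw [h2, one_smul]
  · intro b _ hb
    have h2 := congrFun (congrFun h i) b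
    simp only [Matrix.mul_apply, Matrix.one_apply_ne hb.symm, Matrix.transpose_apply] at h2
    rw [h2, zero_smul]
  · simp

/-- An orthogonal matrix is inverted by its transpose, so each of the two rows consists of
combinations of the other. -/
theorem span_rotate {A : Matrix (Fin n) (Fin n) ℝ}
    (hA : A ∈ Matrix.orthogonalGroup (Fin n) ℝ) (Φ : Fin n → E) :
    Submodule.span ℝ (Set.range (rotate A Φ)) = Submodule.span ℝ (Set.range Φ) := by
  apply le_antisymm
  · rw [Submodule.span_le]
    rintro _ ⟨k, rfl⟩
    exact rotate_mem_span A Φ k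
  · rw [Submodule.span_le]
    rintro _ ⟨k, rfl⟩
    have h := rotate_mem_span A.transpose (rotate A Φ) k
    rwa [rotate_transpose_rotate hA] at h

theorem orthonormal_append {a b : ℕ} {f : Fin a → E} {g : Fin b → E} (hf : Orthonormal ℝ f)
    (hg : Orthonormal ℝ g)
    (h : Submodule.span ℝ (Set.range f) ⟂ Submodule.span ℝ (Set.range g)) :
    Orthonormal ℝ (Fin.append f g) := by
  rw [Submodule.isOrtho_span] at h
  rw [orthonormal_iff_ite] at hf hg ⊢
  intro i j
  induction i using Fin.addCases with
  | left i =>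
    induction j using Fin.addCases with
    | left j => simp [hf]
    | right j =>
      have := h (Set.mem_range_self i) (Set.mem_range_self j)
      simp [this, Fin.ext_iff]
      omega
  | right i =>
    induction j using Fin.addCases with
    | left j =>
      have := h (Set.mem_range_self j) (Set.mem_range_self i)
      simp [real_inner_comm _ _, this, Fin.ext_iff]
      omega
    | right j => simp [hg]

theorem span_append {a b : ℕ} (f : Fin a → E) (g : Fin b → E) :
    Submodule.span ℝ (Set.range (Fin.append f g)) =
      Submodule.span ℝ (Set.range f) ⊔ Submodule.span ℝ (Set.range g) := by
  rw [← Submodule.span_union]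
  congr 1
  ext u
  constructor
  · rintro ⟨i, rfl⟩
    induction i using Fin.addCases with
    | left i => left; simp
    | right i => right; simp
  · rintro (⟨i, rfl⟩ | ⟨i, rfl⟩)
    · exact ⟨Fin.castAdd b i, by simp⟩
    · exact ⟨Fin.natAdd a i, by simp⟩

end Rotate

/-! ### Spans of scaling functions and samplets, and their supports -/

namespace ClusterTree

section Construction

variable {N m : ℕ}

/-- The span of the scaling functions of the root cluster. -/
def scalingSpan (T : ClusterTree N) (Q : T.Transforms m) : Submodule ℝ (V N) :=
  Submodule.span ℝ (Set.range (T.scaling m Q))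

/-- The span of the samplets of the root cluster. -/
def sampletSpan (T : ClusterTree N) (Q : T.Transforms m) : Submodule ℝ (V N) :=
  Submodule.span ℝ (Set.range (T.samplets m Q))

/-- The row of the scaling functions of the sons of the root cluster, transformed. -/
noncomputable def transformed (l r : ClusterTree N) (Q : (node l r).Transforms m) :
    Fin (l.numScaling m + r.numScaling m) → V N :=
  rotate Q.2.2 (Fin.append (l.scaling m Q.1) (r.scaling m Q.2.1))

theorem scaling_node (l r : ClusterTree N) (Q : (node l r).Transforms m)
    (k : Fin ((node l r).numScaling m)) :
    (node l r).scaling m Q k = transformed l r Q (Fin.castLE (min_le_right _ _) k) := rfl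

theorem samplets_node (l r : ClusterTree N) (Q : (node l r).Transforms m)
    (k : Fin ((node l r).numSamplets m)) :
    (node l r).samplets m Q k = transformed l r Q ⟨m + k.1, Nat.add_lt_of_lt_sub' k.2⟩ := rfl

/-- No entry is lost in either case: if there are at most `m` entries, the truncated subtraction in
`numSamplets` gives no samplets and the minimum in `numScaling` keeps all entries. -/
theorem range_transformed (l r : ClusterTree N) (Q : (node l r).Transforms m) :
    Set.range (transformed l r Q) =
      Set.range ((node l r).scaling m Q) ∪ Set.range ((node l r).samplets m Q) := by
  ext u
  constructor
  · rintro ⟨k, rfl⟩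
    by_cases hk : k.1 < m
    · left
      exact ⟨⟨k.1, lt_min hk k.2⟩, rfl⟩
    · right
      refine ⟨⟨k.1 - m, ?_⟩, ?_⟩
      · have := k.2
        change k.1 - m < l.numScaling m + r.numScaling m - m
        omega
      · rw [samplets_node]
        congr 1
        ext
        simp only
        omega
  · rintro (⟨k, rfl⟩ | ⟨k, rfl⟩)
    · exact ⟨_, (scaling_node l r Q k).symm⟩
    · exact ⟨_, (samplets_node l r Q k).symm⟩

theorem span_transformed (l r : ClusterTree N) (Q : (node l r).Transforms m) :
    Submodule.span ℝ (Set.range (transformed l r Q)) =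
      (node l r).scalingSpan Q ⊔ (node l r).sampletSpan Q := by
  rw [range_transformed, Submodule.span_union]
  rfl

theorem span_transformed_le (l r : ClusterTree N) (Q : (node l r).Transforms m) :
    Submodule.span ℝ (Set.range (transformed l r Q)) ≤
      l.scalingSpan Q.1 ⊔ r.scalingSpan Q.2.1 := by
  rw [Submodule.span_le]
  rintro _ ⟨k, rfl⟩
  have := rotate_mem_span Q.2.2 (Fin.append (l.scaling m Q.1) (r.scaling m Q.2.1)) k
  rwa [span_append] at this

theorem scalingSpan_le (T : ClusterTree N) (Q : T.Transforms m) :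
    T.scalingSpan Q ≤ supportedIn T.cluster := by
  induction T with
  | leaf v =>
    rw [scalingSpan, Submodule.span_le]
    rintro _ ⟨k, rfl⟩
    exact delta_mem_supportedIn (Finset.orderEmbOfFin_mem v rfl k)
  | node l r hl hr =>
    refine le_sup_left.trans ((span_transformed l r Q).ge.trans
      ((span_transformed_le l r Q).trans (sup_le ?_ ?_)))
    · exact (hl Q.1).trans (supportedIn_mono Finset.subset_union_left)
    · exact (hr Q.2.1).trans (supportedIn_mono Finset.subset_union_right)

theorem sampletSpan_le (T : ClusterTree N) (Q : T.Transforms m) :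
    T.sampletSpan Q ≤ supportedIn T.cluster := by
  cases T with
  | leaf v =>
    rw [sampletSpan, Submodule.span_le]
    rintro _ ⟨k, rfl⟩
    exact k.elim0
  | node l r =>
    refine le_sup_right.trans ((span_transformed l r Q).ge.trans
      ((span_transformed_le l r Q).trans (sup_le ?_ ?_)))
    · exact (scalingSpan_le l Q.1).trans (supportedIn_mono Finset.subset_union_left)
    · exact (scalingSpan_le r Q.2.1).trans (supportedIn_mono Finset.subset_union_right)

theorem Node.cluster_subset {T : ClusterTree N} (p : Node T) : p.cluster ⊆ T.cluster := by
  induction p with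
  | root T => exact subset_rfl
  | left p ih => exact ih.trans Finset.subset_union_left
  | right p ih => exact ih.trans Finset.subset_union_right

theorem Node.valid {T : ClusterTree N} (p : Node T) (hT : T.Valid) : p.subtree.Valid := by
  induction p with
  | root T => exact hT
  | left p ih => exact ih hT.1
  | right p ih => exact ih hT.2.1

theorem Valid.nonempty {T : ClusterTree N} (hT : T.Valid) : T.cluster.Nonempty := by
  induction T with
  | leaf v => exact hT
  | node l r hl hr => exact (hl hT.1).mono Finset.subset_union_left

/-- The span of the scaling functions of the cluster at a node. -/
def Node.scalingSpan {T : ClusterTree N} (Q : T.Transforms m) (p : Node T) :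
    Submodule ℝ (V N) := Submodule.span ℝ (Set.range (p.scaling Q))

/-- The span of the samplets of the cluster at a node. -/
def Node.sampletSpan {T : ClusterTree N} (Q : T.Transforms m) (p : Node T) :
    Submodule ℝ (V N) := Submodule.span ℝ (Set.range (p.samplets Q))

theorem Node.scalingSpan_le {T : ClusterTree N} (Q : T.Transforms m) (p : Node T) :
    p.scalingSpan Q ≤ supportedIn T.cluster :=
  (ClusterTree.scalingSpan_le p.subtree (p.transforms Q)).trans (supportedIn_mono p.cluster_subset)

theorem Node.sampletSpan_le {T : ClusterTree N} (Q : T.Transforms m) (p : Node T) :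
    p.sampletSpan Q ≤ supportedIn T.cluster :=
  (ClusterTree.sampletSpan_le p.subtree (p.transforms Q)).trans (supportedIn_mono p.cluster_subset)

end Construction

/-! ### Orthogonality and completeness of the samplet basis -/

section QR

variable {d N q : ℕ} {x : Fin N → Pt d}

theorem Node.isQR {T : ClusterTree N} {Q : T.Transforms (mq d q)} (hQ : T.IsQR x q Q)
    (p : Node T) : p.subtree.IsQR x q (p.transforms Q) := by
  induction p with
  | root T => exact hQ
  | left p ih => exact ih hQ.1
  | right p ih => exact ih hQ.2.1

/-- The two-scale relation; only the orthogonality of `Q^v` matters here, not the triangular factor.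
-/
theorem span_transformed_eq {l r : ClusterTree N} {Q : (node l r).Transforms (mq d q)}
    (hQ : (node l r).IsQR x q Q) :
    (node l r).scalingSpan Q ⊔ (node l r).sampletSpan Q =
      l.scalingSpan Q.1 ⊔ r.scalingSpan Q.2.1 := by
  rw [← span_transformed, transformed, span_rotate hQ.2.2.1, span_append]
  rfl

theorem sons_isOrtho {l r : ClusterTree N} (hT : (node l r).Valid) {a b : Submodule ℝ (V N)}
    (ha : a ≤ supportedIn l.cluster) (hb : b ≤ supportedIn r.cluster) : a ⟂ b :=
  (supportedIn_isOrtho hT.2.2).mono ha hb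

theorem orthonormal_transformed {l r : ClusterTree N} (hT : (node l r).Valid)
    {Q : (node l r).Transforms (mq d q)} (hQ : (node l r).IsQR x q Q)
    (hl : Orthonormal ℝ (l.scaling _ Q.1)) (hr : Orthonormal ℝ (r.scaling _ Q.2.1)) :
    Orthonormal ℝ (transformed l r Q) :=
  orthonormal_rotate hQ.2.2.1 (orthonormal_append hl hr
    (sons_isOrtho hT (scalingSpan_le l Q.1) (scalingSpan_le r Q.2.1)))

theorem orthonormal_scaling {T : ClusterTree N} (hT : T.Valid) {Q : T.Transforms (mq d q)}
    (hQ : T.IsQR x q Q) : Orthonormal ℝ (T.scaling _ Q) := by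
  induction T with
  | leaf v => exact orthonormal_delta.comp _ (v.orderEmbOfFin rfl).injective
  | node l r hl hr =>
    exact (orthonormal_transformed hT hQ (hl hT.1 hQ.1) (hr hT.2.1 hQ.2.1)).comp _
      (Fin.castLE_injective _)

theorem orthonormal_samplets {T : ClusterTree N} (hT : T.Valid) {Q : T.Transforms (mq d q)}
    (hQ : T.IsQR x q Q) : Orthonormal ℝ (T.samplets _ Q) := by
  cases T with
  | leaf v => exact ⟨fun k => k.elim0, fun k => k.elim0⟩
  | node l r =>
    refine (orthonormal_transformed hT hQ (orthonormal_scaling hT.1 hQ.1)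
      (orthonormal_scaling hT.2.1 hQ.2.1)).comp
      (fun k : Fin ((node l r).numSamplets (mq d q)) =>
        ⟨mq d q + k.1, Nat.add_lt_of_lt_sub' k.2⟩) fun a b hab => ?_
    simp only [Fin.mk.injEq] at hab
    exact Fin.ext (by omega)

theorem scalingSpan_isOrtho_sampletSpan {T : ClusterTree N} (hT : T.Valid)
    {Q : T.Transforms (mq d q)} (hQ : T.IsQR x q Q) : T.scalingSpan Q ⟂ T.sampletSpan Q := by
  cases T with
  | leaf v =>
    rw [sampletSpan, scalingSpan, Submodule.isOrtho_span]
    rintro _ _ _ ⟨k, rfl⟩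
    exact k.elim0
  | node l r =>
    rw [sampletSpan, scalingSpan, Submodule.isOrtho_span]
    rintro _ ⟨k, rfl⟩ _ ⟨k', rfl⟩
    rw [scaling_node, samplets_node]
    refine (orthonormal_transformed hT hQ (orthonormal_scaling hT.1 hQ.1)
      (orthonormal_scaling hT.2.1 hQ.2.1)).2 fun h => ?_
    have h1 : k.1 = mq d q + k'.1 := congrArg Fin.val h
    have h2 : k.1 < mq d q := lt_of_lt_of_le k.2 (min_le_left _ _)
    omega

/-- By the two-scale relation the scaling space of a cluster lies in the sum of those of its sons.
For samplets below one son, induction handles the summand of that son, and disjoint supports handle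
the other. -/
theorem scalingSpan_isOrtho_node {T : ClusterTree N} (hT : T.Valid) {Q : T.Transforms (mq d q)}
    (hQ : T.IsQR x q Q) (p : Node T) : T.scalingSpan Q ⟂ p.sampletSpan Q := by
  induction p with
  | root T => exact scalingSpan_isOrtho_sampletSpan hT hQ
  | @left l r p ih =>
    refine Submodule.IsOrtho.mono_left (le_sup_left.trans (span_transformed_eq hQ).le) ?_
    rw [Submodule.isOrtho_sup_left]
    exact ⟨ih hT.1 hQ.1, (sons_isOrtho hT (p.sampletSpan_le Q.1) (scalingSpan_le r Q.2.1)).symm⟩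
  | @right l r p ih =>
    refine Submodule.IsOrtho.mono_left (le_sup_left.trans (span_transformed_eq hQ).le) ?_
    rw [Submodule.isOrtho_sup_left]
    exact ⟨sons_isOrtho hT (scalingSpan_le l Q.1) (p.sampletSpan_le Q.2.1), ih hT.2.1 hQ.2.1⟩

theorem sampletSpan_isOrtho_left {l r : ClusterTree N} (hT : (node l r).Valid)
    {Q : (node l r).Transforms (mq d q)} (hQ : (node l r).IsQR x q Q) (p : Node l) :
    (node l r).sampletSpan Q ⟂ p.sampletSpan Q.1 := by
  refine Submodule.IsOrtho.mono_left (le_sup_right.trans (span_transformed_eq hQ).le) ?_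
  rw [Submodule.isOrtho_sup_left]
  exact ⟨scalingSpan_isOrtho_node hT.1 hQ.1 p,
    (sons_isOrtho hT (p.sampletSpan_le Q.1) (scalingSpan_le r Q.2.1)).symm⟩

theorem sampletSpan_isOrtho_right {l r : ClusterTree N} (hT : (node l r).Valid)
    {Q : (node l r).Transforms (mq d q)} (hQ : (node l r).IsQR x q Q) (p : Node r) :
    (node l r).sampletSpan Q ⟂ p.sampletSpan Q.2.1 := by
  refine Submodule.IsOrtho.mono_left (le_sup_right.trans (span_transformed_eq hQ).le) ?_
  rw [Submodule.isOrtho_sup_left]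
  exact ⟨sons_isOrtho hT (scalingSpan_le l Q.1) (p.sampletSpan_le Q.2.1),
    scalingSpan_isOrtho_node hT.2.1 hQ.2.1 p⟩

/-- If one node lies below the other, the samplets of the upper one are combinations of scaling
functions of its sons; otherwise the two nodes part at a common ancestor and have disjoint clusters.
-/
theorem sampletSpan_isOrtho {T : ClusterTree N} (hT : T.Valid) {Q : T.Transforms (mq d q)}
    (hQ : T.IsQR x q Q) {p p' : Node T} (h : p ≠ p') : p.sampletSpan Q ⟂ p'.sampletSpan Q := by
  induction p with
  | root T =>
    cases p' with
    | root => exact absurd rfl h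
    | left p' => exact sampletSpan_isOrtho_left hT hQ p'
    | right p' => exact sampletSpan_isOrtho_right hT hQ p'
  | left p ih =>
    cases p' with
    | root => exact (sampletSpan_isOrtho_left hT hQ p).symm
    | left p' => exact ih hT.1 hQ.1 fun e => h (by rw [e])
    | right p' => exact sons_isOrtho hT (p.sampletSpan_le Q.1) (p'.sampletSpan_le Q.2.1)
  | right p ih =>
    cases p' with
    | root => exact (sampletSpan_isOrtho_right hT hQ p).symm
    | left p' => exact (sons_isOrtho hT (p'.sampletSpan_le Q.1) (p.sampletSpan_le Q.2.1)).symm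
    | right p' => exact ih hT.2.1 hQ.2.1 fun e => h (by rw [e])

theorem Node.orthonormal_samplets {T : ClusterTree N} (hT : T.Valid) {Q : T.Transforms (mq d q)}
    (hQ : T.IsQR x q Q) (p : Node T) : Orthonormal ℝ (p.samplets Q) :=
  ClusterTree.orthonormal_samplets (p.valid hT) (p.isQR hQ)

theorem orthonormal_sampletBasis {T : ClusterTree N} (hT : T.Valid) {Q : T.Transforms (mq d q)}
    (hQ : T.IsQR x q Q) : Orthonormal ℝ (sampletBasis Q) := by
  have hs : ∀ k (s : Σ p : Node T, Fin (p.subtree.numSamplets (mq d q))),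
      inner ℝ (T.scaling _ Q k) (s.1.samplets Q s.2) = 0 := fun k s =>
    Submodule.isOrtho_iff_inner_eq.1 (scalingSpan_isOrtho_node hT hQ s.1) _
      (Submodule.subset_span ⟨k, rfl⟩) _ (Submodule.subset_span ⟨s.2, rfl⟩)
  constructor
  · rintro (k | s)
    · exact (orthonormal_scaling hT hQ).1 k
    · exact (s.1.orthonormal_samplets hT hQ).1 s.2
  · rintro (k | s) (k' | s') h
    · exact (orthonormal_scaling hT hQ).2 fun e => h (by rw [e])
    · exact hs k s'
    · change inner ℝ _ _ = 0
      rw [real_inner_comm]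
      exact hs k' s
    · obtain ⟨p, k⟩ := s
      obtain ⟨p', k'⟩ := s'
      by_cases e : p = p'
      · subst e
        exact (p.orthonormal_samplets hT hQ).2 fun e : k = k' => h (by rw [e])
      · exact Submodule.isOrtho_iff_inner_eq.1 (sampletSpan_isOrtho hT hQ e) _
          (Submodule.subset_span ⟨k, rfl⟩) _ (Submodule.subset_span ⟨k', rfl⟩)

theorem supportedIn_le_scalingSpan_leaf (v : Finset (Fin N)) (Q : (leaf v).Transforms (mq d q)) :
    supportedIn v ≤ (leaf v).scalingSpan Q := by
  refine supportedIn_le_of_delta_mem fun i hi => Submodule.subset_span ?_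
  have h : i ∈ Set.range (v.orderEmbOfFin rfl) := by
    rw [Finset.range_orderEmbOfFin]; exact hi
  obtain ⟨k, rfl⟩ := h
  exact ⟨k, rfl⟩

theorem supportedIn_union_le {v w : Finset (Fin N)} {U : Submodule ℝ (V N)}
    (hv : supportedIn v ≤ U) (hw : supportedIn w ≤ U) : supportedIn (v ∪ w) ≤ U := by
  refine supportedIn_le_of_delta_mem fun i hi => ?_
  rcases Finset.mem_union.1 hi with h | h
  · exact hv (delta_mem_supportedIn h)
  · exact hw (delta_mem_supportedIn h)

/-- Completeness: the two-scale relation, read from the root downwards, puts the scaling functions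
of all clusters into `U`, and those of the leaves are the point evaluations. -/
theorem supportedIn_cluster_le {T : ClusterTree N} {Q : T.Transforms (mq d q)}
    (hQ : T.IsQR x q Q) {U : Submodule ℝ (V N)} (h : T.scalingSpan Q ≤ U)
    (h' : ∀ p : Node T, p.sampletSpan Q ≤ U) : supportedIn T.cluster ≤ U := by
  induction T with
  | leaf v => exact (supportedIn_le_scalingSpan_leaf v Q).trans h
  | node l r hl hr =>
    have h1 : l.scalingSpan Q.1 ⊔ r.scalingSpan Q.2.1 ≤ U := by
      rw [← span_transformed_eq hQ]
      exact sup_le h (h' (Node.root _))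
    exact supportedIn_union_le
      (hl hQ.1 (le_sup_left.trans h1) fun p => h' p.left)
      (hr hQ.2.1 (le_sup_right.trans h1) fun p => h' p.right)

theorem supportedIn_univ : supportedIn (Finset.univ : Finset (Fin N)) = ⊤ := by
  ext u
  simp [mem_supportedIn]

theorem span_sampletBasis {T : ClusterTree N} (hT : T.cluster = Finset.univ)
    {Q : T.Transforms (mq d q)} (hQ : T.IsQR x q Q) :
    Submodule.span ℝ (Set.range (sampletBasis Q)) = ⊤ := by
  rw [eq_top_iff, ← supportedIn_univ, ← hT]
  apply supportedIn_cluster_le hQ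
  · refine Submodule.span_mono ?_
    rintro _ ⟨k, rfl⟩
    exact ⟨Sum.inl k, rfl⟩
  · refine fun p => Submodule.span_mono ?_
    rintro _ ⟨k, rfl⟩
    exact ⟨Sum.inr ⟨p, k⟩, rfl⟩

/-! ### Multiresolution analysis -/

theorem scalingSpace_zero {m : ℕ} (T : ClusterTree N) (Q : T.Transforms m) :
    scalingSpace Q 0 = T.scalingSpan Q := by
  refine congrArg (Submodule.span ℝ) (Set.ext fun φ => ?_)
  constructor
  · rintro ⟨p, hp, k, rfl⟩
    cases p with
    | root => exact ⟨k, rfl⟩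
    | left p => exact absurd hp (Nat.succ_ne_zero _)
    | right p => exact absurd hp (Nat.succ_ne_zero _)
  · rintro ⟨k, rfl⟩
    exact ⟨Node.root T, rfl, k, rfl⟩

theorem detailSpace_zero {m : ℕ} (T : ClusterTree N) (Q : T.Transforms m) :
    detailSpace Q 0 = T.sampletSpan Q := by
  refine congrArg (Submodule.span ℝ) (Set.ext fun φ => ?_)
  constructor
  · rintro ⟨p, hp, k, rfl⟩
    cases p with
    | root => exact ⟨k, rfl⟩
    | left p => exact absurd hp (Nat.succ_ne_zero _)
    | right p => exact absurd hp (Nat.succ_ne_zero _)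
  · rintro ⟨k, rfl⟩
    exact ⟨Node.root T, rfl, k, rfl⟩

theorem scalingSpace_succ {m : ℕ} (l r : ClusterTree N) (Q : (node l r).Transforms m) (j : ℕ) :
    scalingSpace Q (j + 1) = scalingSpace Q.1 j ⊔ scalingSpace Q.2.1 j := by
  rw [scalingSpace, scalingSpace, scalingSpace, ← Submodule.span_union]
  refine congrArg (Submodule.span ℝ) (Set.ext fun φ => ?_)
  constructor
  · rintro ⟨p, hp, k, rfl⟩
    cases p with
    | root => exact absurd hp.symm (Nat.succ_ne_zero _)
    | left p => exact Or.inl ⟨p, Nat.succ_injective hp, k, rfl⟩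
    | right p => exact Or.inr ⟨p, Nat.succ_injective hp, k, rfl⟩
  · rintro (⟨p, hp, k, rfl⟩ | ⟨p, hp, k, rfl⟩)
    · exact ⟨p.left, congrArg Nat.succ hp, k, rfl⟩
    · exact ⟨p.right, congrArg Nat.succ hp, k, rfl⟩

theorem detailSpace_succ {m : ℕ} (l r : ClusterTree N) (Q : (node l r).Transforms m) (j : ℕ) :
    detailSpace Q (j + 1) = detailSpace Q.1 j ⊔ detailSpace Q.2.1 j := by
  rw [detailSpace, detailSpace, detailSpace, ← Submodule.span_union]
  refine congrArg (Submodule.span ℝ) (Set.ext fun φ => ?_)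
  constructor
  · rintro ⟨p, hp, k, rfl⟩
    cases p with
    | root => exact absurd hp.symm (Nat.succ_ne_zero _)
    | left p => exact Or.inl ⟨p, Nat.succ_injective hp, k, rfl⟩
    | right p => exact Or.inr ⟨p, Nat.succ_injective hp, k, rfl⟩
  · rintro (⟨p, hp, k, rfl⟩ | ⟨p, hp, k, rfl⟩)
    · exact ⟨p.left, congrArg Nat.succ hp, k, rfl⟩
    · exact ⟨p.right, congrArg Nat.succ hp, k, rfl⟩

theorem scalingSpace_le {m : ℕ} (T : ClusterTree N) (Q : T.Transforms m) (j : ℕ) :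
    scalingSpace Q j ≤ supportedIn T.cluster := by
  rw [scalingSpace, Submodule.span_le]
  rintro _ ⟨p, -, k, rfl⟩
  exact p.scalingSpan_le Q (Submodule.subset_span ⟨k, rfl⟩)

theorem detailSpace_le {m : ℕ} (T : ClusterTree N) (Q : T.Transforms m) (j : ℕ) :
    detailSpace Q j ≤ supportedIn T.cluster := by
  rw [detailSpace, Submodule.span_le]
  rintro _ ⟨p, -, k, rfl⟩
  exact p.sampletSpan_le Q (Submodule.subset_span ⟨k, rfl⟩)

theorem IsBalanced.sons {l r : ClusterTree N} {J : ℕ} (h : (node l r).IsBalanced J) :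
    ∃ J', J = J' + 1 ∧ l.IsBalanced J' ∧ r.IsBalanced J' := by
  cases J with
  | zero => exact absurd ((h (Node.root _)).2 rfl) id
  | succ J =>
    exact ⟨J, rfl, fun p => (h p.left).trans Nat.succ_inj, fun p => (h p.right).trans Nat.succ_inj⟩

theorem supportedIn_le_scalingSpace {T : ClusterTree N} {J : ℕ} (hJ : T.IsBalanced J)
    (Q : T.Transforms (mq d q)) : supportedIn T.cluster ≤ scalingSpace Q J := by
  induction T generalizing J with
  | leaf v =>
    have h0 : 0 = J := (hJ (Node.root _)).1 trivial
    rw [← h0, scalingSpace_zero]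
    exact supportedIn_le_scalingSpan_leaf v Q
  | node l r hl hr =>
    obtain ⟨J', rfl, hJl, hJr⟩ := hJ.sons
    rw [scalingSpace_succ]
    exact supportedIn_union_le ((hl hJl Q.1).trans le_sup_left)
      ((hr hJr Q.2.1).trans le_sup_right)

/-- On level `0` this is the two-scale relation at the root. Higher levels decompose into the levels
of the two subtrees, which are balanced with depth one less and orthogonal to each other. -/
theorem scalingSpace_isOrtho_and_sup {T : ClusterTree N} (hT : T.Valid)
    {Q : T.Transforms (mq d q)} (hQ : T.IsQR x q Q) {J j : ℕ} (hJ : T.IsBalanced J) (hj : j < J) :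
    scalingSpace Q j ⟂ detailSpace Q j ∧
      scalingSpace Q j ⊔ detailSpace Q j = scalingSpace Q (j + 1) := by
  induction T generalizing J j with
  | leaf v =>
    have h0 : 0 = J := (hJ (Node.root _)).1 trivial
    omega
  | node l r hl hr =>
    obtain ⟨J', rfl, hJl, hJr⟩ := hJ.sons
    cases j with
    | zero =>
      rw [scalingSpace_succ, scalingSpace_zero, scalingSpace_zero, scalingSpace_zero,
        detailSpace_zero]
      exact ⟨scalingSpan_isOrtho_sampletSpan hT hQ, span_transformed_eq hQ⟩
    | succ j =>
      obtain ⟨ol, sl⟩ := hl hT.1 hQ.1 hJl (Nat.succ_lt_succ_iff.1 hj)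
      obtain ⟨or', sr⟩ := hr hT.2.1 hQ.2.1 hJr (Nat.succ_lt_succ_iff.1 hj)
      rw [scalingSpace_succ, scalingSpace_succ, detailSpace_succ, sup_sup_sup_comm, sl, sr]
      refine ⟨?_, rfl⟩
      rw [Submodule.isOrtho_sup_left, Submodule.isOrtho_sup_right, Submodule.isOrtho_sup_right]
      exact ⟨⟨ol, sons_isOrtho hT (scalingSpace_le l Q.1 j) (detailSpace_le r Q.2.1 j)⟩,
        (sons_isOrtho hT (detailSpace_le l Q.1 j) (scalingSpace_le r Q.2.1 j)).symm, or'⟩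

end QR

end ClusterTree

end Samplet

namespace Samplet

/-! ### Polynomials of total degree at most `q` -/

section Polynomials

variable {d q : ℕ}

/-- The polynomial function with the coefficients `c`. -/
noncomputable def polyEval (c : MultiIndex d q → ℝ) (z : Pt d) : ℝ := ∑ α, c α * monomial α z

/-- The exponent of a multi-index. -/
noncomputable def MultiIndex.exponent (α : MultiIndex d q) : Fin d →₀ ℕ :=
  Finsupp.equivFunOnFinite.symm fun i => (α.1 i : ℕ)

theorem MultiIndex.exponent_injective :
    Function.Injective (MultiIndex.exponent : MultiIndex d q → Fin d →₀ ℕ) := by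
  intro α β h
  apply Subtype.ext
  funext i
  exact Fin.ext (DFunLike.congr_fun h i)

/-- Every exponent of total degree at most `q` has all entries at most `q`, hence comes from some
`MultiIndex`; the other coefficients vanish. -/
theorem exists_polyEval_eq {P : MvPolynomial (Fin d) ℝ} (hP : P.totalDegree ≤ q) :
    ∃ c : MultiIndex d q → ℝ, ∀ z : Pt d, MvPolynomial.eval (fun i => z i) P = polyEval c z := by
  classical
  refine ⟨fun α => P.coeff α.exponent, fun z => ?_⟩
  rw [MvPolynomial.eval_eq']
  have hsub : P.support ⊆ Finset.univ.image (MultiIndex.exponent : MultiIndex d q → _) := by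
    intro s hs
    have hdeg : ∑ i, s i ≤ q := by
      have := (MvPolynomial.le_totalDegree hs).trans hP
      rwa [Finsupp.sum_fintype _ _ fun _ => rfl] at this
    have hlt : ∀ i, s i < q + 1 := fun i =>
      Nat.lt_succ_of_le ((Finset.single_le_sum (fun j _ => Nat.zero_le (s j))
        (Finset.mem_univ i)).trans hdeg)
    refine Finset.mem_image.2 ⟨⟨fun i => ⟨s i, hlt i⟩, hdeg⟩, Finset.mem_univ _, ?_⟩
    ext i
    rfl
  rw [Finset.sum_subset hsub, Finset.sum_image fun a _ b _ h => MultiIndex.exponent_injective h]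
  · rfl
  · intro s _ hs
    rw [MvPolynomial.notMem_support_iff.1 hs, zero_mul]

theorem totalDegree_monomial_exponent (α : MultiIndex d q) (a : ℝ) :
    (MvPolynomial.monomial α.exponent a).totalDegree ≤ q := by
  refine (MvPolynomial.totalDegree_monomial_le _ _).trans ?_
  rw [Finsupp.sum_fintype _ _ fun _ => rfl]
  exact α.2

theorem exists_eval_eq (c : MultiIndex d q → ℝ) :
    ∃ P : MvPolynomial (Fin d) ℝ, P.totalDegree ≤ q ∧
      (∀ α : MultiIndex d q, P.coeff α.exponent = c α) ∧
      ∀ z : Pt d, MvPolynomial.eval (fun i => z i) P = polyEval c z := by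
  classical
  refine ⟨∑ α, MvPolynomial.monomial α.exponent (c α), ?_, fun α => ?_, fun z => ?_⟩
  · exact MvPolynomial.totalDegree_finsetSum_le fun α _ => totalDegree_monomial_exponent α (c α)
  · rw [MvPolynomial.coeff_sum, Finset.sum_eq_single α]
    · simp
    · intro β _ h
      rw [MvPolynomial.coeff_monomial, if_neg fun e => h (MultiIndex.exponent_injective e)]
    · simp
  · rw [map_sum]
    refine Finset.sum_congr rfl fun α _ => ?_
    rw [MvPolynomial.eval_monomial, Finsupp.prod_fintype _ _ fun _ => pow_zero _]
    rfl

theorem polyEval_add (a b : MultiIndex d q → ℝ) (z : Pt d) :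
    polyEval (a + b) z = polyEval a z + polyEval b z := by
  simp [polyEval, add_mul, Finset.sum_add_distrib]

theorem polyEval_smul (t : ℝ) (a : MultiIndex d q → ℝ) (z : Pt d) :
    polyEval (t • a) z = t * polyEval a z := by
  simp [polyEval, Finset.mul_sum, mul_assoc]

end Polynomials

/-! ### Vanishing moments and coefficient vectors -/

namespace ClusterTree

section Moments

variable {d N q : ℕ} {x : Fin N → Pt d}

theorem pairing_monomial_samplets {T : ClusterTree N} {Q : T.Transforms (mq d q)}
    (hQ : T.IsQR x q Q) (k : Fin (T.numSamplets (mq d q))) (α : MultiIndex d q) :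
    pairing x (monomial α) (T.samplets _ Q k) = 0 := by
  cases T with
  | leaf v => exact k.elim0
  | node l r =>
    obtain ⟨-, -, hO, e, R, hR, hM⟩ := hQ
    have h1 := (Matrix.mem_orthogonalGroup_iff' _ ℝ).1 hO
    have h2 : Q.2.2.transpose * (Matrix.of fun (a : Fin (mq d q)) i => pairing x (monomial (e a))
          (Fin.append (l.scaling (mq d q) Q.1) (r.scaling (mq d q) Q.2.1) i)).transpose = R := by
      rw [hM, ← Matrix.mul_assoc]
      erw [h1]
      rw [Matrix.one_mul]
    -- The row index `mq d q + k` exceeds every column index, so this entry of `R` is zero; it is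
    -- the moment of the `k`-th samplet.
    have h3 := congrFun (congrFun h2 ⟨mq d q + k.1, Nat.add_lt_of_lt_sub' k.2⟩) (e.symm α)
    rw [hR _ _ (by have := (e.symm α).2; simp only; omega), Matrix.mul_apply] at h3
    simp only [Matrix.transpose_apply, Matrix.of_apply, Equiv.apply_symm_apply] at h3
    rw [samplets, pairing_sum_smul]
    exact h3

theorem pairing_polyEval_samplets {T : ClusterTree N} {Q : T.Transforms (mq d q)}
    (hQ : T.IsQR x q Q) (k : Fin (T.numSamplets (mq d q))) (c : MultiIndex d q → ℝ) :
    pairing x (polyEval c) (T.samplets _ Q k) = 0 := by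
  have h := pairing_finset_sum x (T.samplets _ Q k) Finset.univ c fun α : MultiIndex d q =>
    monomial α
  simp only [pairing_monomial_samplets hQ, mul_zero, Finset.sum_const_zero] at h
  exact h

theorem pairing_eval_samplets {T : ClusterTree N} {Q : T.Transforms (mq d q)}
    (hQ : T.IsQR x q Q) (k : Fin (T.numSamplets (mq d q))) {P : MvPolynomial (Fin d) ℝ}
    (hP : P.totalDegree ≤ q) :
    pairing x (fun z => MvPolynomial.eval (fun i => z i) P) (T.samplets _ Q k) = 0 := by
  obtain ⟨c, hc⟩ := exists_polyEval_eq hP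
  simp only [hc]
  exact pairing_polyEval_samplets hQ k c

theorem samplets_ne_zero {T : ClusterTree N} (hT : T.Valid) {Q : T.Transforms (mq d q)}
    (hQ : T.IsQR x q Q) (k : Fin (T.numSamplets (mq d q))) : T.samplets _ Q k ≠ 0 :=
  (orthonormal_samplets hT hQ).ne_zero k

theorem sum_samplets_eq_zero {T : ClusterTree N} {Q : T.Transforms (mq d q)}
    (hQ : T.IsQR x q Q) (k : Fin (T.numSamplets (mq d q))) : ∑ i, T.samplets _ Q k i = 0 := by
  have h := pairing_eval_samplets hQ k (P := 1) (by simp)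
  simpa [pairing] using h

/-- A samplet is not zero and its coefficients add up to zero, by the moment of the constant
polynomial. -/
theorem exists_ne_mem_supp {T : ClusterTree N} (hT : T.Valid) {Q : T.Transforms (mq d q)}
    (hQ : T.IsQR x q Q) (k : Fin (T.numSamplets (mq d q))) :
    ∃ i ∈ supp (T.samplets _ Q k), ∃ j ∈ supp (T.samplets _ Q k), i ≠ j := by
  have h0 := samplets_ne_zero hT hQ k
  have hs := sum_samplets_eq_zero hQ k
  obtain ⟨i, hi⟩ : ∃ i, T.samplets _ Q k i ≠ 0 := by
    by_contra! h
    exact h0 (by ext i; simpa using h i)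
  refine ⟨i, by simpa [supp] using hi, ?_⟩
  by_contra! h
  rw [Finset.sum_eq_single i] at hs
  · exact hi hs
  · intro j _ hj
    by_contra hne
    exact hj (h j (by simpa [supp] using hne)).symm
  · simp

theorem sum_abs_le_sqrt_card {v : Finset (Fin N)} {u : V N} (hu : supp u ⊆ v) (h1 : ‖u‖ = 1) :
    ∑ i, |u i| ≤ √(v.card : ℝ) := by
  have hs : ∑ i, |u i| = ∑ i ∈ v, |u i| := by
    symm
    refine Finset.sum_subset (Finset.subset_univ v) fun i _ hi => ?_
    rw [supp_subset_iff.1 hu i hi, abs_zero]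
  have hn : ∑ i ∈ v, |u i| ^ 2 ≤ 1 := by
    have h2 : ∑ i, |u i| ^ 2 = 1 := by
      have := EuclideanSpace.norm_sq_eq u
      rw [h1] at this
      simpa using this.symm
    rw [← h2]
    exact Finset.sum_le_sum_of_subset_of_nonneg (Finset.subset_univ v) fun i _ _ => sq_nonneg _
  rw [hs]
  refine Real.le_sqrt_of_sq_le ((sq_sum_le_card_mul_sum_sq (s := v) (f := fun i => |u i|)).trans ?_)
  exact mul_le_of_le_one_right (Nat.cast_nonneg _) hn

theorem samplets_mem_supportedIn {T : ClusterTree N} (Q : T.Transforms (mq d q)) (p : Node T)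
    (k : Fin (p.subtree.numSamplets (mq d q))) : p.samplets Q k ∈ supportedIn p.cluster :=
  ClusterTree.sampletSpan_le p.subtree (p.transforms Q) (Submodule.subset_span ⟨k, rfl⟩)

/-! ### Polynomials are combinations of scaling functions -/

/-- The element of `V` with the values of a polynomial on `v` as coefficients. -/
noncomputable def polyVec (x : Fin N → Pt d) (v : Finset (Fin N)) :
    (MultiIndex d q → ℝ) →ₗ[ℝ] V N where
  toFun c := ∑ i ∈ v, polyEval c (x i) • delta i
  map_add' a b := by simp only [polyEval_add, add_smul, Finset.sum_add_distrib]
  map_smul' t a := by simp only [polyEval_smul, mul_smul, Finset.smul_sum, RingHom.id_apply]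

theorem polyVec_apply (v : Finset (Fin N)) (c : MultiIndex d q → ℝ) (i : Fin N) :
    polyVec x v c i = if i ∈ v then polyEval c (x i) else 0 := by
  simp only [polyVec, LinearMap.coe_mk, AddHom.coe_mk, WithLp.ofLp_sum, WithLp.ofLp_smul,
    Finset.sum_apply, Pi.smul_apply, delta_apply, smul_eq_mul, mul_ite, mul_one, mul_zero,
    Finset.sum_ite_eq]

theorem polyVec_mem_supportedIn (v : Finset (Fin N)) (c : MultiIndex d q → ℝ) :
    polyVec x v c ∈ supportedIn v := fun i hi => by rw [polyVec_apply, if_neg hi]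

theorem polyVec_union {v w : Finset (Fin N)} (h : Disjoint v w) (c : MultiIndex d q → ℝ) :
    polyVec x (v ∪ w) c = polyVec x v c + polyVec x w c :=
  Finset.sum_union h

/-- By induction the polynomial lies in the sum of the scaling spaces of the sons. Vanishing moments
say that it is orthogonal to the samplets, so its samplet component is zero. -/
theorem polyVec_mem_scalingSpan {T : ClusterTree N} (hT : T.Valid) {Q : T.Transforms (mq d q)}
    (hQ : T.IsQR x q Q) (c : MultiIndex d q → ℝ) : polyVec x T.cluster c ∈ T.scalingSpan Q := by
  induction T with
  | leaf v => exact supportedIn_le_scalingSpan_leaf v Q (polyVec_mem_supportedIn v c)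
  | node l r hl hr =>
    have hmem : polyVec x (node l r).cluster c ∈
        (node l r).scalingSpan Q ⊔ (node l r).sampletSpan Q := by
      rw [span_transformed_eq hQ]
      change polyVec x (l.cluster ∪ r.cluster) c ∈ _
      rw [polyVec_union hT.2.2]
      exact Submodule.add_mem_sup (hl hT.1 hQ.1) (hr hT.2.1 hQ.2.1)
    have horth : ∀ b ∈ (node l r).sampletSpan Q,
        inner ℝ (polyVec x (node l r).cluster c) b = 0 := by
      have : Submodule.span ℝ {polyVec x (node l r).cluster c} ⟂ (node l r).sampletSpan Q := by
        rw [sampletSpan, Submodule.isOrtho_span]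
        rintro _ rfl _ ⟨k, rfl⟩
        have hk : (node l r).samplets _ Q k ∈ supportedIn (node l r).cluster :=
          sampletSpan_le _ Q (Submodule.subset_span ⟨k, rfl⟩)
        have h0 := pairing_polyEval_samplets hQ k c
        rw [pairing_eq_sum_of_supp x hk] at h0
        rw [inner_eq_sum, ← h0]
        symm
        rw [← Finset.sum_subset (Finset.subset_univ (node l r).cluster)]
        · refine Finset.sum_congr rfl fun i hi => ?_
          rw [polyVec_apply, if_pos hi, mul_comm]
        · intro i _ hi
          rw [polyVec_apply, if_neg hi, zero_mul]
      exact fun b hb => Submodule.isOrtho_iff_inner_eq.1 this _ (Submodule.mem_span_singleton_self _)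
        b hb
    obtain ⟨a, ha, b, hb, hab⟩ := Submodule.mem_sup.1 hmem
    have h1 := horth b hb
    rw [← hab, inner_add_left,
      Submodule.isOrtho_iff_inner_eq.1 (scalingSpan_isOrtho_sampletSpan hT hQ) a ha b hb, zero_add,
      inner_self_eq_zero] at h1
    rw [← hab, h1, add_zero]
    exact ha

/-- If polynomials are determined by their values on a cluster with sons, then the restrictions of
polynomials are the only combinations of scaling functions of the cluster. -/
theorem exists_polyVec_eq {T : ClusterTree N} (hT : T.Valid) (hleaf : ¬ T.IsLeaf)
    {Q : T.Transforms (mq d q)} (hQ : T.IsQR x q Q)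
    (hinj : ∀ c : MultiIndex d q → ℝ, (∀ i ∈ T.cluster, polyEval c (x i) = 0) → c = 0)
    {u : V N} (hu : u ∈ T.scalingSpan Q) : ∃ c : MultiIndex d q → ℝ, polyVec x T.cluster c = u := by
  have hle : LinearMap.range (polyVec x T.cluster : (MultiIndex d q → ℝ) →ₗ[ℝ] V N) ≤
      T.scalingSpan Q := by
    rintro _ ⟨c, rfl⟩
    exact polyVec_mem_scalingSpan hT hQ c
  have hker : Function.Injective (polyVec x T.cluster : (MultiIndex d q → ℝ) →ₗ[ℝ] V N) := by
    rw [← LinearMap.ker_eq_bot, LinearMap.ker_eq_bot']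
    intro c hc
    refine hinj c fun i hi => ?_
    have := polyVec_apply (x := x) T.cluster c i
    rw [hc, if_pos hi] at this
    simpa using this.symm
  -- A leaf may have more than `mq d q` scaling functions; with sons there are at most as many as
  -- polynomial coefficients, so the inclusion `hle` is an equality of dimensions.
  have hnum : T.numScaling (mq d q) ≤ mq d q := by
    cases T with
    | leaf v => exact absurd trivial hleaf
    | node l r => exact min_le_left _ _
  have heq := Submodule.eq_of_le_of_finrank_le hle (by
    rw [LinearMap.finrank_range_of_inj hker, Module.finrank_fintype_fun_eq_card, scalingSpan,
      finrank_span_eq_card (orthonormal_scaling hT hQ).linearIndependent, Fintype.card_fin]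
    exact hnum)
  rw [← heq] at hu
  exact hu

/-- On a son on which polynomials are determined by their values, a samplet is a polynomial. -/
theorem exists_polyEval_eq_samplets {l r : ClusterTree N} (hT : (node l r).Valid)
    {Q : (node l r).Transforms (mq d q)} (hQ : (node l r).IsQR x q Q)
    (k : Fin ((node l r).numSamplets (mq d q))) {T : ClusterTree N} (hson : T = l ∨ T = r)
    (hleaf : ¬ T.IsLeaf)
    (hinj : ∀ c : MultiIndex d q → ℝ, (∀ i ∈ T.cluster, polyEval c (x i) = 0) → c = 0) :
    ∃ c : MultiIndex d q → ℝ, ∀ i ∈ T.cluster, (node l r).samplets _ Q k i = polyEval c (x i) := by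
  have hmem : (node l r).samplets _ Q k ∈ l.scalingSpan Q.1 ⊔ r.scalingSpan Q.2.1 := by
    rw [← span_transformed_eq hQ]
    exact Submodule.mem_sup_right (Submodule.subset_span ⟨k, rfl⟩)
  obtain ⟨a, ha, b, hb, hab⟩ := Submodule.mem_sup.1 hmem
  rcases hson with rfl | rfl
  · obtain ⟨c, hc⟩ := exists_polyVec_eq hT.1 hleaf hQ.1 hinj ha
    refine ⟨c, fun i hi => ?_⟩
    rw [← hab, PiLp.add_apply, scalingSpan_le _ _ hb i (Finset.disjoint_left.1 hT.2.2 hi), add_zero,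
      ← hc, polyVec_apply, if_pos hi]
  · obtain ⟨c, hc⟩ := exists_polyVec_eq hT.2.1 hleaf hQ.2.1 hinj hb
    refine ⟨c, fun i hi => ?_⟩
    rw [← hab, PiLp.add_apply, scalingSpan_le _ _ ha i (Finset.disjoint_right.1 hT.2.2 hi), zero_add,
      ← hc, polyVec_apply, if_pos hi]

end Moments

end ClusterTree

end Samplet

namespace Samplet

/-! ### A centre of a finite set of points -/

/-- Every finite set of diameter `D` in an inner product space is contained in a ball of radius
`D / √2` around a point of its convex hull. -/
theorem exists_mem_convexHull_sq_norm_le {E ι : Type*} [NormedAddCommGroup E]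
    [InnerProductSpace ℝ E] [Fintype ι] [Nonempty ι] (x : ι → E) {D : ℝ}
    (hD : ∀ i j, dist (x i) (x j) ≤ D) :
    ∃ c ∈ convexHull ℝ (Set.range x), ∀ k, 2 * ‖x k - c‖ ^ 2 ≤ D ^ 2 := by
  classical
  -- The centre is the barycentre for weights that maximize the variance `F` over the simplex.
  let F : (ι → ℝ) → ℝ := fun w => ∑ i, w i * ‖x i‖ ^ 2 - ‖∑ i, w i • x i‖ ^ 2
  have hF : ContinuousOn F (stdSimplex ℝ ι) := by
    apply Continuous.continuousOn
    fun_prop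
  obtain ⟨w, hw, hmax⟩ := (isCompact_stdSimplex ℝ ι).exists_isMaxOn
    ⟨_, single_mem_stdSimplex ℝ (Classical.arbitrary ι)⟩ hF
  set c := ∑ i, w i • x i with hc
  set A := ∑ i, w i * ‖x i‖ ^ 2 with hA
  refine ⟨c, ?_, fun k => ?_⟩
  · rw [hc]
    exact (convex_convexHull ℝ _).sum_mem (fun i _ => hw.1 i) hw.2 fun i _ =>
      subset_convexHull ℝ _ ⟨i, rfl⟩
  · have hk : ‖x k - c‖ ^ 2 = ‖x k‖ ^ 2 - 2 * inner ℝ (x k) c + ‖c‖ ^ 2 := norm_sub_sq_real _ _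
    -- The right-hand side equals `F w + ‖x k - c‖ ^ 2`, so it remains to show that `‖x k - c‖ ^ 2`
    -- is at most `F w`.
    have hsum : ∑ i, w i * ‖x i - x k‖ ^ 2 = A - 2 * inner ℝ (x k) c + ‖x k‖ ^ 2 := by
      have : ∀ i, w i * ‖x i - x k‖ ^ 2 =
          w i * ‖x i‖ ^ 2 - 2 * inner ℝ (x k) (w i • x i) + w i * ‖x k‖ ^ 2 := by
        intro i
        rw [norm_sub_sq_real, inner_smul_right, real_inner_comm]
        ring
      simp only [this]
      rw [Finset.sum_add_distrib, Finset.sum_sub_distrib, ← Finset.mul_sum, ← inner_sum,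
        ← Finset.sum_mul, hw.2, one_mul]
    have hle : ∑ i, w i * ‖x i - x k‖ ^ 2 ≤ D ^ 2 := by
      calc ∑ i, w i * ‖x i - x k‖ ^ 2 ≤ ∑ i, w i * D ^ 2 := by
            refine Finset.sum_le_sum fun i _ => mul_le_mul_of_nonneg_left ?_ (hw.1 i)
            have := hD i k
            rw [dist_eq_norm] at this
            exact pow_le_pow_left₀ (norm_nonneg _) this 2
        _ = D ^ 2 := by rw [← Finset.sum_mul, hw.2, one_mul]
    -- First-order condition at the maximum: compare `F` at `w` and at `(1 - t) w + t e_k`, and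
    -- divide by `t`. Small `t` then gives the claim.
    have hderiv : ∀ t : ℝ, 0 < t → t ≤ 1 →
        ‖x k - c‖ ^ 2 - (A - ‖c‖ ^ 2) ≤ t * ‖x k - c‖ ^ 2 := by
      intro t ht ht1
      have hmem : (1 - t) • w + t • Pi.single k (1 : ℝ) ∈ stdSimplex ℝ ι :=
        convex_stdSimplex ℝ ι hw (single_mem_stdSimplex ℝ k) (by linarith) ht.le (by ring)
      have h1 : F ((1 - t) • w + t • Pi.single k (1 : ℝ)) ≤ F w := hmax hmem
      have e1 : ∑ i, ((1 - t) • w + t • Pi.single k (1 : ℝ) : ι → ℝ) i * ‖x i‖ ^ 2 =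
          (1 - t) * A + t * ‖x k‖ ^ 2 := by
        simp only [Pi.add_apply, Pi.smul_apply, smul_eq_mul, add_mul, Finset.sum_add_distrib,
          mul_assoc, ← Finset.mul_sum, Pi.single_apply, ite_mul, one_mul, zero_mul,
          Finset.sum_ite_eq', Finset.mem_univ, if_true, hA]
      have e2 : ∑ i, ((1 - t) • w + t • Pi.single k (1 : ℝ) : ι → ℝ) i • x i = (1 - t) • c + t • x k := by
        simp only [Pi.add_apply, Pi.smul_apply, smul_eq_mul, add_smul, Finset.sum_add_distrib,
          mul_smul, ← Finset.smul_sum, Pi.single_apply, ite_smul, one_smul, zero_smul,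
          Finset.sum_ite_eq', Finset.mem_univ, if_true, hc]
      have e3 : ‖(1 - t) • c + t • x k‖ ^ 2 =
          (1 - t) ^ 2 * ‖c‖ ^ 2 + 2 * ((1 - t) * t * inner ℝ (x k) c) + t ^ 2 * ‖x k‖ ^ 2 := by
        rw [norm_add_sq_real, norm_smul, norm_smul, inner_smul_left, inner_smul_right,
          real_inner_comm, mul_pow, mul_pow, Real.norm_eq_abs, Real.norm_eq_abs, sq_abs, sq_abs]
        simp only [conj_trivial]
        ring
      simp only [F] at h1
      rw [e1, e2, e3] at h1
      have h2 : t * (‖x k - c‖ ^ 2 - (A - ‖c‖ ^ 2)) ≤ t * (t * ‖x k - c‖ ^ 2) := by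
        rw [hk]
        nlinarith [h1]
      exact le_of_mul_le_mul_left h2 ht
    have hF' : ‖x k - c‖ ^ 2 ≤ A - ‖c‖ ^ 2 := by
      by_contra! hlt
      have hpos : 0 < ‖x k - c‖ ^ 2 - (A - ‖c‖ ^ 2) := by linarith
      have hn : 0 ≤ ‖x k - c‖ ^ 2 := sq_nonneg _
      set a := ‖x k - c‖ ^ 2
      set b := a - (A - ‖c‖ ^ 2)
      have hba : b ≤ a := by simpa using hderiv 1 one_pos le_rfl
      have ha : 0 < a := hpos.trans_le hba
      have h1 := hderiv (b / (2 * a)) (by positivity) (by rw [div_le_one (by positivity)]; linarith)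
      have h2 : b / (2 * a) * a = b / 2 := by field_simp
      linarith
    linarith

section Diam

variable {d N : ℕ} (x : Fin N → Pt d)

theorem isBounded_image (v : Finset (Fin N)) : Bornology.IsBounded (x '' (v : Set (Fin N))) :=
  (v.finite_toSet.image x).isBounded

theorem dist_le_diam {v : Finset (Fin N)} {i j : Fin N} (hi : i ∈ v) (hj : j ∈ v) :
    dist (x i) (x j) ≤ diam x v :=
  Metric.dist_le_diam_of_mem (isBounded_image x v) ⟨i, hi, rfl⟩ ⟨j, hj, rfl⟩

theorem diam_nonneg (v : Finset (Fin N)) : 0 ≤ diam x v := Metric.diam_nonneg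

theorem diam_mono {v w : Finset (Fin N)} (h : v ⊆ w) : diam x v ≤ diam x w :=
  Metric.diam_mono (Set.image_mono (Finset.coe_subset.2 h)) (isBounded_image x w)

theorem sq_sum_abs_le (h : Pt d) : (∑ k, |h k|) ^ 2 ≤ d * ‖h‖ ^ 2 := by
  have h1 := sq_sum_le_card_mul_sum_sq (s := (Finset.univ : Finset (Fin d))) (f := fun k => |h k|)
  rw [EuclideanSpace.norm_sq_eq]
  simpa using h1

/-- For `d ≥ 2`, a Euclidean radius `diam / √2` gives the `ℓ¹` radius `√(d / 2) * diam`, which is at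
most `d / 2 * diam`. This comparison fails for `d = 1`, where the midpoint of the extreme points
serves instead. -/
theorem exists_centre {v : Finset (Fin N)} (hv : v.Nonempty) :
    ∃ y ∈ convexHull ℝ (x '' (v : Set (Fin N))), ∀ i ∈ v,
      ∑ k, |x i k - y k| ≤ (d : ℝ) / 2 * diam x v := by
  have hD := diam_nonneg x v
  obtain ⟨i₀, hi₀⟩ := hv
  rcases Nat.lt_or_ge d 2 with hd | hd
  · interval_cases d
    · exact ⟨x i₀, subset_convexHull ℝ _ ⟨i₀, hi₀, rfl⟩, fun i _ => by simp⟩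
    · obtain ⟨a, ha, hmin⟩ := v.exists_min_image (fun i => x i 0) ⟨i₀, hi₀⟩
      obtain ⟨b, hb, hmax⟩ := v.exists_max_image (fun i => x i 0) ⟨i₀, hi₀⟩
      have hab := dist_le_diam x hb ha
      have h1 : x b 0 - x a 0 ≤ diam x v := by
        refine le_trans ?_ hab
        rw [EuclideanSpace.dist_eq]
        refine Real.le_sqrt_of_sq_le ?_
        simp [Real.dist_eq]
      refine ⟨midpoint ℝ (x a) (x b), (convex_convexHull ℝ _).midpoint_mem
        (subset_convexHull ℝ _ ⟨a, ha, rfl⟩) (subset_convexHull ℝ _ ⟨b, hb, rfl⟩), fun i hi => ?_⟩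
      have h2 := hmin i hi
      have h3 := hmax i hi
      have h4 : (midpoint ℝ (x a) (x b)) 0 = (x a 0 + x b 0) / 2 := by
        rw [midpoint_eq_smul_add]
        simp
        ring
      simp only [Finset.univ_unique, Fin.default_eq_zero, Finset.sum_singleton, Fin.isValue, h4]
      rw [abs_le]
      constructor <;> push_cast <;> linarith
  · have : Nonempty v := ⟨⟨i₀, hi₀⟩⟩
    obtain ⟨c, hc, hle⟩ := exists_mem_convexHull_sq_norm_le (fun i : v => x i)
      (D := diam x v) fun i j => dist_le_diam x i.2 j.2
    refine ⟨c, ?_, fun i hi => ?_⟩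
    · convert hc using 2
      ext z
      simp
    · have h1 := hle ⟨i, hi⟩
      have h2 := sq_sum_abs_le (x i - c)
      simp only [PiLp.sub_apply] at h2
      have hd' : (2 : ℝ) ≤ d := by exact_mod_cast hd
      refine le_of_sq_le_sq ?_ (by positivity)
      simp only at h1
      nlinarith [sq_nonneg (diam x v), mul_nonneg (by linarith : (0 : ℝ) ≤ d)
        (sq_nonneg (diam x v)), mul_le_mul_of_nonneg_left h1 (by linarith : (0 : ℝ) ≤ d)]

end Diam

/-! ### Taylor's formula -/

section Taylor

variable {d : ℕ}

theorem sum_smul_single (h : Pt d) : ∑ i, h i • EuclideanSpace.single i (1 : ℝ) = h := by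
  ext j
  simp [Pi.single_apply]

theorem multilinear_apply_eq_sum {n : ℕ} (D : ContinuousMultilinearMap ℝ (fun _ : Fin n => Pt d) ℝ)
    (h : Pt d) : D (fun _ => h) =
      ∑ ι : Fin n → Fin d, (∏ a, h (ι a)) * D fun a => EuclideanSpace.single (ι a) (1 : ℝ) := by
  have h1 : (fun _ : Fin n => h) = fun _ => ∑ i, h i • EuclideanSpace.single i (1 : ℝ) := by
    rw [sum_smul_single]
  rw [h1, ContinuousMultilinearMap.map_sum]
  refine Finset.sum_congr rfl fun ι _ => ?_
  rw [ContinuousMultilinearMap.map_smul_univ, smul_eq_mul]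

/-- Expanding in coordinates produces the `ℓ¹` norm of `h`, which is why `exists_centre` measures
distances in that norm. -/
theorem abs_multilinear_apply_le {n : ℕ}
    (D : ContinuousMultilinearMap ℝ (fun _ : Fin n => Pt d) ℝ) {M : ℝ}
    (hM : ∀ ι : Fin n → Fin d, |D fun a => EuclideanSpace.single (ι a) (1 : ℝ)| ≤ M) (h : Pt d) :
    |D fun _ => h| ≤ M * (∑ i, |h i|) ^ n := by
  rw [multilinear_apply_eq_sum, Fintype.sum_pow, Finset.mul_sum]
  refine (Finset.abs_sum_le_sum_abs _ _).trans (Finset.sum_le_sum fun ι _ => ?_)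
  rw [abs_mul, Finset.abs_prod, mul_comm]
  exact mul_le_mul_of_nonneg_right (hM ι) (Finset.prod_nonneg fun _ _ => abs_nonneg _)

/-- The Taylor polynomial of degree `q` of `f` at `y`. -/
noncomputable def taylorPoly (q : ℕ) (f : Pt d → ℝ) (y : Pt d) : MvPolynomial (Fin d) ℝ :=
  ∑ n ∈ Finset.range (q + 1), ∑ ι : Fin n → Fin d,
    MvPolynomial.C ((n.factorial : ℝ)⁻¹ *
      iteratedFDeriv ℝ n f y fun a => EuclideanSpace.single (ι a) (1 : ℝ)) *
      ∏ a, (MvPolynomial.X (ι a) - MvPolynomial.C (y (ι a)))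

theorem totalDegree_taylorPoly_le (q : ℕ) (f : Pt d → ℝ) (y : Pt d) :
    (taylorPoly q f y).totalDegree ≤ q := by
  refine MvPolynomial.totalDegree_finsetSum_le fun n hn =>
    MvPolynomial.totalDegree_finsetSum_le fun ι _ => ?_
  refine (MvPolynomial.totalDegree_mul _ _).trans ?_
  rw [MvPolynomial.totalDegree_C, zero_add]
  refine (MvPolynomial.totalDegree_finsetProd _ _).trans ?_
  refine (Finset.sum_le_card_nsmul _ _ 1 fun a _ => ?_).trans ?_
  · refine (MvPolynomial.totalDegree_sub _ _).trans ?_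
    simp [MvPolynomial.totalDegree_X]
  · simpa using Nat.lt_succ_iff.1 (Finset.mem_range.1 hn)

theorem eval_taylorPoly (q : ℕ) (f : Pt d → ℝ) (y h : Pt d) :
    MvPolynomial.eval (fun i => (y + h) i) (taylorPoly q f y) =
      ∑ n ∈ Finset.range (q + 1), (n.factorial : ℝ)⁻¹ • iteratedFDeriv ℝ n f y fun _ => h := by
  simp only [taylorPoly, map_sum, map_mul, map_prod, map_sub, MvPolynomial.eval_C,
    MvPolynomial.eval_X, PiLp.add_apply, add_sub_cancel_left]
  refine Finset.sum_congr rfl fun n _ => ?_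
  rw [multilinear_apply_eq_sum, smul_eq_mul, Finset.mul_sum]
  refine Finset.sum_congr rfl fun ι _ => by ring

/-- Integral form of the remainder along the segment; the integral of `(1 - t) ^ q` supplies the
factor that completes `q !` to `(q + 1)!`. -/
theorem abs_sub_taylorPoly_le {q : ℕ} {Ω : Set (Pt d)} (ho : IsOpen Ω) {f : Pt d → ℝ}
    (hf : ContDiffOn ℝ ((q + 1 : ℕ) : WithTop ℕ∞) f Ω) {M : ℝ}
    (hM : ∀ y ∈ Ω, ∀ ι : Fin (q + 1) → Fin d,
      |iteratedFDeriv ℝ (q + 1) f y fun a => EuclideanSpace.single (ι a) (1 : ℝ)| ≤ M)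
    {y z : Pt d} (hseg : segment ℝ y z ⊆ Ω) :
    |f z - MvPolynomial.eval (fun i => z i) (taylorPoly q f y)| ≤
      M * ((∑ k, |z k - y k|) ^ (q + 1) / ((q + 1).factorial : ℝ)) := by
  obtain ⟨h, rfl⟩ : ∃ h, z = y + h := ⟨z - y, by abel⟩
  have hmem : ∀ t ∈ Set.Icc (0 : ℝ) 1, y + t • h ∈ Ω := fun t ht => hseg (by
    rw [segment_eq_image']
    exact ⟨t, ht, by simp⟩)
  have hT := map_add_eq_sum_add_integral_iteratedFDeriv (f := f) (x := y) (y := h) (n := q)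
    fun t ht => by
      have := hf.contDiffAt (ho.mem_nhds (hmem t ht))
      exact_mod_cast this
  rw [eval_taylorPoly, hT, add_sub_cancel_left, smul_eq_mul, abs_mul,
    abs_of_nonneg (by positivity : (0 : ℝ) ≤ (q.factorial : ℝ)⁻¹)]
  have hint : |∫ t in (0 : ℝ)..1, (1 - t) ^ q • iteratedFDeriv ℝ (q + 1) f (y + t • h) fun _ => h| ≤
      ∫ t in (0 : ℝ)..1, (1 - t) ^ q * (M * (∑ k, |h k|) ^ (q + 1)) := by
    rw [← Real.norm_eq_abs]
    refine intervalIntegral.norm_integral_le_of_norm_le zero_le_one ?_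
      (Continuous.intervalIntegrable (by fun_prop) _ _)
    refine Filter.Eventually.of_forall fun t ht => ?_
    have ht0 : 0 ≤ 1 - t := by linarith [ht.2]
    rw [norm_smul, Real.norm_eq_abs, Real.norm_eq_abs, abs_of_nonneg (pow_nonneg ht0 q)]
    exact mul_le_mul_of_nonneg_left
      (abs_multilinear_apply_le _ (hM _ (hmem t ⟨ht.1.le, ht.2⟩)) h) (pow_nonneg ht0 q)
  have hval : ∫ t in (0 : ℝ)..1, (1 - t) ^ q * (M * (∑ k, |h k|) ^ (q + 1)) =
      (M * (∑ k, |h k|) ^ (q + 1)) / (q + 1) := by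
    rw [intervalIntegral.integral_mul_const,
      intervalIntegral.integral_comp_sub_left (fun t => t ^ q) 1]
    simp
    ring
  rw [hval] at hint
  simp only [PiLp.add_apply, add_sub_cancel_left]
  refine (mul_le_mul_of_nonneg_left hint (by positivity)).trans_eq ?_
  rw [Nat.factorial_succ]
  push_cast
  field_simp

end Taylor

/-! ### Samplet coefficients of smooth functions -/

namespace ClusterTree

section SmoothFunctions

variable {d N q : ℕ} {x : Fin N → Pt d}

theorem enorm_iteratedFDeriv_le_cNorm {k n : ℕ} (hn : n ≤ k) {Ω : Set (Pt d)} {f : Pt d → ℝ}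
    {y : Pt d} (hy : y ∈ Ω) (ι : Fin n → Fin d) :
    ‖iteratedFDeriv ℝ n f y fun a => EuclideanSpace.single (ι a) (1 : ℝ)‖ₑ ≤ cNorm k Ω f :=
  le_iSup_of_le n <| le_iSup_of_le hn <| le_iSup_of_le ι <| le_iSup_of_le y <|
    le_iSup_of_le hy le_rfl

theorem abs_pairing_samplets_le {Ω : Set (Pt d)} (hx : ∀ i, x i ∈ Ω) {T : ClusterTree N}
    (hT : T.Valid) {Q : T.Transforms (mq d q)} (hQ : T.IsQR x q Q) (ho : IsOpen Ω)
    (hc : Convex ℝ Ω) {f : Pt d → ℝ} (hf : ContDiffOn ℝ ((q + 1 : ℕ) : WithTop ℕ∞) f Ω)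
    (k : Fin (T.numSamplets (mq d q))) {v : Finset (Fin N)} (hv : supp (T.samplets _ Q k) ⊆ v) :
    ENNReal.ofReal |pairing x f (T.samplets _ Q k)| ≤
      ENNReal.ofReal (((d : ℝ) / 2) ^ (q + 1) * (diam x v ^ (q + 1) / ((q + 1).factorial : ℝ))) *
        cNorm (q + 1) Ω f * ENNReal.ofReal (∑ i, |T.samplets _ Q k i|) := by
  set σ := T.samplets _ Q k with hσ
  obtain ⟨i₀, hi₀, -⟩ := exists_ne_mem_supp hT hQ k
  have hvne : v.Nonempty := ⟨i₀, hv hi₀⟩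
  have hsupp := supp_subset_iff.1 hv
  have hD := diam_nonneg x v
  have hl1 : 0 < ∑ i, |σ i| := by
    refine Finset.sum_pos' (fun i _ => abs_nonneg _) ⟨i₀, Finset.mem_univ _, ?_⟩
    simpa [supp] using hi₀
  obtain ⟨y, hy, hle⟩ := exists_centre x hvne
  have hyΩ : y ∈ Ω := convexHull_min (by rintro _ ⟨i, -, rfl⟩; exact hx i) hc hy
  have key : ∀ g : Pt d → ℝ, ∀ B : ℝ, 0 ≤ B → (∀ i ∈ v, |g (x i)| ≤ B) →
      |pairing x g σ| ≤ B * ∑ i, |σ i| := by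
    intro g B hB hg
    rw [Finset.mul_sum]
    refine (Finset.abs_sum_le_sum_abs _ _).trans (Finset.sum_le_sum fun i _ => ?_)
    rw [abs_mul, mul_comm]
    by_cases hi : i ∈ v
    · exact mul_le_mul_of_nonneg_right (hg i hi) (abs_nonneg _)
    · rw [hsupp i hi, abs_zero, mul_zero, mul_zero]
  set A := ((d : ℝ) / 2) ^ (q + 1) * (diam x v ^ (q + 1) / ((q + 1).factorial : ℝ)) with hA
  have hA0 : 0 ≤ A := by positivity
  -- An infinite norm needs care because `0 * ⊤ = 0`: if the geometric factor vanishes, all points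
  -- of `v` coincide with `y`, and the moment of the constant `f y` shows that the left-hand side is
  -- zero.
  by_cases hK : cNorm (q + 1) Ω f = ⊤
  · rcases hA0.eq_or_lt with h0 | h0
    · have hprod : (d : ℝ) / 2 * diam x v = 0 := by
        have h1 : ((d : ℝ) / 2 * diam x v) ^ (q + 1) / ((q + 1).factorial : ℝ) = 0 := by
          rw [mul_pow, h0, hA]; ring
        rcases div_eq_zero_iff.1 h1 with h2 | h2
        · exact pow_eq_zero_iff (Nat.succ_ne_zero q) |>.1 h2
        · exact absurd h2 (by positivity)
      have hxy : ∀ i ∈ v, x i = y := by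
        intro i hi
        ext l
        have h1 := hle i hi
        rw [hprod] at h1
        have h2 := (Finset.single_le_sum (f := fun k => |x i k - y k|)
          (fun k _ => abs_nonneg _) (Finset.mem_univ l)).trans h1
        have h3 := abs_eq_zero.1 (le_antisymm h2 (abs_nonneg _))
        linarith
      have hz : pairing x f σ = 0 := by
        have h1 := pairing_eval_samplets hQ k (P := MvPolynomial.C (f y)) (by simp)
        rw [← h1, pairing_eq_sum_of_supp x hsupp, pairing_eq_sum_of_supp x hsupp]
        refine Finset.sum_congr rfl fun i hi => ?_
        rw [hxy i hi, MvPolynomial.eval_C]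
      rw [hz, abs_zero, ENNReal.ofReal_zero]
      exact bot_le
    · rw [hK, ENNReal.mul_top (ENNReal.ofReal_pos.2 h0).ne',
        ENNReal.top_mul (ENNReal.ofReal_pos.2 hl1).ne']
      exact le_top
  · set M := (cNorm (q + 1) Ω f).toReal with hMdef
    have hM0 : 0 ≤ M := ENNReal.toReal_nonneg
    have hM : ∀ z ∈ Ω, ∀ ι : Fin (q + 1) → Fin d,
        |iteratedFDeriv ℝ (q + 1) f z fun a => EuclideanSpace.single (ι a) (1 : ℝ)| ≤ M := by
      intro z hz ι
      have h1 := ENNReal.toReal_mono hK (enorm_iteratedFDeriv_le_cNorm (f := f) le_rfl hz ι)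
      rwa [toReal_enorm, Real.norm_eq_abs] at h1
    have hpair : pairing x f σ = pairing x
        (fun z => f z - MvPolynomial.eval (fun i => z i) (taylorPoly q f y)) σ := by
      rw [pairing_sub, pairing_eval_samplets hQ k (totalDegree_taylorPoly_le q f y), sub_zero]
    have hmain := key (fun z => f z - MvPolynomial.eval (fun i => z i) (taylorPoly q f y))
      (M * A) (mul_nonneg hM0 hA0) fun i hi => by
        refine (abs_sub_taylorPoly_le ho hf hM (hc.segment_subset hyΩ (hx i))).trans ?_
        refine mul_le_mul_of_nonneg_left ?_ hM0
        rw [hA, mul_div_assoc', ← mul_pow]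
        gcongr
        exact hle i hi
    rw [hpair, ← ENNReal.ofReal_toReal hK, ← ENNReal.ofReal_mul hA0,
      ← ENNReal.ofReal_mul (mul_nonneg hA0 hM0)]
    refine ENNReal.ofReal_le_ofReal (hmain.trans_eq ?_)
    rw [mul_comm M A]

end SmoothFunctions

end ClusterTree

end Samplet

namespace Samplet

/-! ### Bounding boxes -/

section Box

variable {d N : ℕ} (x : Fin N → Pt d)

/-- The lower end of the bounding box of `v` in direction `i`. -/
noncomputable def boxLo (v : Finset (Fin N)) (i : Fin d) : ℝ :=
  sInf ((fun k => x k i) '' (v : Set (Fin N)))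

/-- The upper end of the bounding box of `v` in direction `i`. -/
noncomputable def boxHi (v : Finset (Fin N)) (i : Fin d) : ℝ :=
  sSup ((fun k => x k i) '' (v : Set (Fin N)))

open ClusterTree (edgeLength)

theorem edgeLength_eq (v : Finset (Fin N)) (i : Fin d) :
    edgeLength x v i = boxHi x v i - boxLo x v i := rfl

variable {x} {v w : Finset (Fin N)}

theorem boxLo_le {k : Fin N} (hk : k ∈ v) (i : Fin d) : boxLo x v i ≤ x k i :=
  csInf_le (v.finite_toSet.image _).bddBelow ⟨k, hk, rfl⟩

theorem le_boxHi {k : Fin N} (hk : k ∈ v) (i : Fin d) : x k i ≤ boxHi x v i :=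
  le_csSup (v.finite_toSet.image _).bddAbove ⟨k, hk, rfl⟩

theorem exists_eq_boxLo (hv : v.Nonempty) (i : Fin d) : ∃ k ∈ v, x k i = boxLo x v i :=
  ((Finset.coe_nonempty.2 hv).image fun k => x k i).csInf_mem (v.finite_toSet.image _)

theorem exists_eq_boxHi (hv : v.Nonempty) (i : Fin d) : ∃ k ∈ v, x k i = boxHi x v i :=
  ((Finset.coe_nonempty.2 hv).image fun k => x k i).csSup_mem (v.finite_toSet.image _)

theorem boxLo_mono (hv : v.Nonempty) (h : v ⊆ w) (i : Fin d) : boxLo x w i ≤ boxLo x v i := by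
  obtain ⟨k, hk, e⟩ := exists_eq_boxLo (x := x) hv i
  rw [← e]
  exact boxLo_le (h hk) i

theorem boxHi_mono (hv : v.Nonempty) (h : v ⊆ w) (i : Fin d) : boxHi x v i ≤ boxHi x w i := by
  obtain ⟨k, hk, e⟩ := exists_eq_boxHi (x := x) hv i
  rw [← e]
  exact le_boxHi (h hk) i

theorem edgeLength_mono (hv : v.Nonempty) (h : v ⊆ w) (i : Fin d) :
    edgeLength x v i ≤ edgeLength x w i :=
  sub_le_sub (boxHi_mono hv h i) (boxLo_mono hv h i)

theorem abs_sub_le_edgeLength {k l : Fin N} (hk : k ∈ v) (hl : l ∈ v) (i : Fin d) :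
    |x k i - x l i| ≤ edgeLength x v i := by
  rw [edgeLength_eq, abs_le]
  constructor <;> linarith [boxLo_le (x := x) hk i, le_boxHi (x := x) hk i,
    boxLo_le (x := x) hl i, le_boxHi (x := x) hl i]

theorem edgeLength_nonneg (hv : v.Nonempty) (i : Fin d) : 0 ≤ edgeLength x v i := by
  obtain ⟨k, hk⟩ := hv
  simpa using abs_sub_le_edgeLength (x := x) hk hk i

theorem norm_le_of_forall_abs_le {z : Pt d} {L : ℝ} (h : ∀ i, |z i| ≤ L) : ‖z‖ ≤ d * L := by
  calc ‖z‖ = ‖∑ i, z i • EuclideanSpace.single i (1 : ℝ)‖ := by rw [sum_smul_single]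
    _ ≤ ∑ i : Fin d, L := by
        refine (norm_sum_le _ _).trans (Finset.sum_le_sum fun i _ => ?_)
        simpa [norm_smul] using h i
    _ = d * L := by simp

theorem dist_le_of_edgeLength_le {L : ℝ} (hL : ∀ i, edgeLength x v i ≤ L) {k l : Fin N}
    (hk : k ∈ v) (hl : l ∈ v) : dist (x k) (x l) ≤ d * L := by
  rw [dist_eq_norm]
  exact norm_le_of_forall_abs_le fun i => (abs_sub_le_edgeLength hk hl i).trans (hL i)

theorem abs_sub_apply_le_dist (y z : Pt d) (i : Fin d) : |y i - z i| ≤ dist y z := by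
  rw [dist_eq_norm]
  exact PiLp.norm_apply_le (y - z) i

/-- There is a point in the convex hull of `v` that is far away from the faces of the bounding
box. -/
theorem exists_deep (hd : 0 < d) (hv : v.Nonempty) {Ω : Set (Pt d)} (hΩ : Convex ℝ Ω)
    (hx : ∀ k, x k ∈ Ω) :
    ∃ m ∈ Ω, ∀ i, boxLo x v i + edgeLength x v i / (2 * d) ≤ m i ∧
      m i ≤ boxHi x v i - edgeLength x v i / (2 * d) := by
  choose a ha hae using fun i => exists_eq_boxLo (x := x) hv i
  choose b hb hbe using fun i => exists_eq_boxHi (x := x) hv i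
  have hd' : (0 : ℝ) < d := by exact_mod_cast hd
  -- Average over all directions the midpoints of two points on opposite faces. In coordinate `i`,
  -- the `i`-th midpoint alone keeps the average at distance `edgeLength / (2 * d)` from both faces.
  refine ⟨∑ i, (1 / (d : ℝ)) • midpoint ℝ (x (a i)) (x (b i)), ?_, fun i => ?_⟩
  · refine hΩ.sum_mem (fun _ _ => by positivity) ?_ fun i _ => hΩ.midpoint_mem (hx _) (hx _)
    simp [hd'.ne']
  · have hm : (∑ j, (1 / (d : ℝ)) • midpoint ℝ (x (a j)) (x (b j))) i =
        (1 / (2 * d)) * ∑ j, (x (a j) i + x (b j) i) := by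
      simp only [WithLp.ofLp_sum, WithLp.ofLp_smul, Finset.sum_apply, Pi.smul_apply, smul_eq_mul,
        midpoint_eq_smul_add, Finset.mul_sum, WithLp.ofLp_add, Pi.add_apply, invOf_eq_inv]
      refine Finset.sum_congr rfl fun j _ => ?_
      field_simp
    have h1 : edgeLength x v i ≤ ∑ j, (x (a j) i + x (b j) i - 2 * boxLo x v i) := by
      refine le_trans (le_of_eq ?_) (Finset.single_le_sum
        (f := fun j => x (a j) i + x (b j) i - 2 * boxLo x v i)
        (fun j _ => ?_) (Finset.mem_univ i))
      · simp only [hae, hbe, edgeLength_eq]; ring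
      · simp only
        linarith [boxLo_le (x := x) (ha j) i, boxLo_le (x := x) (hb j) i]
    have h2 : edgeLength x v i ≤ ∑ j, (2 * boxHi x v i - (x (a j) i + x (b j) i)) := by
      refine le_trans (le_of_eq ?_) (Finset.single_le_sum
        (f := fun j => 2 * boxHi x v i - (x (a j) i + x (b j) i))
        (fun j _ => ?_) (Finset.mem_univ i))
      · simp only [hae, hbe, edgeLength_eq]; ring
      · simp only
        linarith [le_boxHi (x := x) (ha j) i, le_boxHi (x := x) (hb j) i]
    rw [Finset.sum_sub_distrib, Finset.sum_const, Finset.card_univ, Fintype.card_fin,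
      nsmul_eq_mul] at h1 h2
    rw [hm]
    constructor
    · rw [← sub_nonneg]
      have : 1 / (2 * (d : ℝ)) * ∑ j, (x (a j) i + x (b j) i) -
          (boxLo x v i + edgeLength x v i / (2 * d)) = 1 / (2 * d) *
            (∑ j, (x (a j) i + x (b j) i) - d * (2 * boxLo x v i) - edgeLength x v i) := by
        field_simp
        ring
      rw [this]
      exact mul_nonneg (by positivity) (by linarith)
    · rw [← sub_nonneg]
      have : boxHi x v i - edgeLength x v i / (2 * d) -
          1 / (2 * (d : ℝ)) * ∑ j, (x (a j) i + x (b j) i) = 1 / (2 * d) *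
            (d * (2 * boxHi x v i) - ∑ j, (x (a j) i + x (b j) i) - edgeLength x v i) := by
        field_simp
        ring
      rw [this]
      exact mul_nonneg (by positivity) (by linarith)

end Box

/-! ### Packing and covering -/

section Packing

variable {d N : ℕ} {x : Fin N → Pt d}

open MeasureTheory Metric

/-- Disjoint balls of radius `δ` around the points fit into one of radius `R + δ`; compare volumes.
-/
theorem card_mul_pow_le {s : Finset (Fin N)} {δ R : ℝ} (hδ : 0 < δ) (hR : 0 ≤ R)
    (hsep : ∀ i j, i ≠ j → 2 * δ ≤ dist (x i) (x j)) {y : Pt d} (hs : ∀ i ∈ s, dist (x i) y ≤ R) :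
    s.card * δ ^ d ≤ (R + δ) ^ d := by
  have hdis : (s : Set (Fin N)).PairwiseDisjoint fun i => ball (x i) δ := by
    intro i _ j _ hij
    exact ball_disjoint_ball (by linarith [hsep i j hij])
  have hsub : (⋃ i ∈ s, ball (x i) δ) ⊆ ball y (R + δ) :=
    Set.iUnion₂_subset fun i hi => ball_subset_ball' (by linarith [hs i hi])
  have h1 := measure_mono (μ := (volume : Measure (Pt d))) hsub
  rw [measure_biUnion_finset hdis fun i _ => measurableSet_ball] at h1
  simp only [Measure.addHaar_ball_of_pos _ _ hδ,
    Measure.addHaar_ball_of_pos _ _ (add_pos_of_nonneg_of_pos hR hδ), Finset.sum_const,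
    nsmul_eq_mul, ← mul_assoc] at h1
  have h2 := (ENNReal.mul_le_mul_iff_left (measure_ball_pos _ _ zero_lt_one).ne'
    measure_ball_lt_top.ne).1 h1
  rw [finrank_euclideanSpace_fin, ← ENNReal.ofReal_natCast,
    ← ENNReal.ofReal_mul (Nat.cast_nonneg _)] at h2
  exact (ENNReal.ofReal_le_ofReal_iff (by positivity)).1 h2

/-- Balls of radius `H` around the points cover the ball of radius `R`; compare volumes. -/
theorem pow_le_card_mul_pow {s : Finset (Fin N)} {H R : ℝ} (hH : 0 ≤ H) (hR : 0 < R) {y : Pt d}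
    (hs : ∀ z ∈ ball y R, ∃ i ∈ s, dist z (x i) ≤ H) : R ^ d ≤ s.card * H ^ d := by
  have hsub : ball y R ⊆ ⋃ i ∈ s, closedBall (x i) H := fun z hz => by
    obtain ⟨i, hi, h⟩ := hs z hz
    exact Set.mem_biUnion hi h
  have h1 := (measure_mono (μ := (volume : Measure (Pt d))) hsub).trans
    (measure_biUnion_finset_le _ _)
  simp only [Measure.addHaar_ball_of_pos _ _ hR, Measure.addHaar_closedBall _ _ hH,
      Finset.sum_const, nsmul_eq_mul, ← mul_assoc] at h1
  have h2 := (ENNReal.mul_le_mul_iff_left (measure_ball_pos _ _ zero_lt_one).ne'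
      measure_ball_lt_top.ne).1 h1
  rw [finrank_euclideanSpace_fin, ← ENNReal.ofReal_natCast,
      ← ENNReal.ofReal_mul (Nat.cast_nonneg _)] at h2
  exact (ENNReal.ofReal_le_ofReal_iff (by positivity)).1 h2

end Packing

end Samplet

namespace Samplet

open ClusterTree (edgeLength IsMedianSplit)

/-! ### Cells, and how fast their edges can shrink -/

section Cells

variable {d N : ℕ}

/-- The points of `w` that are strictly inside the bounding box of `v` in the directions in `I`
belong to `v`. -/
def IsCell (x : Fin N → Pt d) (w v : Finset (Fin N)) (I : Set (Fin d)) : Prop :=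
  v ⊆ w ∧ ∀ k ∈ w, (∀ i ∈ I, boxLo x v i < x k i ∧ x k i < boxHi x v i) → k ∈ v

variable {x : Fin N → Pt d} {u v w : Finset (Fin N)}

theorem isCell_self (w : Finset (Fin N)) (I : Set (Fin d)) : IsCell x w w I :=
  ⟨subset_rfl, fun _ hk _ => hk⟩

theorem IsCell.trans {I J : Set (Fin d)} (hwv : IsCell x w v I) (hvu : IsCell x v u J)
    (hu : u.Nonempty) : IsCell x w u (I ∪ J) := by
  refine ⟨hvu.1.trans hwv.1, fun k hk h => hvu.2 k (hwv.2 k hk fun i hi => ?_) fun i hi =>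
    h i (Or.inr hi)⟩
  have h1 := h i (Or.inl hi)
  exact ⟨(boxLo_mono hu hvu.1 i).trans_lt h1.1, h1.2.trans_le (boxHi_mono hu hvu.1 i)⟩

/-- The sons `u` and `u'` of a cluster are separated by a hyperplane perpendicular to the direction
`i`. -/
def IsSeparated (x : Fin N → Pt d) (u u' : Finset (Fin N)) (i : Fin d) : Prop :=
  ∃ c : ℝ, ((∀ k ∈ u, c ≤ x k i) ∧ ∀ k ∈ u', x k i ≤ c) ∨
    ((∀ k ∈ u, x k i ≤ c) ∧ ∀ k ∈ u', c ≤ x k i)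

/-- A point strictly inside the range of `u` in direction `i` lies strictly on the side of `u` of
the hyperplane. Points on the hyperplane may go either way, hence the strict inequalities in
`IsCell`. -/
theorem IsSeparated.isCell {u u' : Finset (Fin N)} {i : Fin d} (h : IsSeparated x u u' i)
    (hu : u.Nonempty) : IsCell x (u ∪ u') u {i} := by
  refine ⟨Finset.subset_union_left, fun k hk hki => ?_⟩
  have hi := hki i rfl
  rcases Finset.mem_union.1 hk with h1 | h1
  · exact h1
  · obtain ⟨a, ha, hae⟩ := exists_eq_boxLo (x := x) hu i
    obtain ⟨b, hb, hbe⟩ := exists_eq_boxHi (x := x) hu i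
    obtain ⟨c, ⟨h2, h3⟩ | ⟨h2, h3⟩⟩ := h
    · linarith [h2 a ha, h3 k h1]
    · linarith [h2 b hb, h3 k h1]

/-- Points `x_1, …, x_N` in the convex set `Ω` with separation radius at least `δ` and fill distance
at most `H`. -/
structure IsSpread (Ω : Set (Pt d)) (x : Fin N → Pt d) (δ H : ℝ) : Prop where
  convex : Convex ℝ Ω
  mem : ∀ i, x i ∈ Ω
  pos : 0 < δ
  le : δ ≤ H
  sep : ∀ i j, i ≠ j → 2 * δ ≤ dist (x i) (x j)
  fill : ∀ y ∈ Ω, ∃ i, dist y (x i) ≤ H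

variable {Ω : Set (Pt d)} {δ H : ℝ}

theorem IsSpread.H_pos (hX : IsSpread Ω x δ H) : 0 < H := hX.pos.trans_le hX.le

/-- Some point of the whole set is within `H` of `y`, and the margins force it strictly inside both
boxes. -/
theorem IsSpread.exists_mem_dist_le (hX : IsSpread Ω x δ H) (hw : IsCell x Finset.univ w Set.univ)
    {I : Set (Fin d)} (hv : IsCell x w v I) {y : Pt d} (hy : y ∈ Ω)
    (hyw : ∀ i, boxLo x w i + H < y i ∧ y i < boxHi x w i - H)
    (hyv : ∀ i ∈ I, boxLo x v i + H < y i ∧ y i < boxHi x v i - H) :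
    ∃ k ∈ v, dist y (x k) ≤ H := by
  obtain ⟨k, hk⟩ := hX.fill y hy
  have h1 : ∀ i, y i - H ≤ x k i ∧ x k i ≤ y i + H := fun i => by
    have := abs_le.1 ((abs_sub_apply_le_dist y (x k) i).trans hk)
    constructor <;> linarith [this.1, this.2]
  refine ⟨k, hv.2 k (hw.2 k (Finset.mem_univ k) fun i _ => ?_) fun i hi => ?_, hk⟩
  · constructor <;> linarith [h1 i, hyw i]
  · constructor <;> linarith [h1 i, hyv i hi]

/-- Edges of bounding boxes do not shrink faster than those in the directions of the splits. -/
theorem IsSpread.edgeLength_le (hX : IsSpread Ω x δ H) (hd : 0 < d)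
    (hw : IsCell x Finset.univ w Set.univ) {I : Set (Fin d)} (hv : IsCell x w v I)
    (hne : v.Nonempty) {t : ℝ} (ht0 : 0 ≤ t) (ht1 : t ≤ 1)
    (h1 : ∀ i, H < (1 - t) * (edgeLength x v i / (2 * d)) + t * (edgeLength x w i / (4 * d)))
    (h2 : ∀ i ∈ I, t * edgeLength x w i + H < edgeLength x v i / (2 * d)) (k : Fin d) :
    t / 2 * edgeLength x w k - 2 * H ≤ edgeLength x v k := by
  have hwne : w.Nonempty := hne.mono hv.1
  obtain ⟨m, hmΩ, hm⟩ := exists_deep hd hne hX.convex hX.mem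
  obtain ⟨m', hmΩ', hm'⟩ := exists_deep hd hwne hX.convex hX.mem
  -- Contract `w` towards `m`, which is deep in the box of `v`. The midpoint with `m'`, deep in the
  -- box of `w`, keeps the images away from the faces in directions that were not cut; in the cut
  -- directions the image stays within `t * edgeLength x w i` of `m`.
  have key : ∀ p ∈ w, ∃ n ∈ v,
      dist ((1 - t) • m + t • midpoint ℝ m' (x p)) (x n) ≤ H := by
    intro p hp
    have hcoord : ∀ i, ((1 - t) • m + t • midpoint ℝ m' (x p)) i =
        (1 - t) * m i + t * ((m' i + x p i) / 2) := by
      intro i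
      simp only [PiLp.add_apply, PiLp.smul_apply, smul_eq_mul, midpoint_eq_smul_add, invOf_eq_inv]
      ring
    have hpe : ∀ i, edgeLength x w i / (4 * d) = edgeLength x w i / (2 * d) / 2 := fun i => by
      rw [div_div]; ring_nf
    refine hX.exists_mem_dist_le hw hv (hX.convex hmΩ (hX.convex.midpoint_mem hmΩ' (hX.mem p))
      (by linarith) ht0 (by ring)) (fun i => ?_) fun i hi => ?_
    · rw [hcoord]
      have e1 := h1 i
      rw [hpe] at e1
      have a1 := boxLo_mono (x := x) hne hv.1 i
      have a2 := boxHi_mono (x := x) hne hv.1 i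
      have a3 := boxLo_le (x := x) hp i
      have a4 := le_boxHi (x := x) hp i
      have ht1' : 0 ≤ 1 - t := by linarith
      constructor
      · have b1 : (1 - t) * (boxLo x w i + edgeLength x v i / (2 * d)) ≤ (1 - t) * m i :=
          mul_le_mul_of_nonneg_left (by linarith [hm i]) ht1'
        have b2 : t * (boxLo x w i + edgeLength x w i / (2 * d) / 2) ≤
            t * ((m' i + x p i) / 2) :=
          mul_le_mul_of_nonneg_left (by linarith [hm' i]) ht0
        linarith
      · have b1 : (1 - t) * m i ≤ (1 - t) * (boxHi x w i - edgeLength x v i / (2 * d)) :=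
          mul_le_mul_of_nonneg_left (by linarith [hm i]) ht1'
        have b2 : t * ((m' i + x p i) / 2) ≤
            t * (boxHi x w i - edgeLength x w i / (2 * d) / 2) :=
          mul_le_mul_of_nonneg_left (by linarith [hm' i]) ht0
        linarith
    · rw [hcoord]
      have e2 := h2 i hi
      have hEw : 0 ≤ edgeLength x w i / (2 * d) :=
        div_nonneg (edgeLength_nonneg hwne i) (by positivity)
      have hEv : 0 ≤ edgeLength x v i / (2 * d) :=
        div_nonneg (edgeLength_nonneg hne i) (by positivity)
      have a1 := boxLo_mono (x := x) hne hv.1 i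
      have a2 := boxHi_mono (x := x) hne hv.1 i
      have a3 := boxLo_le (x := x) hp i
      have a4 := le_boxHi (x := x) hp i
      have hw' := edgeLength_eq x w i
      have c1 : t * (-edgeLength x w i) ≤ t * ((m' i + x p i) / 2 - m i) :=
        mul_le_mul_of_nonneg_left (by linarith [hm i, hm' i]) ht0
      have c2 : t * ((m' i + x p i) / 2 - m i) ≤ t * edgeLength x w i :=
        mul_le_mul_of_nonneg_left (by linarith [hm i, hm' i]) ht0
      constructor <;> linarith [hm i]
  -- The images of two extreme points of `w` are `t / 2 * edgeLength x w k` apart in direction `k`,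
  -- and each is within `H` of a point of `v`.
  obtain ⟨a, ha, hae⟩ := exists_eq_boxLo (x := x) hwne k
  obtain ⟨b, hb, hbe⟩ := exists_eq_boxHi (x := x) hwne k
  obtain ⟨n, hn, hdn⟩ := key a ha
  obtain ⟨n', hn', hdn'⟩ := key b hb
  have f1 := abs_le.1 ((abs_sub_apply_le_dist _ _ k).trans hdn)
  have f2 := abs_le.1 ((abs_sub_apply_le_dist _ _ k).trans hdn')
  have f3 := (abs_le.1 (abs_sub_le_edgeLength (x := x) hn' hn k)).2
  simp only [PiLp.add_apply, PiLp.smul_apply, smul_eq_mul, midpoint_eq_smul_add, invOf_eq_inv,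
    hae, hbe] at f1 f2
  rw [edgeLength_eq x w]
  linarith [f1.1, f1.2, f2.1, f2.2]

/-- Splitting a cluster into parts of comparable size shrinks the edge in the direction of the split
at most by a constant factor. -/
theorem IsSpread.edgeLength_le_of_split (hX : IsSpread Ω x δ H) (hd : 0 < d) {u u' : Finset (Fin N)}
    (hw : IsCell x Finset.univ (u ∪ u') Set.univ) (hu : u.Nonempty) {ℓ : Fin d}
    (hsep : IsSeparated x u u' ℓ) (hcard : u'.card ≤ u.card + 2)
    (hE : ∀ i, 4 * d * H < edgeLength x (u ∪ u') i) {M : ℕ}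
    (hM : 3 * (8 * H + δ) ^ d < M * δ ^ d) :
    edgeLength x (u ∪ u') ℓ ≤ (4 * d + 2 * M) * (edgeLength x u ℓ + 4 * H) := by
  classical
  have hd' : (1 : ℝ) ≤ d := by exact_mod_cast hd
  have hH := hX.H_pos
  have hMpos : 0 < (M : ℝ) := by
    have h1 : 0 < (M : ℝ) * δ ^ d :=
      lt_of_le_of_lt (by have := hX.pos; positivity) hM
    exact pos_of_mul_pos_left h1 (pow_pos hX.pos d).le
  -- Otherwise `u` is a thin slab at one end of the box. Pushing each of its points towards the
  -- other end, with `M` different step sizes, gives points of `u'` with bounded multiplicity, too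
  -- many for `u'`.
  by_contra! hcon
  set w := u ∪ u' with hwdef
  have hwne : w.Nonempty := hu.mono Finset.subset_union_left
  set a := edgeLength x w ℓ with ha
  set b := edgeLength x u ℓ with hb
  have hb0 : 0 ≤ b := edgeLength_nonneg hu ℓ
  have hcon1 : 4 * d * (b + 4 * H) < a := by
    have : 0 ≤ 2 * (M : ℝ) * (b + 4 * H) := by positivity
    linarith
  have hcon2 : 2 * M * (b + 4 * H) < a := by
    have : 0 ≤ 4 * (d : ℝ) * (b + 4 * H) := by positivity
    linarith
  obtain ⟨m, hmΩ, hm⟩ := exists_deep hd hwne hX.convex hX.mem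
  -- an orientation of the direction `ℓ`
  obtain ⟨ε, top, hε, hm_top, hu_top, p, hp, hp_top, htop⟩ : ∃ ε top : ℝ, (ε = 1 ∨ ε = -1) ∧
      ε * m ℓ ≤ top - a / (2 * d) ∧ (∀ y ∈ u, top - b ≤ ε * x y ℓ) ∧
      ∃ p ∈ w, ε * x p ℓ = top - a ∧ ∀ y ∈ w, ε * x y ℓ ≤ top := by
    have haw := edgeLength_eq x w ℓ
    obtain ⟨A, hA, hAe⟩ := exists_eq_boxLo (x := x) hwne ℓ
    obtain ⟨B, hB, hBe⟩ := exists_eq_boxHi (x := x) hwne ℓ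
    obtain ⟨c, ⟨h2, h3⟩ | ⟨h2, h3⟩⟩ := hsep
    · refine ⟨1, boxHi x w ℓ, Or.inl rfl, by linarith [hm ℓ], fun y hy => ?_, A, hA, ?_,
        fun y hy => by linarith [le_boxHi (x := x) hy ℓ]⟩
      · rcases Finset.mem_union.1 hB with h | h
        · linarith [(abs_le.1 (abs_sub_le_edgeLength (x := x) h hy ℓ)).2]
        · linarith [h2 y hy, h3 B h]
      · linarith
    · refine ⟨-1, -boxLo x w ℓ, Or.inr rfl, by linarith [hm ℓ], fun y hy => ?_, B, hB, ?_,
        fun y hy => by linarith [boxLo_le (x := x) hy ℓ]⟩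
      · rcases Finset.mem_union.1 hA with h | h
        · linarith [(abs_le.1 (abs_sub_le_edgeLength (x := x) hy h ℓ)).2]
        · linarith [h2 y hy, h3 A h]
      · linarith
  have hεle : ∀ z z' : Pt d, ε * z ℓ - ε * z' ℓ ≤ dist z z' := by
    intro z z'
    have := abs_le.1 (abs_sub_apply_le_dist z z' ℓ)
    rcases hε with rfl | rfl <;> linarith [this.1, this.2]
  let s : Fin M → ℝ := fun n => n / (2 * M)
  have hs0 : ∀ n, 0 ≤ s n := fun n => by positivity
  have hs1 : ∀ n, s n ≤ 1 / 2 := fun n => by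
    simp only [s]
    rw [div_le_div_iff₀ (by positivity) (by norm_num)]
    have : (n : ℝ) ≤ M := by exact_mod_cast n.2.le
    linarith
  -- The midpoint with `m` puts the point more than `H` inside the box of `w`. As `s n ≤ 1 / 2`,
  -- distances between points `y` shrink at most by the factor `4`.
  let τ : Fin N → Fin M → Pt d := fun y n => midpoint ℝ m ((1 - s n) • x y + s n • x p)
  have hτ : ∀ y n i, τ y n i = (m i + ((1 - s n) * x y i + s n * x p i)) / 2 := by
    intro y n i
    simp only [τ, PiLp.add_apply, PiLp.smul_apply, smul_eq_mul, midpoint_eq_smul_add, invOf_eq_inv]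
    ring
  have himage : ∀ y ∈ u, ∀ n, ∃ k ∈ u', dist (τ y n) (x k) ≤ H := by
    intro y hy n
    have hyw : y ∈ w := Finset.mem_union_left _ hy
    have hs0' := hs0 n
    have hs1' : 0 ≤ 1 - s n := by linarith [hs1 n]
    obtain ⟨k, hk, hdist⟩ := hX.exists_mem_dist_le hw (isCell_self w ∅) (y := τ y n)
      (hX.convex.midpoint_mem hmΩ (hX.convex (hX.mem y) (hX.mem p) hs1' hs0' (by ring)))
      (fun i => by
        rw [hτ]
        have h1 : 2 * H < edgeLength x w i / (2 * d) := by
          rw [lt_div_iff₀ (by positivity)]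
          linarith [hE i]
        have c1 : (1 - s n) * boxLo x w i ≤ (1 - s n) * x y i :=
          mul_le_mul_of_nonneg_left (boxLo_le hyw i) hs1'
        have c2 : s n * boxLo x w i ≤ s n * x p i := mul_le_mul_of_nonneg_left (boxLo_le hp i) hs0'
        have c3 : (1 - s n) * x y i ≤ (1 - s n) * boxHi x w i :=
          mul_le_mul_of_nonneg_left (le_boxHi hyw i) hs1'
        have c4 : s n * x p i ≤ s n * boxHi x w i := mul_le_mul_of_nonneg_left (le_boxHi hp i) hs0'
        constructor <;> linarith [hm i])
      (fun i hi => absurd hi (Set.notMem_empty i))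
    refine ⟨k, ?_, hdist⟩
    rcases Finset.mem_union.1 hk with h | h
    -- Points of `u` are within `b` of the top, whereas `τ y n` is at least `a / (4 * d) > b + 4 *
    -- H` below it.
    · exfalso
      have e1 := hεle (x k) (τ y n)
      rw [dist_comm] at e1
      have e2 : ε * τ y n ℓ = (ε * m ℓ + ((1 - s n) * (ε * x y ℓ) + s n * (ε * x p ℓ))) / 2 := by
        rw [hτ]; ring
      have c1 : (1 - s n) * (ε * x y ℓ) ≤ (1 - s n) * top :=
        mul_le_mul_of_nonneg_left (htop y hyw) hs1'
      have c2 : s n * (ε * x p ℓ) ≤ s n * top := mul_le_mul_of_nonneg_left (htop p hp) hs0'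
      have c3 : 2 * (b + 4 * H) < a / (2 * d) := by
        rw [lt_div_iff₀ (by positivity)]
        linarith
      linarith [hu_top k h]
    · exact h
  choose! φ hφ hφd using himage
  -- the images for different parameters are far apart
  have hinj : ∀ y ∈ u, ∀ y' ∈ u, ∀ n n', φ y n = φ y' n' → n = n' := by
    have aux : ∀ y ∈ u, ∀ y' ∈ u, ∀ n n', φ y n = φ y' n' → ¬ n < n' := by
      intro y hy y' hy' n n' he hlt
      have h1 := hφd y hy n
      have h2 := hφd y' hy' n'
      rw [← he] at h2
      have h3 := hεle (τ y n) (τ y' n')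
      have h4 := dist_triangle_right (τ y n) (τ y' n') (x (φ y n))
      have e1 : ε * τ y n ℓ = (ε * m ℓ + ((1 - s n) * (ε * x y ℓ) + s n * (ε * x p ℓ))) / 2 := by
        rw [hτ]; ring
      have e2 : ε * τ y' n' ℓ =
          (ε * m ℓ + ((1 - s n') * (ε * x y' ℓ) + s n' * (ε * x p ℓ))) / 2 := by
        rw [hτ]; ring
      have c1 : (1 - s n) * (top - b) ≤ (1 - s n) * (ε * x y ℓ) :=
        mul_le_mul_of_nonneg_left (hu_top y hy) (by linarith [hs1 n])
      have c2 : (1 - s n') * (ε * x y' ℓ) ≤ (1 - s n') * top :=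
        mul_le_mul_of_nonneg_left (htop y' (Finset.mem_union_left _ hy')) (by linarith [hs1 n'])
      have c3 : 0 ≤ s n * b := mul_nonneg (hs0 n) hb0
      rw [hp_top] at e1 e2
      have c4 : 1 / (2 * M) ≤ s n' - s n := by
        simp only [s]
        rw [← sub_div]
        have : (n : ℝ) + 1 ≤ n' := by exact_mod_cast hlt
        gcongr
        linarith
      -- So the two points differ by more than `2 * H` in direction `ℓ`, although both are within
      -- `H` of the same point.
      have c5 : b + 4 * H < 1 / (2 * M) * a := by
        rw [one_div, ← div_eq_inv_mul, lt_div_iff₀ (by positivity)]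
        linarith
      have ha0 : 0 ≤ a := edgeLength_nonneg hwne ℓ
      have c6 := mul_le_mul_of_nonneg_right c4 ha0
      linarith
    intro y hy y' hy' n n' he
    exact le_antisymm (not_lt.1 (aux y' hy' y hy n' n he.symm)) (not_lt.1 (aux y hy y' hy' n n' he))
  -- In a fibre the parameter is fixed and the points `τ y n` are within `2 * H` of each other, so
  -- the points `y` are within `8 * H`; packing bounds their number.
  have hfib : ∀ k ∈ u', (((u ×ˢ (Finset.univ : Finset (Fin M))).filter
      fun z => φ z.1 z.2 = k).card : ℝ) * δ ^ d ≤ (8 * H + δ) ^ d := by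
    intro k _
    rcases ((u ×ˢ (Finset.univ : Finset (Fin M))).filter
      fun z => φ z.1 z.2 = k).eq_empty_or_nonempty with h0 | ⟨⟨y₀, n₀⟩, h0⟩
    · rw [h0]
      have := hX.pos
      simp only [Finset.card_empty, Nat.cast_zero, zero_mul]
      positivity
    · simp only [Finset.mem_filter, Finset.mem_product, Finset.mem_univ, and_true] at h0
      rw [← Finset.card_image_of_injOn (f := Prod.fst)]
      · refine card_mul_pow_le hX.pos (by positivity) hX.sep (y := x y₀) fun y hy => ?_
        obtain ⟨⟨y, n⟩, hyn, rfl⟩ := Finset.mem_image.1 hy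
        simp only [Finset.mem_filter, Finset.mem_product, Finset.mem_univ, and_true] at hyn
        have hnn : n = n₀ := hinj y hyn.1 y₀ h0.1 n n₀ (hyn.2.trans h0.2.symm)
        subst hnn
        have h1 := hφd y hyn.1 n
        have h2 := hφd y₀ h0.1 n
        rw [hyn.2] at h1
        rw [h0.2] at h2
        have h3 := dist_triangle_right (τ y n) (τ y₀ n) (x k)
        have h4 : dist (τ y n) (τ y₀ n) = (1 - s n) / 2 * dist (x y) (x y₀) := by
          have h5 : τ y n - τ y₀ n = ((1 - s n) / 2) • (x y - x y₀) := by
            ext i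
            simp only [PiLp.sub_apply, PiLp.smul_apply, smul_eq_mul, hτ]
            ring
          rw [dist_eq_norm, h5, norm_smul, Real.norm_eq_abs,
            abs_of_nonneg (by linarith [hs1 n]), dist_eq_norm]
        have h6 : 1 / 4 * dist (x y) (x y₀) ≤ (1 - s n) / 2 * dist (x y) (x y₀) :=
          mul_le_mul_of_nonneg_right (by linarith [hs1 n]) dist_nonneg
        simp only
        linarith
      · rintro ⟨y, n⟩ h1 ⟨y', n'⟩ h2 h3
        simp only [Finset.coe_filter, Finset.mem_product, Finset.mem_univ, and_true,
          Set.mem_ofPred_eq] at h1 h2 h3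
        exact Prod.ext h3 (hinj y h1.1 y' h2.1 n n' (h1.2.trans h2.2.symm))
  have hcount : ((u ×ˢ (Finset.univ : Finset (Fin M))).card : ℝ) * δ ^ d ≤
      u'.card * (8 * H + δ) ^ d := by
    rw [Finset.card_eq_sum_card_fiberwise (t := u') (f := fun z => φ z.1 z.2)
      fun z hz => hφ z.1 (Finset.mem_product.1 hz).1 z.2]
    push_cast
    rw [Finset.sum_mul, ← nsmul_eq_mul]
    exact Finset.sum_le_card_nsmul _ _ _ hfib
  rw [Finset.card_product, Finset.card_univ, Fintype.card_fin] at hcount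
  push_cast at hcount
  have hu1 : (1 : ℝ) ≤ u.card := by exact_mod_cast hu.card_pos
  have hc3 : (u'.card : ℝ) ≤ 3 * u.card := by
    have : (u'.card : ℝ) ≤ u.card + 2 := by exact_mod_cast hcard
    linarith
  have hP : 0 ≤ (8 * H + δ) ^ d := by have := hX.pos; positivity
  have h1 := hcount.trans (mul_le_mul_of_nonneg_right hc3 hP)
  have h2 : (u.card : ℝ) * (M * δ ^ d) ≤ u.card * (3 * (8 * H + δ) ^ d) := by linarith
  exact absurd (le_of_mul_le_mul_left h2 (by linarith)) (not_le.2 hM)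

end Cells

end Samplet

namespace Samplet

open ClusterTree (edgeLength IsMedianSplit)

/-! ### Shape regularity -/

/-- If nonnegative numbers cannot be separated into small and large ones with a gap between them,
then they are comparable. -/
theorem pow_mul_le_of_no_gap {d : ℕ} {a : Fin d → ℝ} (ha : ∀ i, 0 ≤ a i) {γ : ℝ} (hγ : 0 < γ)
    (hγ1 : γ ≤ 1)
    (hgap : ∀ S : Set (Fin d), S.Nonempty → S ≠ Set.univ → ∃ k ∈ S, ∃ i ∉ S, γ * a i ≤ a k)
    (i j : Fin d) : γ ^ d * a j ≤ a i := by
  classical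
  obtain ⟨j₀, -, hj₀⟩ := Finset.univ.exists_max_image a ⟨i, Finset.mem_univ i⟩
  -- These sets strictly decrease with `n` while nonempty, since two equal consecutive ones would
  -- exhibit a gap. The index of the maximum is never included, so fewer than `d` elements are left
  -- to lose.
  have key : ∀ n : ℕ, (Finset.univ.filter fun i => a i < γ ^ n * a j₀).Nonempty →
      (Finset.univ.filter fun i => a i < γ ^ n * a j₀).card + n < d := by
    have hne : ∀ n : ℕ, j₀ ∉ Finset.univ.filter fun i => a i < γ ^ n * a j₀ := by
      intro n hn
      have := mul_le_of_le_one_left (ha j₀) (pow_le_one₀ (n := n) hγ.le hγ1)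
      linarith [(Finset.mem_filter.1 hn).2]
    intro n
    induction n with
    | zero =>
      intro _
      have := Finset.card_lt_univ_of_notMem (hne 0)
      rwa [Fintype.card_fin] at this
    | succ n ih =>
      intro hS
      have hsub : (Finset.univ.filter fun i => a i < γ ^ (n + 1) * a j₀) ⊆
          Finset.univ.filter fun i => a i < γ ^ n * a j₀ := by
        intro i hi
        refine Finset.mem_filter.2 ⟨Finset.mem_univ i, (Finset.mem_filter.1 hi).2.trans_le ?_⟩
        exact mul_le_mul_of_nonneg_right (pow_le_pow_of_le_one hγ.le hγ1 n.le_succ) (ha j₀)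
      obtain ⟨k, hk, l, hl, hkl⟩ := hgap {i | a i < γ ^ n * a j₀}
        (by obtain ⟨i, hi⟩ := hS; exact ⟨i, (Finset.mem_filter.1 (hsub hi)).2⟩)
        (fun h => hne n (Finset.mem_filter.2 ⟨Finset.mem_univ _, by
          have : j₀ ∈ {i | a i < γ ^ n * a j₀} := h ▸ Set.mem_univ j₀
          exact this⟩))
      have hlt := Finset.card_lt_card (Finset.ssubset_iff_subset_ne.2 ⟨hsub, fun e => by
        have h1 : k ∈ Finset.univ.filter fun i => a i < γ ^ n * a j₀ :=
          Finset.mem_filter.2 ⟨Finset.mem_univ k, hk⟩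
        rw [← e] at h1
        have h2 := (Finset.mem_filter.1 h1).2
        have h3 : γ ^ n * a j₀ ≤ a l := not_lt.1 hl
        have h4 := mul_le_mul_of_nonneg_left h3 hγ.le
        rw [pow_succ] at h2
        linarith⟩)
      have := ih (hS.mono hsub)
      omega
  by_contra! hcon
  have h1 := key d ⟨i, Finset.mem_filter.2 ⟨Finset.mem_univ i, hcon.trans_le
    (mul_le_mul_of_nonneg_left (hj₀ j (Finset.mem_univ j)) (by positivity))⟩⟩
  omega

section Shape

variable {d N : ℕ} {x : Fin N → Pt d} {Ω : Set (Pt d)} {δ H : ℝ}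

/-- For each set `S` of directions, `v` arises by cuts in the other directions from a cell that is
long in one direction in `S`. -/
def IsFat (x : Fin N → Pt d) (c₀ : ℝ) (v : Finset (Fin N)) : Prop :=
  ∀ S : Set (Fin d), S.Nonempty → ∃ w, IsCell x Finset.univ w Set.univ ∧ IsCell x w v Sᶜ ∧
    ∃ k ∈ S, ∀ i ∉ S, c₀ * edgeLength x w i ≤ edgeLength x w k

/-- If the cut direction belongs to `S`, the son itself is the new reference cell: its edge along
the cut is comparable to the longest edge of the parent. Otherwise the old reference cell remains,
with one more admissible cut. -/
theorem IsFat.son {c₀ : ℝ} (hc₀ : 0 ≤ c₀) {v u : Finset (Fin N)} (hv : IsFat x c₀ v)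
    (hcell : IsCell x Finset.univ v Set.univ) {ℓ : Fin d} (hvu : IsCell x v u {ℓ})
    (hu : u.Nonempty) (hℓ : ∀ k, edgeLength x v k ≤ edgeLength x v ℓ)
    (hle : c₀ * edgeLength x v ℓ ≤ edgeLength x u ℓ) : IsFat x c₀ u := by
  intro S hS
  by_cases hmem : ℓ ∈ S
  · refine ⟨u, ?_, isCell_self u _, ℓ, hmem, fun i _ => ?_⟩
    · have := hcell.trans hvu hu
      rwa [Set.univ_union] at this
    · refine le_trans (mul_le_mul_of_nonneg_left ?_ hc₀) hle
      exact (edgeLength_mono hu hvu.1 i).trans (hℓ i)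
  · obtain ⟨w, hw, hwv, hk⟩ := hv S hS
    refine ⟨w, hw, ?_, hk⟩
    have := hwv.trans hvu hu
    rwa [Set.union_eq_self_of_subset_right (Set.singleton_subset_iff.2 hmem)] at this

/-- If all edges in `S` were much shorter than the others, then the reference cell for `S` would
have lost a long edge in `S` through cuts in other directions only, which `IsSpread.edgeLength_le`
excludes. -/
theorem IsFat.pow_mul_edgeLength_le (hX : IsSpread Ω x δ H) (hd : 0 < d) {c₀ : ℝ} (hc₀ : 0 < c₀)
    (hc₀1 : c₀ ≤ 1) {v : Finset (Fin N)} (hv : IsFat x c₀ v) (hne : v.Nonempty)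
    (hE : ∀ i, 4 * d * H < edgeLength x v i) (i j : Fin d) :
    (c₀ / (32 * d)) ^ d * edgeLength x v j ≤ edgeLength x v i := by
  have hd' : (1 : ℝ) ≤ d := by exact_mod_cast hd
  have hH := hX.H_pos
  refine pow_mul_le_of_no_gap (edgeLength_nonneg hne) (by positivity)
    (by rw [div_le_one (by positivity)]; linarith) (fun S hS hS' => ?_) i j
  by_contra! hcon
  obtain ⟨w, hw, hwv, k, hk, hkw⟩ := hv S hS
  have hk' := hcon k hk
  obtain ⟨i₀, hi₀⟩ := (Set.ne_univ_iff_exists_notMem S).1 hS'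
  have hvk : 0 < edgeLength x v k := lt_trans (by positivity) (hE k)
  have hwk : 0 < edgeLength x w k := hvk.trans_le (edgeLength_mono hne hwv.1 k)
  -- With the factor `8`, the contracted reference cell is still four times as long as `v` in
  -- direction `k`, which contradicts `IsSpread.edgeLength_le`.
  set t := 8 * edgeLength x v k / edgeLength x w k with ht
  have ht0 : 0 ≤ t := by positivity
  have htw : t * edgeLength x w k = 8 * edgeLength x v k := by
    rw [ht]; field_simp
  have hbound : ∀ i ∉ S, t * edgeLength x w i ≤ edgeLength x v i / (4 * d) := by
    intro i hi
    have h1 : c₀ * (t * edgeLength x w i) ≤ c₀ * (edgeLength x v i / (4 * d)) :=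
      calc c₀ * (t * edgeLength x w i) = t * (c₀ * edgeLength x w i) := by ring
        _ ≤ t * edgeLength x w k := mul_le_mul_of_nonneg_left (hkw i hi) ht0
        _ = 8 * edgeLength x v k := htw
        _ ≤ 8 * (c₀ / (32 * d) * edgeLength x v i) := by linarith [hk' i hi]
        _ = c₀ * (edgeLength x v i / (4 * d)) := by field_simp; ring
    exact le_of_mul_le_mul_left h1 hc₀
  have hdeep : ∀ i, H < edgeLength x v i / (4 * d) := fun i => by
    rw [lt_div_iff₀ (by positivity)]
    linarith [hE i]
  have hhalf : ∀ i, edgeLength x v i / (2 * d) = 2 * (edgeLength x v i / (4 * d)) := fun i => by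
    field_simp; ring
  have ht1 : t ≤ 1 / 4 := by
    have h1 := hbound i₀ hi₀
    have h2 := edgeLength_mono (x := x) hne hwv.1 i₀
    have h3 : 0 < edgeLength x w i₀ := lt_of_lt_of_le (lt_trans (by positivity) (hE i₀)) h2
    have h4 : edgeLength x v i₀ / (4 * d) ≤ 1 / 4 * edgeLength x w i₀ := by
      rw [div_le_iff₀ (by positivity)]
      nlinarith
    exact le_of_mul_le_mul_right (h1.trans h4) h3
  have hmain := hX.edgeLength_le hd hw hwv hne ht0 (by linarith) (fun i => by
      have h1 : 0 ≤ t * (edgeLength x w i / (4 * d)) :=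
        mul_nonneg ht0 (div_nonneg (edgeLength_nonneg (hne.mono hwv.1) i) (by positivity))
      have h2 : 3 / 4 * (edgeLength x v i / (2 * d)) ≤ (1 - t) * (edgeLength x v i / (2 * d)) :=
        mul_le_mul_of_nonneg_right (by linarith)
          (div_nonneg (edgeLength_nonneg hne i) (by positivity))
      linarith [hdeep i, hhalf i]) (fun i hi => by
      linarith [hbound i hi, hdeep i, hhalf i]) k
  have h5 : 4 * H ≤ 4 * d * H := by nlinarith
  linarith [hE k]

/-- All edges of the bounding box are large compared to the fill distance, and the cluster is
fat. -/
def IsGood (x : Fin N → Pt d) (K c₀ H : ℝ) (v : Finset (Fin N)) : Prop :=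
  (∀ i, K * H < edgeLength x v i) ∧ IsFat x c₀ v

/-- A son of a good cluster inherits fatness because the cut edge loses only a constant factor. If
one of its edges is at most `K * H`, then so, up to a constant, is that edge of the parent; the
edges of the parent being comparable, all are of order `H`. Small clusters have small sons. -/
theorem isGood_or_small_of_split (hX : IsSpread Ω x δ H) (hd : 0 < d) {u u' : Finset (Fin N)}
    (hw : IsCell x Finset.univ (u ∪ u') Set.univ) (hu : u.Nonempty) {ℓ : Fin d}
    (hℓ : ∀ k, edgeLength x (u ∪ u') k ≤ edgeLength x (u ∪ u') ℓ)
    (hsep : IsSeparated x u u' ℓ) (hcard : u'.card ≤ u.card + 2) {M : ℕ}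
    (hM : 3 * (8 * H + δ) ^ d < M * δ ^ d) {c₀ K B : ℝ} (hc₀ : 0 < c₀)
    (hc₀M : c₀ * (2 * (4 * d + 2 * M)) ≤ 1) (hK : 32 * d ^ 2 * (4 * d + 2 * M) ≤ K)
    (hB : 16 * d * (4 * d + 2 * M) * (K + 2) ≤ (c₀ / (32 * d)) ^ d * B)
    (h : IsGood x K c₀ H (u ∪ u') ∨ ∀ i, edgeLength x (u ∪ u') i ≤ B * H) :
    IsGood x K c₀ H u ∨ ∀ i, edgeLength x u i ≤ B * H := by
  have hd' : (1 : ℝ) ≤ d := by exact_mod_cast hd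
  have hH := hX.H_pos
  rcases h with ⟨hE, hfat⟩ | h
  swap
  · exact Or.inr fun i => (edgeLength_mono hu Finset.subset_union_left i).trans (h i)
  set C : ℝ := 4 * d + 2 * M with hC
  have hM0 : (0 : ℝ) ≤ M := Nat.cast_nonneg M
  have hC4 : 4 ≤ C := by linarith
  have hd2 : (1 : ℝ) ≤ d ^ 2 := one_le_pow₀ hd'
  have hdd : (d : ℝ) ≤ d ^ 2 := by nlinarith
  have hCC : C ≤ d ^ 2 * C := by nlinarith
  have hdC : d * C ≤ d ^ 2 * C := by nlinarith
  have hK4 : 4 * d ≤ K := by nlinarith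
  have hE4 : ∀ i, 4 * d * H < edgeLength x (u ∪ u') i := fun i =>
    lt_of_le_of_lt (mul_le_mul_of_nonneg_right hK4 hH.le) (hE i)
  have hcell := hsep.isCell hu
  have hsplit := hX.edgeLength_le_of_split hd hw hu hsep hcard hE4 hM
  rw [← hC] at hsplit
  have hKℓ : 8 * C * H < edgeLength x (u ∪ u') ℓ :=
    lt_of_le_of_lt (mul_le_mul_of_nonneg_right (by linarith) hH.le) (hE ℓ)
  have hhalf : edgeLength x (u ∪ u') ℓ ≤ 2 * C * edgeLength x u ℓ := by linarith
  by_cases hEu : ∀ i, K * H < edgeLength x u i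
  · refine Or.inl ⟨hEu, hfat.son hc₀.le hw hcell hu hℓ ?_⟩
    have h1 := mul_le_mul_of_nonneg_left hhalf hc₀.le
    have h2 := mul_le_mul_of_nonneg_right hc₀M (edgeLength_nonneg (x := x) hu ℓ)
    linarith
  · push Not at hEu
    obtain ⟨i, hi⟩ := hEu
    right
    have hC0 : 0 < C := by linarith
    -- With this ratio the contracted parent, together with the margin `H`, fits into the son along
    -- `ℓ`, whose edge has lost at most the factor `2 * C`.
    have ht1 : 1 / (8 * d * C) ≤ 1 := by
      rw [div_le_one (by positivity)]
      nlinarith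
    have hmain := hX.edgeLength_le hd hw hcell hu (t := 1 / (8 * d * C)) (by positivity) ht1
      (fun k => by
        have h1 : 0 ≤ (1 - 1 / (8 * d * C)) * (edgeLength x u k / (2 * d)) :=
          mul_nonneg (by linarith) (div_nonneg (edgeLength_nonneg hu k) (by positivity))
        have h2 : H < 1 / (8 * d * C) * (edgeLength x (u ∪ u') k / (4 * d)) := by
          have e : 1 / (8 * d * C) * (edgeLength x (u ∪ u') k / (4 * d)) =
              edgeLength x (u ∪ u') k / (32 * d ^ 2 * C) := by field_simp; ring
          rw [e, lt_div_iff₀ (by positivity), mul_comm]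
          exact lt_of_le_of_lt (mul_le_mul_of_nonneg_right hK hH.le) (hE k)
        linarith)
      (fun k hk => by
        obtain rfl : k = ℓ := hk
        have h1 : edgeLength x (u ∪ u') k / (4 * d * C) ≤ edgeLength x u k / (2 * d) := by
          rw [div_le_div_iff₀ (by positivity) (by positivity)]
          nlinarith
        have h2 : 1 / (8 * d * C) * edgeLength x (u ∪ u') k =
            edgeLength x (u ∪ u') k / (4 * d * C) / 2 := by field_simp; ring
        have h3 : 2 * H < edgeLength x (u ∪ u') k / (4 * d * C) := by
          rw [lt_div_iff₀ (by positivity)]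
          have : 8 * d * C * H < edgeLength x (u ∪ u') k :=
            lt_of_le_of_lt (mul_le_mul_of_nonneg_right (by nlinarith) hH.le) (hE k)
          linarith
        linarith) i
    have hwi : edgeLength x (u ∪ u') i ≤ 16 * d * C * (K + 2) * H := by
      have h1 : edgeLength x (u ∪ u') i / (16 * d * C) ≤ (K + 2) * H := by
        have e : 1 / (8 * d * C) / 2 * edgeLength x (u ∪ u') i =
          edgeLength x (u ∪ u') i / (16 * d * C) := by field_simp; ring
        rw [e] at hmain
        linarith
      rw [div_le_iff₀ (by positivity)] at h1
      linarith
    intro j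
    have hc₀1 : c₀ ≤ 1 := by nlinarith
    have hasp := hfat.pow_mul_edgeLength_le hX hd hc₀ hc₀1 (hu.mono Finset.subset_union_left) hE4 i j
    have h1 := mul_le_mul_of_nonneg_right hB hH.le
    refine (edgeLength_mono hu (Finset.subset_union_left (s₂ := u')) j).trans ?_
    have hκ : 0 < (c₀ / (32 * d)) ^ d := by positivity
    refine le_of_mul_le_mul_left ?_ hκ
    linarith

end Shape

/-! ### Induction along the splits of a cluster tree -/

namespace ClusterTree

variable {d N : ℕ} {x : Fin N → Pt d}

theorem Node.of_splits {τ : ℕ} {Pr : Finset (Fin N) → ℕ → Prop}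
    (hstep : ∀ v₁ v₂ j, v₁.Nonempty → v₂.Nonempty → Disjoint v₁ v₂ → IsMedianSplit x v₁ v₂ →
      Pr (v₁ ∪ v₂) j → Pr v₁ (j + 1) ∧ Pr v₂ (j + 1))
    {T : ClusterTree N} (p : Node T) (hT : T.Valid) (hs : T.IsSplitTree x τ) {j : ℕ}
    (h : Pr T.cluster j) : Pr p.cluster (j + p.level) := by
  induction p generalizing j with
  | root T => exact h
  | left p ih =>
    have := ih hT.1 hs.1 (hstep _ _ j hT.1.nonempty hT.2.1.nonempty hT.2.2 hs.2.2 h).1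
    rw [add_assoc, add_comm 1] at this
    exact this
  | right p ih =>
    have := ih hT.2.1 hs.2.1 (hstep _ _ j hT.1.nonempty hT.2.1.nonempty hT.2.2 hs.2.2 h).2
    rw [add_assoc, add_comm 1] at this
    exact this

theorem Node.isSplitTree {τ : ℕ} {T : ClusterTree N} (p : Node T) (hs : T.IsSplitTree x τ) :
    p.subtree.IsSplitTree x τ := by
  induction p with
  | root T => exact hs
  | left p ih => exact ih hs.1
  | right p ih => exact ih hs.2.1

end ClusterTree

/-! ### The invariant of clusters: shape and number of points -/

section Invariant

variable {d N : ℕ} {x : Fin N → Pt d} {Ω : Set (Pt d)} {δ H : ℝ}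

/-- The properties of a cluster `v` on level `j` that are inherited by the sons. -/
structure ClusterBounds (x : Fin N → Pt d) (H K c₀ B : ℝ) (v : Finset (Fin N)) (j : ℕ) : Prop where
  isCell : IsCell x Finset.univ v Set.univ
  shape : IsGood x K c₀ H v ∨ ∀ i, edgeLength x v i ≤ B * H
  card_le : 2 ^ j * v.card + 2 ≤ N + 2 * 2 ^ j
  level_le : 2 ≤ v.card → 2 ^ j ≤ 2 * N
  le_card : N + 2 ≤ 2 ^ j * (v.card + 2)

/-- With `n` points in the parent, the son has between `n / 2 - 1` and `n / 2 + 1`. These maps fix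
`-2` and `2`, so `card + 2` at worst halves and `card - 2` at best halves; the bounds are iterated
in this form without subtraction. A son with two points has a parent with at least three, which
bounds the level. -/
theorem ClusterBounds.son (hX : IsSpread Ω x δ H) (hd : 0 < d) {M : ℕ}
    (hM : 3 * (8 * H + δ) ^ d < M * δ ^ d) {c₀ K B : ℝ} (hc₀ : 0 < c₀)
    (hc₀M : c₀ * (2 * (4 * d + 2 * M)) ≤ 1) (hK : 32 * d ^ 2 * (4 * d + 2 * M) ≤ K)
    (hB : 16 * d * (4 * d + 2 * M) * (K + 2) ≤ (c₀ / (32 * d)) ^ d * B)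
    {u u' : Finset (Fin N)} (hu : u.Nonempty) (hu' : u'.Nonempty) (hdis : Disjoint u u') {ℓ : Fin d}
    (hℓ : ∀ k, edgeLength x (u ∪ u') k ≤ edgeLength x (u ∪ u') ℓ)
    (hsep : IsSeparated x u u' ℓ) (hcard : u'.card ≤ u.card + 2) (hcard' : u.card ≤ u'.card + 2)
    {j : ℕ} (h : ClusterBounds x H K c₀ B (u ∪ u') j) : ClusterBounds x H K c₀ B u (j + 1) := by
  have hsum := Finset.card_union_of_disjoint hdis
  have h1 := h.card_le
  have h2 := h.le_card
  have hpos : 0 < 2 ^ j := by positivity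
  have hpu' := hu'.card_pos
  rw [hsum] at h1 h2
  constructor
  · have := h.isCell.trans (hsep.isCell hu) hu
    rwa [Set.univ_union] at this
  · exact isGood_or_small_of_split hX hd h.isCell hu hℓ hsep hcard hM hc₀ hc₀M hK hB h.shape
  · have : 2 ^ j * (2 * u.card) ≤ 2 ^ j * (u.card + u'.card + 2) :=
      Nat.mul_le_mul_left _ (by omega)
    rw [pow_succ]
    linarith
  · intro h3
    have : 2 ^ j * 3 ≤ 2 ^ j * (u.card + u'.card) := Nat.mul_le_mul_left _ (by omega)
    rw [pow_succ]
    linarith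
  · have : 2 ^ j * (u.card + u'.card + 2) ≤ 2 ^ j * (2 * (u.card + 2)) :=
      Nat.mul_le_mul_left _ (by omega)
    rw [pow_succ]
    linarith

theorem ClusterBounds.sons (hX : IsSpread Ω x δ H) (hd : 0 < d) {M : ℕ}
    (hM : 3 * (8 * H + δ) ^ d < M * δ ^ d) {c₀ K B : ℝ} (hc₀ : 0 < c₀)
    (hc₀M : c₀ * (2 * (4 * d + 2 * M)) ≤ 1) (hK : 32 * d ^ 2 * (4 * d + 2 * M) ≤ K)
    (hB : 16 * d * (4 * d + 2 * M) * (K + 2) ≤ (c₀ / (32 * d)) ^ d * B)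
    {v₁ v₂ : Finset (Fin N)} (h₁ : v₁.Nonempty) (h₂ : v₂.Nonempty) (hdis : Disjoint v₁ v₂)
    (hs : IsMedianSplit x v₁ v₂) {j : ℕ} (h : ClusterBounds x H K c₀ B (v₁ ∪ v₂) j) :
    ClusterBounds x H K c₀ B v₁ (j + 1) ∧ ClusterBounds x H K c₀ B v₂ (j + 1) := by
  obtain ⟨ℓ, c, hℓ, -, hup, hdown, hc1, hc2⟩ := hs
  constructor
  · exact h.son hX hd hM hc₀ hc₀M hK hB h₁ h₂ hdis hℓ ⟨c, Or.inl ⟨hup, hdown⟩⟩ (by omega) hc2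
  · rw [Finset.union_comm] at h hℓ
    exact h.son hX hd hM hc₀ hc₀M hK hB h₂ h₁ hdis.symm hℓ ⟨c, Or.inr ⟨hdown, hup⟩⟩ hc2 (by omega)

/-- The edges of the root lie between `2 * ρ - 2 * H` and `2 * Δ`. If `H` is not small compared to
`ρ`, the second alternative of the shape condition holds; otherwise the root is its own reference
cell for every `S`. -/
theorem clusterBounds_root (hX : IsSpread Ω x δ H) {z₀ : Pt d} {ρ Δ : ℝ} (hρ : 0 < ρ)
    (hball : Metric.closedBall z₀ ρ ⊆ Ω) (hΔ : ∀ i j, dist (x i) (x j) ≤ 2 * Δ) (hne : 0 < N)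
    {c₀ K B : ℝ} (hc₀ : c₀ * (2 * Δ) ≤ ρ) (hc₀0 : 0 ≤ c₀) (hB : 2 * Δ * K ≤ B * ρ) (hK : 2 ≤ K)
    (hΔ0 : 0 ≤ Δ) : ClusterBounds x H K c₀ B Finset.univ 0 := by
  have huniv : (Finset.univ : Finset (Fin N)).Nonempty := ⟨⟨0, hne⟩, Finset.mem_univ _⟩
  have hH := hX.H_pos
  have hup : ∀ i, edgeLength x Finset.univ i ≤ 2 * Δ := by
    intro i
    obtain ⟨a, ha, hae⟩ := exists_eq_boxLo (x := x) huniv i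
    obtain ⟨b, hb, hbe⟩ := exists_eq_boxHi (x := x) huniv i
    rw [edgeLength_eq, ← hae, ← hbe]
    exact (le_abs_self _).trans ((abs_sub_apply_le_dist _ _ i).trans (hΔ b a))
  have hlow : ∀ i, 2 * ρ - 2 * H ≤ edgeLength x Finset.univ i := by
    intro i
    have hmem : ∀ s : ℝ, |s| = ρ → ∃ k, |z₀ i + s - x k i| ≤ H := by
      intro s hs
      obtain ⟨k, hk⟩ := hX.fill (z₀ + EuclideanSpace.single i s) (hball (by
        rw [Metric.mem_closedBall, dist_eq_norm, add_sub_cancel_left]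
        simp [hs]))
      refine ⟨k, ?_⟩
      have := (abs_sub_apply_le_dist _ _ i).trans hk
      simpa using this
    obtain ⟨a, ha⟩ := hmem (-ρ) (by rw [abs_neg, abs_of_pos hρ])
    obtain ⟨b, hb⟩ := hmem ρ (abs_of_pos hρ)
    have h1 := (abs_le.1 (abs_sub_le_edgeLength (x := x) (Finset.mem_univ b)
      (Finset.mem_univ a) i)).2
    linarith [(abs_le.1 ha).1, (abs_le.1 hb).2]
  refine ⟨isCell_self _ _, ?_, by simp, fun _ => by simp; omega, by simp⟩
  by_cases hsmall : 2 * Δ ≤ B * H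
  · exact Or.inr fun i => (hup i).trans hsmall
  · left
    push Not at hsmall
    have hKH : K * H < ρ := by
      have h1 : 2 * Δ * (K * H) ≤ B * H * ρ := by nlinarith
      have hΔpos : 0 < 2 * Δ := by
        rcases hΔ0.eq_or_lt with h0 | h0
        · exfalso
          rw [← h0] at hsmall hB
          have : 0 ≤ B := by
            by_contra! hneg
            nlinarith
          nlinarith
        · linarith
      have h2 : 2 * Δ * (K * H) < 2 * Δ * ρ := lt_of_le_of_lt h1 (by nlinarith)
      exact lt_of_mul_lt_mul_left h2 hΔpos.le
    have h2H : 2 * H < ρ := by nlinarith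
    have hge : ∀ i, ρ ≤ edgeLength x Finset.univ i := fun i => by linarith [hlow i]
    refine ⟨fun i => hKH.trans_le (hge i), fun S hS => ?_⟩
    obtain ⟨k, hk⟩ := hS
    refine ⟨Finset.univ, isCell_self _ _, isCell_self _ _, k, hk, fun i _ => ?_⟩
    exact (mul_le_mul_of_nonneg_left (hup i) hc₀0).trans (hc₀.trans (hge k))

end Invariant

end Samplet

namespace Samplet

open ClusterTree (edgeLength IsMedianSplit)

/-! ### Polynomials with many zeros -/

section ManyZeros

variable {d q : ℕ}

theorem contDiff_monomial (α : MultiIndex d q) : ContDiff ℝ 1 (monomial α) := by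
  unfold monomial
  fun_prop

theorem continuous_polyEval (c : MultiIndex d q → ℝ) : Continuous (polyEval c) := by
  unfold polyEval
  exact continuous_finsetSum _ fun α _ => (contDiff_monomial α).continuous.const_smul (c α)

theorem eq_zero_of_polyEval_eq_zero {c : MultiIndex d q → ℝ}
    (h : ∀ z ∈ Metric.closedBall (0 : Pt d) 1, polyEval c z = 0) : c = 0 := by
  obtain ⟨P, -, hcoeff, hP⟩ := exists_eval_eq c
  have hε : 0 < 1 / ((d : ℝ) + 1) := by positivity
  have h0 : P = 0 := by
    refine MvPolynomial.funext_set (fun _ => Set.Icc 0 (1 / ((d : ℝ) + 1)))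
      (fun _ => Set.Icc_infinite hε) fun z hz => ?_
    rw [map_zero]
    refine (hP (WithLp.toLp 2 z)).trans (h _ ?_)
    rw [mem_closedBall_zero_iff]
    refine (norm_le_of_forall_abs_le (L := 1 / ((d : ℝ) + 1)) fun i => ?_).trans ?_
    · have := hz i (Set.mem_univ i)
      rw [abs_of_nonneg this.1]
      exact this.2
    · rw [mul_one_div, div_le_one (by positivity)]
      linarith
  funext α
  rw [← hcoeff α, h0, MvPolynomial.coeff_zero, Pi.zero_apply]

/-- An affine substitution does not raise the total degree; this reduces statements on arbitrary
balls to the unit ball. -/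
theorem exists_polyEval_affine (c : MultiIndex d q → ℝ) (y : Pt d) (R : ℝ) :
    ∃ c' : MultiIndex d q → ℝ, ∀ z, polyEval c' z = polyEval c (y + R • z) := by
  have hdeg : (∑ α : MultiIndex d q, MvPolynomial.C (c α) *
      ∏ i, (MvPolynomial.C (y i) + MvPolynomial.C R * MvPolynomial.X i) ^ (α.1 i : ℕ) :
      MvPolynomial (Fin d) ℝ).totalDegree ≤ q := by
    refine MvPolynomial.totalDegree_finsetSum_le fun α _ => ?_
    refine (MvPolynomial.totalDegree_mul _ _).trans ?_
    rw [MvPolynomial.totalDegree_C, zero_add]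
    refine (MvPolynomial.totalDegree_finsetProd _ _).trans
      (le_trans (Finset.sum_le_sum fun i _ => ?_) α.2)
    refine (MvPolynomial.totalDegree_pow _ _).trans (mul_le_of_le_one_right (Nat.zero_le _) ?_)
    refine (MvPolynomial.totalDegree_add _ _).trans (max_le (by simp) ?_)
    refine (MvPolynomial.totalDegree_mul _ _).trans ?_
    simp [MvPolynomial.totalDegree_X]
  obtain ⟨c', hc'⟩ := exists_polyEval_eq hdeg
  refine ⟨c', fun z => ?_⟩
  rw [← hc']
  simp [polyEval, monomial]

/-- A polynomial of degree at most `q` that has zeros close to all points of a sufficiently large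
ball vanishes. -/
theorem exists_const_eq_zero_of_dense_zeros (d q : ℕ) :
    ∃ K : ℝ, 1 ≤ K ∧ ∀ (c : MultiIndex d q → ℝ) (y₀ : Pt d) (R H : ℝ), 0 < R → 0 ≤ H → K * H ≤ R →
      (∀ y ∈ Metric.closedBall y₀ R, ∃ z, dist y z ≤ H ∧ polyEval c z = 0) → c = 0 := by
  have : CompactSpace (Metric.closedBall (0 : Pt d) 1) :=
    isCompact_iff_compactSpace.1 (isCompact_closedBall _ _)
  let A : (MultiIndex d q → ℝ) →ₗ[ℝ] C(Metric.closedBall (0 : Pt d) 1, ℝ) :=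
    { toFun := fun c => ⟨fun z => polyEval c z, (continuous_polyEval c).comp continuous_subtype_val⟩
      map_add' := fun a b => by ext z; exact polyEval_add a b z
      map_smul' := fun t a => by ext z; exact polyEval_smul t a z }
  -- On the finite-dimensional space of coefficients, the supremum over the unit ball bounds the
  -- coefficients.
  obtain ⟨κ, -, hκ⟩ := A.exists_antilipschitzWith (by
    rw [LinearMap.ker_eq_bot']
    exact fun c hc => eq_zero_of_polyEval_eq_zero fun z hz => DFunLike.congr_fun hc ⟨z, hz⟩)
  have hlip : ∀ α : MultiIndex d q, ∃ L : ℝ≥0,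
      LipschitzOnWith L (monomial α) (Metric.closedBall (0 : Pt d) 2) := fun α =>
    (contDiff_monomial α).contDiffOn.exists_lipschitzOnWith one_ne_zero (convex_closedBall _ _)
      (isCompact_closedBall _ _)
  choose L hL using hlip
  set Λ : ℝ := ∑ α, (L α : ℝ) with hΛ
  have hΛ0 : 0 ≤ Λ := Finset.sum_nonneg fun α _ => (L α).2
  have hbound : ∀ (c : MultiIndex d q → ℝ), ∀ y ∈ Metric.closedBall (0 : Pt d) 2,
      ∀ z ∈ Metric.closedBall (0 : Pt d) 2, |polyEval c y - polyEval c z| ≤ ‖c‖ * Λ * dist y z := by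
    intro c y hy z hz
    rw [polyEval, polyEval, ← Finset.sum_sub_distrib, hΛ, Finset.mul_sum, Finset.sum_mul]
    refine (Finset.abs_sum_le_sum_abs _ _).trans (Finset.sum_le_sum fun α _ => ?_)
    rw [← mul_sub, abs_mul, mul_assoc]
    refine mul_le_mul (norm_le_pi_norm c α) ?_ (abs_nonneg _) (norm_nonneg _)
    rw [← Real.dist_eq]
    exact (hL α).dist_le_mul y hy z hz
  -- After rescaling, zeros are `H / R`-dense, so the supremum is at most `‖c'‖ * Λ * (H / R)`. This
  -- contradicts the bound by `κ` as soon as `κ * Λ * (H / R) < 1`, unless `c' = 0`.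
  refine ⟨κ * Λ + 1, by have : (0 : ℝ) ≤ κ := κ.2; nlinarith, fun c y₀ R H hR hH hK hz => ?_⟩
  have hκ0 : (0 : ℝ) ≤ κ := κ.2
  obtain ⟨c', hc'⟩ := exists_polyEval_affine c y₀ R
  have hη1 : H / R ≤ 1 := by
    rw [div_le_one hR]
    nlinarith [mul_nonneg hκ0 hΛ0]
  have hη0 : 0 ≤ H / R := by positivity
  have hc'0 : c' = 0 := by
    have hA : ‖A c'‖ ≤ ‖c'‖ * Λ * (H / R) := by
      refine (ContinuousMap.norm_le _ (by positivity)).2 fun ⟨y, hy⟩ => ?_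
      rw [mem_closedBall_zero_iff] at hy
      obtain ⟨z, hyz, hz0⟩ := hz (y₀ + R • y) (by
        rw [Metric.mem_closedBall, dist_eq_norm, add_sub_cancel_left, norm_smul, Real.norm_eq_abs,
          abs_of_pos hR]
        nlinarith)
      have hzz : y₀ + R • (R⁻¹ • (z - y₀)) = z := by
        rw [smul_inv_smul₀ hR.ne']; abel
      have hd : dist y (R⁻¹ • (z - y₀)) ≤ H / R := by
        have e : y - R⁻¹ • (z - y₀) = R⁻¹ • (y₀ + R • y - z) := by
          rw [show y₀ + R • y - z = R • y - (z - y₀) by abel, smul_sub R⁻¹ (R • y), inv_smul_smul₀ hR.ne']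
        rw [dist_eq_norm, e, norm_smul, ← dist_eq_norm, Real.norm_eq_abs,
          abs_of_pos (inv_pos.2 hR), inv_mul_eq_div]
        exact div_le_div_of_nonneg_right hyz hR.le
      have h1 := hbound c' y (by rw [mem_closedBall_zero_iff]; linarith) (R⁻¹ • (z - y₀)) (by
        rw [mem_closedBall_zero_iff]
        have h2 := norm_sub_norm_le (R⁻¹ • (z - y₀)) y
        rw [← dist_eq_norm, dist_comm] at h2
        linarith)
      rw [hc' (R⁻¹ • (z - y₀)), hzz, hz0, sub_zero] at h1
      exact h1.trans (mul_le_mul_of_nonneg_left hd (by positivity))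
    have h3 : ‖c'‖ ≤ κ * ‖A c'‖ := by
      have := hκ.le_mul_dist c' 0
      rwa [map_zero, dist_zero_right, dist_zero_right] at this
    have h4 : κ * Λ * (H / R) < 1 := by
      rw [mul_div_assoc', div_lt_one hR]
      rcases hH.eq_or_lt with h0 | h0
      · rw [← h0]; simpa using hR
      · linarith
    have h5 : ‖c'‖ ≤ ‖c'‖ * (κ * Λ * (H / R)) := by
      calc ‖c'‖ ≤ κ * ‖A c'‖ := h3
        _ ≤ κ * (‖c'‖ * Λ * (H / R)) := mul_le_mul_of_nonneg_left hA hκ0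
        _ = ‖c'‖ * (κ * Λ * (H / R)) := by ring
    by_contra hne
    have : 0 < ‖c'‖ := norm_pos_iff.2 hne
    nlinarith
  refine eq_zero_of_polyEval_eq_zero fun z _ => ?_
  have h6 := hc' (R⁻¹ • (z - y₀))
  rw [hc'0, smul_inv_smul₀ hR.ne', add_sub_cancel] at h6
  rw [← h6]
  simp [polyEval]

end ManyZeros

/-! ### Sizes of clusters -/

section Sizes

variable {d N : ℕ} {x : Fin N → Pt d} {Ω : Set (Pt d)} {δ H : ℝ}

/-- A fat cluster contains points close to all points of a ball whose size is comparable to the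
shortest edge of the bounding box. -/
theorem IsSpread.exists_ball (hX : IsSpread Ω x δ H) (hd : 0 < d) {v : Finset (Fin N)}
    (hv : IsCell x Finset.univ v Set.univ) (hne : v.Nonempty) {z₀ : Pt d} {ρ D s : ℝ}
    (hball : Metric.closedBall z₀ ρ ⊆ Ω) (hD : ∀ y ∈ Ω, ∀ z ∈ Ω, dist y z ≤ D)
    (hs : ∀ i, s ≤ edgeLength x v i) (hH : 4 * d * H < s) :
    ∃ y₀, ∀ y ∈ Metric.closedBall y₀ (s / (8 * d * D) * ρ), ∃ k ∈ v, dist y (x k) ≤ H := by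
  have hd' : (1 : ℝ) ≤ d := by exact_mod_cast hd
  have hH0 := hX.H_pos
  have hs0 : 0 < s := lt_trans (by positivity) hH
  have hsD : s ≤ D := by
    have i : Fin d := ⟨0, hd⟩
    obtain ⟨a, ha, hae⟩ := exists_eq_boxLo (x := x) hne i
    obtain ⟨b, hb, hbe⟩ := exists_eq_boxHi (x := x) hne i
    refine (hs i).trans ?_
    rw [edgeLength_eq, ← hae, ← hbe]
    exact (le_abs_self _).trans ((abs_sub_apply_le_dist _ _ i).trans
      (hD _ (hX.mem b) _ (hX.mem a)))
  have hD0 : 0 < D := hs0.trans_le hsD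
  obtain ⟨m, hmΩ, hm⟩ := exists_deep hd hne hX.convex hX.mem
  -- Contract the ball in `Ω` towards `m` by this ratio: points move at most `t * D = s / (8 * d)`
  -- away from `m`, whose depth is at least four times that, and `H` is less than twice that.
  set t := s / (8 * d * D) with ht
  have ht0 : 0 < t := by positivity
  have ht1 : t ≤ 1 := by
    rw [ht, div_le_one (by positivity)]
    nlinarith
  have htD : t * D = s / (8 * d) := by
    rw [ht]; field_simp
  refine ⟨(1 - t) • m + t • z₀, fun y hy => ?_⟩
  obtain ⟨z, hz, rfl⟩ : ∃ z ∈ Metric.closedBall z₀ ρ, y = (1 - t) • m + t • z := by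
    refine ⟨z₀ + t⁻¹ • (y - ((1 - t) • m + t • z₀)), ?_, ?_⟩
    · rw [Metric.mem_closedBall, dist_eq_norm, add_sub_cancel_left, norm_smul, Real.norm_eq_abs,
        abs_of_pos (inv_pos.2 ht0), inv_mul_le_iff₀ ht0, ← dist_eq_norm]
      exact hy
    · rw [smul_add, smul_inv_smul₀ ht0.ne']
      abel
  have hzΩ := hball hz
  refine hX.exists_mem_dist_le hv (isCell_self v ∅)
    (hX.convex hmΩ hzΩ (by linarith) ht0.le (by ring)) (fun i => ?_)
    (fun i hi => absurd hi (Set.notMem_empty i))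
  have hcoord : ((1 - t) • m + t • z) i = m i + t * (z i - m i) := by
    simp only [PiLp.add_apply, PiLp.smul_apply, smul_eq_mul]
    ring
  have h1 := abs_le.1 ((abs_sub_apply_le_dist z m i).trans (hD z hzΩ m hmΩ))
  have h2 : t * (-D) ≤ t * (z i - m i) := mul_le_mul_of_nonneg_left h1.1 ht0.le
  have h3 : t * (z i - m i) ≤ t * D := mul_le_mul_of_nonneg_left h1.2 ht0.le
  have h4 : s / (2 * d) ≤ edgeLength x v i / (2 * d) :=
    div_le_div_of_nonneg_right (hs i) (by positivity)
  have h5 : s / (2 * d) = 4 * (s / (8 * d)) := by field_simp; ring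
  have h6 : H < 2 * (s / (8 * d)) := by
    rw [mul_div_assoc', lt_div_iff₀ (by positivity)]
    linarith
  have h7 : 0 < s / (8 * d) := by positivity
  rw [hcoord]
  constructor <;> linarith [hm i]

/-- The bounds on the clusters of quasi-uniform points hold with constants that do not depend on the
points. -/
theorem exists_clusterBounds (hd : 0 < d) (c : ℝ) {ρ D : ℝ} (hρ : 0 < ρ) (hD : 0 < D) :
    ∃ c₀ K B : ℝ, 0 < c₀ ∧ c₀ ≤ 1 ∧ 4 * d ≤ K ∧ 0 < B ∧
      ∀ (N : ℕ) (x : Fin N → Pt d) (Ω : Set (Pt d)) (z₀ : Pt d) (δ : ℝ),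
        IsSpread Ω x δ (c * δ) → Metric.closedBall z₀ ρ ⊆ Ω →
        (∀ y ∈ Ω, ∀ z ∈ Ω, dist y z ≤ D) →
        (0 < N → ClusterBounds x (c * δ) K c₀ B Finset.univ 0) ∧
        ∀ v₁ v₂ j, v₁.Nonempty → v₂.Nonempty → Disjoint v₁ v₂ → IsMedianSplit x v₁ v₂ →
          ClusterBounds x (c * δ) K c₀ B (v₁ ∪ v₂) j →
          ClusterBounds x (c * δ) K c₀ B v₁ (j + 1) ∧ ClusterBounds x (c * δ) K c₀ B v₂ (j + 1) := by
  have hd' : (1 : ℝ) ≤ d := by exact_mod_cast hd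
  -- For `H = c * δ` the ratio `(8 * H + δ) / δ` of the packing bound is `8 * c + 1`, independent of
  -- the points.
  obtain ⟨M, hM⟩ := exists_nat_gt (3 * (8 * c + 1) ^ d)
  have hM0 : (0 : ℝ) ≤ M := Nat.cast_nonneg M
  set C : ℝ := 4 * d + 2 * M with hC
  have hC4 : 4 ≤ C := by linarith
  -- The first bound is for the loss at a split, the second for the root.
  set c₀ : ℝ := min (1 / (2 * C)) (ρ / D) with hc₀
  have hc₀0 : 0 < c₀ := lt_min (by positivity) (by positivity)
  have hc₀C : c₀ * (2 * C) ≤ 1 := by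
    have h1 : c₀ ≤ 1 / (2 * C) := min_le_left _ _
    rwa [le_div_iff₀ (by positivity)] at h1
  have hc₀D : c₀ * D ≤ ρ := by
    have h1 : c₀ ≤ ρ / D := min_le_right _ _
    rwa [le_div_iff₀ hD] at h1
  set K : ℝ := 32 * d ^ 2 * C with hK
  have hd2 : (d : ℝ) ≤ d ^ 2 := by nlinarith
  have hK4 : 4 * (d : ℝ) ≤ K := by nlinarith
  set B : ℝ := max (16 * d * C * (K + 2) / (c₀ / (32 * d)) ^ d) (D * K / ρ) with hB
  have hB1 : 16 * d * C * (K + 2) ≤ (c₀ / (32 * d)) ^ d * B := by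
    have h1 : 16 * d * C * (K + 2) / (c₀ / (32 * d)) ^ d ≤ B := le_max_left _ _
    rw [div_le_iff₀ (by positivity)] at h1
    linarith
  have hB2 : D * K ≤ B * ρ := by
    have h1 : D * K / ρ ≤ B := le_max_right _ _
    rwa [div_le_iff₀ hρ] at h1
  have hB0 : 0 < B := lt_of_lt_of_le (by positivity) (le_max_right _ _)
  refine ⟨c₀, K, B, hc₀0, by nlinarith, hK4, hB0, fun N x Ω z₀ δ hX hball hdist => ⟨fun hN => ?_,
    fun v₁ v₂ j h₁ h₂ hdis hs h => ?_⟩⟩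
  · exact clusterBounds_root hX hρ hball (Δ := D / 2)
      (fun i j => (hdist _ (hX.mem i) _ (hX.mem j)).trans (by linarith)) hN (by linarith) hc₀0.le
      (by linarith) (by linarith) (by positivity)
  · refine h.sons hX hd (M := M) ?_ hc₀0 hc₀C le_rfl hB1 h₁ h₂ hdis hs
    have e : 8 * (c * δ) + δ = (8 * c + 1) * δ := by ring
    rw [e, mul_pow, ← mul_assoc]
    exact mul_lt_mul_of_pos_right hM (pow_pos hX.pos d)

end Sizes

end Samplet

namespace Samplet

open ClusterTree (edgeLength IsMedianSplit)

/-! ### Diameters of clusters and nonzeros of polynomials -/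

section Localization

variable {d N : ℕ} {x : Fin N → Pt d} {Ω : Set (Pt d)} {δ : ℝ}

theorem diam_le_of_edgeLength_le {v : Finset (Fin N)} {L : ℝ} (hL0 : 0 ≤ L)
    (hL : ∀ i, edgeLength x v i ≤ L) : diam x v ≤ d * L := by
  refine Metric.diam_le_of_forall_dist_le (by positivity) ?_
  rintro _ ⟨k, hk, rfl⟩ _ ⟨l, hl, rfl⟩
  exact dist_le_of_edgeLength_le hL hk hl

theorem IsSpread.card_univ_mul_pow_le {H : ℝ} (hX : IsSpread Ω x δ H) {D : ℝ}
    (hD : ∀ y ∈ Ω, ∀ z ∈ Ω, dist y z ≤ D) {i j : Fin N} (hij : i ≠ j) :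
    N * δ ^ d ≤ (2 * D) ^ d := by
  have h1 : 2 * δ ≤ D := (hX.sep i j hij).trans (hD _ (hX.mem i) _ (hX.mem j))
  have hδ := hX.pos
  have h2 := card_mul_pow_le (s := Finset.univ) hδ (by linarith : 0 ≤ D) hX.sep (y := x i)
    fun k _ => hD _ (hX.mem k) _ (hX.mem i)
  rw [Finset.card_univ, Fintype.card_fin] at h2
  exact h2.trans (pow_le_pow_left₀ (by linarith) (by linarith) d)

theorem level_scale (hd : 0 < d) (j : ℕ) :
    0 < (2 : ℝ) ^ (-(j : ℝ) / d) ∧ ((2 : ℝ) ^ (-(j : ℝ) / d)) ^ d * 2 ^ j = 1 := by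
  refine ⟨by positivity, ?_⟩
  have hd' : (d : ℝ) ≠ 0 := by exact_mod_cast hd.ne'
  rw [← Real.rpow_natCast, ← Real.rpow_mul (by norm_num), div_mul_cancel₀ _ hd',
    Real.rpow_neg (by norm_num), Real.rpow_natCast, inv_mul_cancel₀ (by positivity)]

/-- Moves numerical factors into a `d`-th power so that roots can be taken. -/
theorem mul_pow_le_pow {a b : ℝ} (hd : 0 < d) (ha : 1 ≤ a) (hb : 0 ≤ b) :
    a * b ^ d ≤ (a * b) ^ d := by
  rw [mul_pow]
  exact mul_le_mul_of_nonneg_right (le_self_pow₀ ha hd.ne') (pow_nonneg hb d)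

/-- The clusters on level `j` have diameters of order at most `2 ^ (-j / d)`. -/
theorem exists_edgeLength_le (hd : 0 < d) {c c₀ K B ρ D : ℝ} (hc : 1 ≤ c) (hρ : 0 < ρ) (hD0 : 0 < D)
    (hc₀ : 0 < c₀) (hc₀1 : c₀ ≤ 1) (hK : 4 * d ≤ K) (hB : 0 < B) {z₀ : Pt d}
    (hball : Metric.closedBall z₀ ρ ⊆ Ω) (hD : ∀ y ∈ Ω, ∀ z ∈ Ω, dist y z ≤ D) :
    ∃ C : ℝ, 0 < C ∧ ∀ (N : ℕ) (x : Fin N → Pt d) (δ : ℝ), IsSpread Ω x δ (c * δ) →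
      ∀ (v : Finset (Fin N)) (j : ℕ), 2 ≤ v.card → ClusterBounds x (c * δ) K c₀ B v j →
      ∀ i, edgeLength x v i ≤ C * (2 : ℝ) ^ (-(j : ℝ) / d) := by
  set κ := (c₀ / (32 * d)) ^ d with hκ
  have hd' : (0 : ℝ) < d := by exact_mod_cast hd
  have hκ0 : 0 < κ := by positivity
  refine ⟨4 * B * c * D + 80 * d * c * D ^ 2 / (ρ * κ), by positivity,
    fun N x δ hX v j hv h i => ?_⟩
  obtain ⟨hr, hrj⟩ := level_scale hd j
  set r := (2 : ℝ) ^ (-(j : ℝ) / d) with hrdef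
  have hvne : v.Nonempty := Finset.card_pos.1 (by omega)
  obtain ⟨a, -, b, -, hab⟩ := Finset.one_lt_card.1 (by omega : 1 < v.card)
  have hN := hX.card_univ_mul_pow_le hD hab
  have hδ := hX.pos
  have hlev : (2 : ℝ) ^ j ≤ 2 * N := by exact_mod_cast h.level_le hv
  have h2j : (0 : ℝ) < 2 ^ j := by positivity
  have hA : 0 ≤ 4 * B * c * D := by positivity
  have hA' : 0 ≤ 80 * d * c * D ^ 2 / (ρ * κ) := by positivity
  -- A good cluster is dense in a ball comparable to its shortest edge, so covering by its at most
  -- `5 * N / 2 ^ j` points bounds that edge, and thereby all edges. A small one has edges of order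
  -- `δ`, and `2 ^ j ≤ 2 * N` bounds `δ` by packing.
  rcases h.shape with hgood | hsmall
  · obtain ⟨i₀, -, hi₀⟩ := Finset.univ.exists_min_image (edgeLength x v) ⟨i, Finset.mem_univ i⟩
    have hH0 := hX.H_pos
    have hE : ∀ i, 4 * d * (c * δ) < edgeLength x v i := fun i =>
      lt_of_le_of_lt (mul_le_mul_of_nonneg_right hK hH0.le) (hgood.1 i)
    obtain ⟨y₀, hy₀⟩ := hX.exists_ball hd h.isCell hvne hball hD
      (fun i => hi₀ i (Finset.mem_univ i)) (hE i₀)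
    have hs0 : 0 < edgeLength x v i₀ := lt_trans (by positivity) (hE i₀)
    set R := edgeLength x v i₀ / (8 * d * D) * ρ with hR
    have hR0 : 0 < R := by positivity
    have hcover := pow_le_card_mul_pow hH0.le hR0 fun y hy =>
      hy₀ y (Metric.ball_subset_closedBall hy)
    have hcard : (2 : ℝ) ^ j * v.card ≤ 5 * N := by
      have h1 : (2 : ℝ) ^ j * v.card + 2 ≤ N + 2 * 2 ^ j := by exact_mod_cast h.card_le
      linarith
    have hpow : R ^ d ≤ (10 * c * D * r) ^ d := by
      have h1 : R ^ d * 2 ^ j ≤ (10 * c * D) ^ d := by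
        calc R ^ d * 2 ^ j ≤ v.card * (c * δ) ^ d * 2 ^ j :=
              mul_le_mul_of_nonneg_right hcover h2j.le
          _ = (2 ^ j * v.card) * (c * δ) ^ d := by ring
          _ ≤ 5 * N * (c * δ) ^ d := mul_le_mul_of_nonneg_right hcard (by positivity)
          _ = 5 * c ^ d * (N * δ ^ d) := by rw [mul_pow]; ring
          _ ≤ 5 * c ^ d * (2 * D) ^ d := mul_le_mul_of_nonneg_left hN (by positivity)
          _ = 5 * (c * (2 * D)) ^ d := by rw [mul_pow c]; ring
          _ ≤ (5 * (c * (2 * D))) ^ d := mul_pow_le_pow hd (by norm_num) (by positivity)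
          _ = (10 * c * D) ^ d := by ring_nf
      refine le_of_mul_le_mul_right ?_ h2j
      rw [mul_pow _ r, mul_assoc, hrj, mul_one]
      exact h1
    have hRle : R ≤ 10 * c * D * r := le_of_pow_le_pow_left₀ hd.ne' (by positivity) hpow
    have hasp := hgood.2.pow_mul_edgeLength_le hX hd hc₀ hc₀1 hvne hE i₀ i
    have hs : edgeLength x v i₀ * ρ ≤ 80 * d * c * D ^ 2 * r := by
      have e : edgeLength x v i₀ * ρ = R * (8 * d * D) := by rw [hR]; field_simp
      rw [e]
      have := mul_le_mul_of_nonneg_right hRle (by positivity : 0 ≤ 8 * d * D)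
      linarith
    have h3 : edgeLength x v i ≤ 80 * d * c * D ^ 2 / (ρ * κ) * r := by
      rw [div_mul_eq_mul_div, le_div_iff₀ (by positivity)]
      have := mul_le_mul_of_nonneg_right hasp hρ.le
      linarith
    have := mul_nonneg hA hr.le
    linarith
  · have hpow : δ ^ d ≤ (4 * D * r) ^ d := by
      have h1 : δ ^ d * 2 ^ j ≤ (4 * D) ^ d := by
        calc δ ^ d * 2 ^ j ≤ δ ^ d * (2 * N) := mul_le_mul_of_nonneg_left hlev (by positivity)
          _ = 2 * (N * δ ^ d) := by ring
          _ ≤ 2 * (2 * D) ^ d := by linarith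
          _ ≤ (2 * (2 * D)) ^ d := mul_pow_le_pow hd (by norm_num) (by positivity)
          _ = (4 * D) ^ d := by ring_nf
      refine le_of_mul_le_mul_right ?_ h2j
      rw [mul_pow _ r, mul_assoc, hrj, mul_one]
      exact h1
    have hle : δ ≤ 4 * D * r := le_of_pow_le_pow_left₀ hd.ne' (by positivity) hpow
    have h1 := mul_le_mul_of_nonneg_left hle (by positivity : 0 ≤ B * c)
    have h2 := hsmall i
    have := mul_nonneg hA' hr.le
    linarith

/-- The sons of a cluster on a coarse level `j` have leading edges of order `2 ^ (-j / d)`. -/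
theorem IsSpread.le_edgeLength {c ρ : ℝ} (hX : IsSpread Ω x δ (c * δ)) (hd : 0 < d) (hc : 0 < c)
    (hρ : 0 < ρ) {z₀ : Pt d} (hball : Metric.closedBall z₀ ρ ⊆ Ω) {v : Finset (Fin N)} {j : ℕ}
    (hcard : N ≤ 2 ^ j * (4 * v.card)) (hv : v.Nonempty) {L : ℝ}
    (hL : ∀ i, edgeLength x v i ≤ L) (hL0 : 0 ≤ L) :
    ρ * (2 : ℝ) ^ (-(j : ℝ) / d) ≤ 4 * c * (d * L + δ) := by
  obtain ⟨hr, hrj⟩ := level_scale hd j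
  set r := (2 : ℝ) ^ (-(j : ℝ) / d) with hrdef
  have hδ := hX.pos
  obtain ⟨k, hk⟩ := hv
  have h1 : ρ ^ d ≤ N * (c * δ) ^ d := by
    have := pow_le_card_mul_pow (s := Finset.univ) (x := x) hX.H_pos.le hρ (y := z₀)
      fun y hy => by
        obtain ⟨i, hi⟩ := hX.fill y (hball (Metric.ball_subset_closedBall hy))
        exact ⟨i, Finset.mem_univ i, hi⟩
    rwa [Finset.card_univ, Fintype.card_fin] at this
  have h2 := card_mul_pow_le (s := v) hδ (by positivity : 0 ≤ d * L) hX.sep (y := x k)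
    fun i hi => dist_le_of_edgeLength_le hL hi hk
  have h3 : (N : ℝ) ≤ 2 ^ j * (4 * v.card) := by exact_mod_cast hcard
  have h4 : (ρ * r) ^ d ≤ (4 * (c * (d * L + δ))) ^ d := by
    calc (ρ * r) ^ d = ρ ^ d * r ^ d := mul_pow _ _ _
      _ ≤ 2 ^ j * (4 * v.card) * (c * δ) ^ d * r ^ d := by
          refine mul_le_mul_of_nonneg_right (h1.trans ?_) (by positivity)
          exact mul_le_mul_of_nonneg_right h3 (by positivity)
      _ = 4 * (c ^ d * (v.card * δ ^ d)) * (r ^ d * 2 ^ j) := by rw [mul_pow]; ring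
      _ = 4 * (c ^ d * (v.card * δ ^ d)) := by rw [hrj, mul_one]
      _ ≤ 4 * (c ^ d * (d * L + δ) ^ d) := by gcongr
      _ = 4 * (c * (d * L + δ)) ^ d := by rw [mul_pow c]
      _ ≤ _ := mul_pow_le_pow hd (by norm_num) (by positivity)
  have := le_of_pow_le_pow_left₀ hd.ne' (by positivity) h4
  linarith

/-- A function on the points of `v` which is the restriction of a polynomial `≠ 0` does not vanish at
points in opposite parts of a sufficiently large ball around which `v` is dense. -/
theorem exists_far_nonzeros {q : ℕ} (hd : 0 < d) {v : Finset (Fin N)} {K H R : ℝ}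
    (hH : 0 ≤ H) (hR : 0 < R) (hK1 : 1 ≤ K) (hKR : 8 * (K * H) ≤ R)
    (hK : ∀ (c : MultiIndex d q → ℝ) (y₀ : Pt d) (R H : ℝ), 0 < R → 0 ≤ H → K * H ≤ R →
      (∀ y ∈ Metric.closedBall y₀ R, ∃ z, dist y z ≤ H ∧ polyEval c z = 0) → c = 0)
    {y₀ : Pt d} (hball : ∀ y ∈ Metric.closedBall y₀ R, ∃ k ∈ v, dist y (x k) ≤ H)
    {c : MultiIndex d q → ℝ} (hc : c ≠ 0) :
    ∃ k ∈ v, ∃ l ∈ v, polyEval c (x k) ≠ 0 ∧ polyEval c (x l) ≠ 0 ∧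
      R / 2 ≤ dist (x k) (x l) := by
  have hHR : 8 * H ≤ R := by nlinarith
  have i₀ : Fin d := ⟨0, hd⟩
  -- In the ball of radius `R / 4` around each of two opposite points zeros cannot be `H`-dense. The
  -- nonzeros so found are at least `3 / 2 * R - 2 * (R / 4 + H)` apart.
  have key : ∀ s : ℝ, |s| = 3 / 4 * R → ∃ k ∈ v, polyEval c (x k) ≠ 0 ∧
      dist (y₀ + EuclideanSpace.single i₀ s) (x k) ≤ R / 4 + H := by
    intro s hs
    by_contra! hcon
    refine hc (hK c (y₀ + EuclideanSpace.single i₀ s) (R / 4) H (by positivity) hH (by linarith)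
      fun y hy => ?_)
    obtain ⟨k, hk, hyk⟩ := hball y (by
      refine Metric.closedBall_subset_closedBall' ?_ hy
      rw [dist_eq_norm, add_sub_cancel_left]
      rw [show EuclideanSpace.single i₀ s = PiLp.single 2 i₀ s from rfl, PiLp.norm_single,
        Real.norm_eq_abs, hs]
      linarith)
    refine ⟨x k, hyk, ?_⟩
    by_contra hne
    have h1 := hcon k hk hne
    have h2 := dist_triangle_left (y₀ + EuclideanSpace.single i₀ s) (x k) y
    have h3 := Metric.mem_closedBall.1 hy
    linarith
  obtain ⟨k, hk, hk0, hkd⟩ := key (3 / 4 * R) (abs_of_pos (by positivity))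
  obtain ⟨l, hl, hl0, hld⟩ := key (-(3 / 4 * R)) (by rw [abs_neg, abs_of_pos (by positivity)])
  refine ⟨k, hk, l, hl, hk0, hl0, ?_⟩
  have h1 := (abs_sub_apply_le_dist _ _ i₀).trans hkd
  have h2 := (abs_sub_apply_le_dist _ _ i₀).trans hld
  have h3 := abs_sub_apply_le_dist (x k) (x l) i₀
  simp only [PiLp.add_apply, PiLp.single_apply, if_true] at h1 h2
  have h1 := (abs_le.1 h1).2
  have h2 := (abs_le.1 h2).1
  have h3 := (abs_le.1 h3).2
  linarith

end Localization

end Samplet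

namespace Samplet

open ClusterTree (edgeLength IsMedianSplit)

/-! ### Two-sided bounds on the supports of samplets -/

section Localization

variable {d : ℕ} {Ω : Set (Pt d)}

/-- The supports of the samplets of clusters on level `j` have diameters of order at least
`2 ^ (-j / d)`. -/
theorem exists_le_diam_supp (hd : 0 < d) (q τ : ℕ) {c c₀ K B ρ D : ℝ} (hc : 1 ≤ c) (hρ : 0 < ρ)
    (hD0 : 0 < D) (hc₀ : 0 < c₀) (hc₀1 : c₀ ≤ 1) (hK : 4 * d ≤ K) (hB : 0 < B) {z₀ : Pt d}
    (hball : Metric.closedBall z₀ ρ ⊆ Ω) (hD : ∀ y ∈ Ω, ∀ z ∈ Ω, dist y z ≤ D) :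
    ∃ C : ℝ, 0 < C ∧ ∀ (N : ℕ) (x : Fin N → Pt d) (δ : ℝ), IsSpread Ω x δ (c * δ) →
      ∀ l r : ClusterTree N, (ClusterTree.node l r).Valid →
      (ClusterTree.node l r).IsSplitTree x τ →
      ∀ j, ClusterBounds x (c * δ) K c₀ B l.cluster (j + 1) →
        ClusterBounds x (c * δ) K c₀ B r.cluster (j + 1) →
      ∀ Q : (ClusterTree.node l r).Transforms (mq d q), (ClusterTree.node l r).IsQR x q Q →
      ∀ k, C * (2 : ℝ) ^ (-(j : ℝ) / d) ≤
        diam x (supp ((ClusterTree.node l r).samplets (mq d q) Q k)) := by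
  obtain ⟨Kp, hKp1, hKp⟩ := exists_const_eq_zero_of_dense_zeros d q
  have hd' : (1 : ℝ) ≤ d := by exact_mod_cast hd
  have hc0 : 0 < c := by linarith
  set κ := (c₀ / (32 * d)) ^ d with hκ
  have hκ0 : 0 < κ := by positivity
  set lam := ρ / (8 * c * d) with hlam
  have hlam0 : 0 < lam := by positivity
  set μ := κ * lam / (8 * d * D) * ρ with hμ
  have hμ0 : 0 < μ := by positivity
  -- For `δ < η * 2 ^ (-j / d)`, these conditions make, in this order, the sons too large to be
  -- leaves, the longest edge at least `lam * 2 ^ (-j / d)`, the small alternative impossible, all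
  -- edges long enough for `IsSpread.exists_ball`, and the ball obtained large enough for
  -- polynomials to be determined by their values.
  obtain ⟨η, hη0, h1, h2, h3, h4, h5⟩ : ∃ η : ℝ, 0 < η ∧ (2 * τ + 8) * (c * η) ≤ ρ ∧
      8 * c * η ≤ ρ ∧ B * c * η ≤ lam ∧ 4 * d * c * η ≤ κ * lam ∧ 8 * (Kp * (c * η)) ≤ μ := by
    refine ⟨min (ρ / ((2 * τ + 8) * c)) (min (ρ / (8 * c)) (min (lam / (B * c))
      (min (κ * lam / (4 * d * c)) (μ / (8 * Kp * c))))), ?_, ?_⟩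
    · have : 0 < Kp := by linarith
      refine lt_min ?_ (lt_min ?_ (lt_min ?_ (lt_min ?_ ?_))) <;> positivity
    · set η := min (ρ / ((2 * τ + 8) * c)) (min (ρ / (8 * c)) (min (lam / (B * c))
        (min (κ * lam / (4 * d * c)) (μ / (8 * Kp * c))))) with hη
      have hKp0 : 0 < Kp := by linarith
      have m1 : η ≤ ρ / ((2 * τ + 8) * c) := min_le_left _ _
      have m1' := min_le_right (ρ / ((2 * τ + 8) * c)) (min (ρ / (8 * c)) (min (lam / (B * c))
        (min (κ * lam / (4 * d * c)) (μ / (8 * Kp * c)))))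
      have m2 := m1'.trans (min_le_left _ _)
      have m2' := m1'.trans (min_le_right _ _)
      have m3 := m2'.trans (min_le_left _ _)
      have m3' := m2'.trans (min_le_right _ _)
      have m4 := m3'.trans (min_le_left _ _)
      have m5 := m3'.trans (min_le_right _ _)
      rw [← hη] at m2 m3 m4 m5
      rw [le_div_iff₀ (by positivity)] at m1 m2 m3 m4 m5
      refine ⟨?_, ?_, ?_, ?_, ?_⟩ <;> linarith
  refine ⟨min (2 * η) (μ / 2), lt_min (by positivity) (by positivity),
    fun N x δ hX l r hT hs j hl hr Q hQ k => ?_⟩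
  obtain ⟨hr0, hrj⟩ := level_scale hd j
  set ε := (2 : ℝ) ^ (-(j : ℝ) / d) with hε
  have hδ := hX.pos
  have hH0 := hX.H_pos
  set σ := (ClusterTree.node l r).samplets (mq d q) Q k with hσ
  obtain ⟨a, ha, b, hb, hab⟩ := ClusterTree.exists_ne_mem_supp hT hQ k
  -- If points are already separated on the scale `ε`, two points of the support suffice.
  rcases le_or_gt (η * ε) δ with hlarge | hsmall
  · have h6 := (hX.sep a b hab).trans (dist_le_diam x ha hb)
    have h7 : min (2 * η) (μ / 2) * ε ≤ 2 * η * ε :=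
      mul_le_mul_of_nonneg_right (min_le_left _ _) hr0.le
    linarith
  · have hcδ : c * δ ≤ c * η * ε := by
      rw [mul_assoc]
      exact mul_le_mul_of_nonneg_left hsmall.le hc0.le
    -- there are many points in the sons
    have hmany : (2 * τ + 8) * 2 ^ j ≤ N := by
      have e1 : ρ ^ d ≤ N * (c * δ) ^ d := by
        have := pow_le_card_mul_pow (s := Finset.univ) (x := x) hH0.le hρ (y := z₀)
          fun y hy => by
            obtain ⟨i, hi⟩ := hX.fill y (hball (Metric.ball_subset_closedBall hy))
            exact ⟨i, Finset.mem_univ i, hi⟩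
        rwa [Finset.card_univ, Fintype.card_fin] at this
      have e2 : (c * η) ^ d * (2 * τ + 8) ≤ (c * η) ^ d * (N * ε ^ d) := by
        calc (c * η) ^ d * (2 * τ + 8) = (2 * τ + 8) * (c * η) ^ d := mul_comm _ _
          _ ≤ ((2 * τ + 8) * (c * η)) ^ d :=
              mul_pow_le_pow hd (by linarith [(Nat.cast_nonneg τ : (0 : ℝ) ≤ τ)]) (by positivity)
          _ ≤ ρ ^ d := pow_le_pow_left₀ (by positivity) h1 d
          _ ≤ N * (c * δ) ^ d := e1
          _ ≤ N * (c * η * ε) ^ d := by gcongr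
          _ = (c * η) ^ d * (N * ε ^ d) := by rw [mul_pow (c * η)]; ring
      have e3 := le_of_mul_le_mul_left e2 (by positivity)
      have e4 : ((2 * τ + 8) * 2 ^ j : ℝ) ≤ N := by
        have := mul_le_mul_of_nonneg_right e3 (by positivity : (0 : ℝ) ≤ 2 ^ j)
        rwa [mul_assoc (N : ℝ), hrj, mul_one] at this
      exact_mod_cast e4
    obtain ⟨T, hson, haT⟩ : ∃ T, (T = l ∨ T = r) ∧ a ∈ T.cluster := by
      have : a ∈ l.cluster ∪ r.cluster :=
        supp_subset_iff.2 (ClusterTree.sampletSpan_le _ Q (Submodule.subset_span ⟨k, rfl⟩)) ha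
      rcases Finset.mem_union.1 this with h | h
      · exact ⟨l, Or.inl rfl, h⟩
      · exact ⟨r, Or.inr rfl, h⟩
    have hTb : ClusterBounds x (c * δ) K c₀ B T.cluster (j + 1) := by
      rcases hson with rfl | rfl
      · exact hl
      · exact hr
    have hTs : T.IsSplitTree x τ := by
      rcases hson with rfl | rfl
      · exact hs.1
      · exact hs.2.1
    have hTne : T.cluster.Nonempty := ⟨a, haT⟩
    have hcard : τ + 2 ≤ T.cluster.card := by
      have e1 := hTb.le_card
      rw [pow_succ] at e1
      have e2 : 2 ^ j * (2 * τ + 8) ≤ 2 ^ j * (2 * (T.cluster.card + 2)) := by linarith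
      have := Nat.le_of_mul_le_mul_left e2 (by positivity)
      omega
    have hleaf : ¬ T.IsLeaf := by
      cases T with
      | leaf v =>
        have : v.card < τ := hTs
        change τ + 2 ≤ v.card at hcard
        omega
      | node l r => exact id
    have hN4 : N ≤ 2 ^ j * (4 * T.cluster.card) := by
      have e1 := hTb.le_card
      rw [pow_succ, mul_assoc] at e1
      have e2 : 2 ^ j * (2 * (T.cluster.card + 2)) ≤ 2 ^ j * (4 * T.cluster.card) :=
        Nat.mul_le_mul_left _ (by omega)
      omega
    -- hence the sons are fat
    obtain ⟨i₀, -, hi₀⟩ := Finset.univ.exists_max_image (edgeLength x T.cluster)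
      ⟨⟨0, hd⟩, Finset.mem_univ _⟩
    have hL := hX.le_edgeLength hd hc0 hρ hball hN4 hTne (fun i => hi₀ i (Finset.mem_univ i))
      (edgeLength_nonneg hTne i₀)
    have hLlam : lam * ε ≤ edgeLength x T.cluster i₀ := by
      rw [hlam, div_mul_eq_mul_div, div_le_iff₀ (by positivity)]
      have e1 : 8 * c * δ ≤ 8 * c * (η * ε) := mul_le_mul_of_nonneg_left hsmall.le (by positivity)
      have e2 := mul_le_mul_of_nonneg_right h2 hr0.le
      linarith
    have hgood : IsGood x K c₀ (c * δ) T.cluster := by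
      refine hTb.shape.resolve_right fun hsm => ?_
      have e1 := hsm i₀
      have e2 : B * c * δ < B * c * (η * ε) := mul_lt_mul_of_pos_left hsmall (by positivity)
      have e3 := mul_le_mul_of_nonneg_right h3 hr0.le
      linarith
    have hE : ∀ i, 4 * d * (c * δ) < edgeLength x T.cluster i := fun i =>
      lt_of_le_of_lt (mul_le_mul_of_nonneg_right hK hH0.le) (hgood.1 i)
    have hs' : ∀ i, κ * lam * ε ≤ edgeLength x T.cluster i := fun i => by
      have e1 := hgood.2.pow_mul_edgeLength_le hX hd hc₀ hc₀1 hTne hE i i₀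
      have e2 := mul_le_mul_of_nonneg_left hLlam hκ0.le
      linarith
    obtain ⟨y₀, hy₀⟩ := hX.exists_ball hd hTb.isCell hTne hball hD hs' (by
      have e1 := mul_le_mul_of_nonneg_right h4 hr0.le
      have e2 : 4 * d * c * δ < 4 * d * c * (η * ε) := mul_lt_mul_of_pos_left hsmall (by positivity)
      linarith)
    have hReq : κ * lam * ε / (8 * d * D) * ρ = μ * ε := by rw [hμ]; ring
    rw [hReq] at hy₀
    have hKR : 8 * (Kp * (c * δ)) ≤ μ * ε := by
      have e1 := mul_le_mul_of_nonneg_right h5 hr0.le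
      have e2 := mul_le_mul_of_nonneg_left hcδ (by linarith : 0 ≤ Kp)
      linarith
    -- on a son, the samplet is a polynomial
    obtain ⟨p, hp⟩ := ClusterTree.exists_polyEval_eq_samplets (x := x) hT hQ k hson hleaf
      fun p hp => hKp p y₀ (μ * ε) (c * δ) (by positivity) hH0.le
        (by nlinarith [mul_nonneg (by linarith : 0 ≤ Kp) hH0.le]) fun y hy => by
          obtain ⟨i, hi, hyi⟩ := hy₀ y hy
          exact ⟨x i, hyi, hp i hi⟩
    have hp0 : p ≠ 0 := by
      rintro rfl
      have e1 : σ a ≠ 0 := by simpa [supp] using ha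
      rw [hσ, hp a haT] at e1
      simp [polyEval] at e1
    obtain ⟨u, hu, v, hv, hu0, hv0, huv⟩ := exists_far_nonzeros (x := x) hd hH0.le
      (by positivity : 0 < μ * ε) hKp1 hKR hKp hy₀ hp0
    rw [← hp u hu] at hu0
    rw [← hp v hv] at hv0
    have e1 := dist_le_diam x (v := supp σ) (i := u) (j := v) (by simpa [supp] using hu0)
      (by simpa [supp] using hv0)
    have h7 : min (2 * η) (μ / 2) * ε ≤ μ / 2 * ε :=
      mul_le_mul_of_nonneg_right (min_le_right _ _) hr0.le
    linarith

theorem exists_localization_of_isSpread (hd : 0 < d) (q τ : ℕ) {c ρ D : ℝ} (hc : 1 ≤ c)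
    (hρ : 0 < ρ) (hD0 : 0 < D) {z₀ : Pt d} (hball : Metric.closedBall z₀ ρ ⊆ Ω)
    (hD : ∀ y ∈ Ω, ∀ z ∈ Ω, dist y z ≤ D) :
    ∃ C₁ C₂ : ℝ, 0 < C₁ ∧ 0 < C₂ ∧ ∀ (N : ℕ) (x : Fin N → Pt d) (δ : ℝ),
      IsSpread Ω x δ (c * δ) → ∀ T : ClusterTree N, T.IsClusterTree → T.IsSplitTree x τ →
      ∀ Q : T.Transforms (mq d q), T.IsQR x q Q →
      ∀ (p : T.Node) (k : Fin (p.subtree.numSamplets (mq d q))),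
        C₁ * (2 : ℝ) ^ (-(p.level : ℝ) / d) ≤ diam x (supp (p.samplets Q k)) ∧
        diam x (supp (p.samplets Q k)) ≤ C₂ * (2 : ℝ) ^ (-(p.level : ℝ) / d) := by
  obtain ⟨c₀, K, B, hc₀, hc₀1, hK, hB, hbounds⟩ := exists_clusterBounds hd c hρ hD0
  obtain ⟨C₁, hC₁, hlow⟩ :=
    exists_le_diam_supp hd q τ hc hρ hD0 hc₀ hc₀1 hK hB hball hD
  obtain ⟨C₂, hC₂, hup⟩ := exists_edgeLength_le hd hc hρ hD0 hc₀ hc₀1 hK hB hball hD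
  have hd' : (0 : ℝ) < d := by exact_mod_cast hd
  refine ⟨C₁, d * C₂, hC₁, by positivity, fun N x δ hX T hT hs Q hQ p k => ?_⟩
  obtain ⟨hroot, hstep⟩ := hbounds N x Ω z₀ δ hX hball hD
  obtain ⟨a, ha, b, hb, hab⟩ := ClusterTree.exists_ne_mem_supp (p.valid hT.1) (p.isQR hQ) k
  have hr := (level_scale hd p.level).1
  have hv : ClusterBounds x (c * δ) K c₀ B p.cluster p.level := by
    have := p.of_splits hstep hT.1 hs (j := 0) (by
      rw [hT.2]
      exact hroot (Fin.pos a))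
    rwa [zero_add] at this
  have hsub : supp (p.samplets Q k) ⊆ p.cluster :=
    supp_subset_iff.2 (ClusterTree.samplets_mem_supportedIn Q p k)
  constructor
  · have key : ∀ (T' : ClusterTree N) (Q' : T'.Transforms (mq d q)) (k), T'.Valid →
        T'.IsSplitTree x τ → T'.IsQR x q Q' → ClusterBounds x (c * δ) K c₀ B T'.cluster p.level →
        C₁ * (2 : ℝ) ^ (-(p.level : ℝ) / d) ≤ diam x (supp (T'.samplets (mq d q) Q' k)) := by
      intro T' Q' k hval hsp hqr hv
      cases T' with
      | leaf v => exact k.elim0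
      | node l r =>
        obtain ⟨h1, h2⟩ := hstep _ _ _ hval.1.nonempty hval.2.1.nonempty hval.2.2 hsp.2.2 hv
        exact hlow N x δ hX l r hval hsp p.level h1 h2 Q' hqr k
    exact key _ _ k (p.valid hT.1) (p.isSplitTree hs) (p.isQR hQ) hv
  · refine (diam_mono x hsub).trans ?_
    rw [mul_assoc]
    exact diam_le_of_edgeLength_le (by positivity) (hup N x δ hX p.cluster p.level
      (Finset.one_lt_card.2 ⟨a, hsub ha, b, hsub hb, hab⟩) hv)

/-- Quasi-uniform point sets with at least two points are spread, and `Ω` is bounded. -/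
theorem IsQuasiUniform.exists_isSpread {N : ℕ} {x : Fin N → Pt d} {c : ℝ≥0} (hΩ : Convex ℝ Ω)
    (hX : IsQuasiUniform Ω c x) {a b : Fin N} (hab : a ≠ b) :
    ∃ δ : ℝ, IsSpread Ω x δ (max (c : ℝ) 1 * δ) := by
  obtain ⟨⟨i, j⟩, hij, hmin⟩ := (Finset.univ.filter fun z : Fin N × Fin N => z.1 ≠ z.2).exists_min_image
    (fun z => dist (x z.1) (x z.2)) ⟨(a, b), by simpa using hab⟩
  simp only [Finset.mem_filter, Finset.mem_univ, true_and] at hij hmin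
  have hpos : 0 < dist (x i) (x j) := dist_pos.2 fun e => hij (hX.injective e)
  refine ⟨dist (x i) (x j) / 2, hΩ, hX.mem, by positivity, ?_, fun k l hkl => ?_, fun y hy => ?_⟩
  -- The maximum with `1` ensures that the fill bound is not below the separation radius.
  · exact le_mul_of_one_le_left (by positivity) (le_max_right _ _)
  · have := hmin (k, l) hkl
    simp only at this
    linarith
  · have : Nonempty (Fin N) := ⟨a⟩
    obtain ⟨k, hk⟩ := exists_eq_ciInf_of_finite (f := fun i => edist y (x i))
    refine ⟨k, ?_⟩
    have h1 : edist y (x k) ≤ fillDistance Ω x := by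
      rw [hk]
      exact le_iSup₂_of_le y hy le_rfl
    have h2 : separationRadius x ≤ ENNReal.ofReal (dist (x i) (x j) / 2) := by
      refine (iInf_le_of_le i (iInf_le_of_le j (iInf_le_of_le hij le_rfl))).trans_eq ?_
      rw [edist_dist, ENNReal.ofReal_div_of_pos (by norm_num)]
      norm_num
    have h3 : edist y (x k) ≤ ENNReal.ofReal (c * (dist (x i) (x j) / 2)) := by
      refine (h1.trans hX.fill_le).trans ?_
      rw [ENNReal.ofReal_mul c.coe_nonneg]
      have : ENNReal.ofReal (c : ℝ) = c := ENNReal.ofReal_coe_nnreal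
      rw [this]
      gcongr
    rw [edist_dist, ENNReal.ofReal_le_ofReal_iff (mul_nonneg c.coe_nonneg (by positivity))] at h3
    exact h3.trans (mul_le_mul_of_nonneg_right (le_max_left _ _) (by positivity))

theorem IsSpread.isBounded {N : ℕ} {x : Fin N → Pt d} {δ H : ℝ} (hX : IsSpread Ω x δ H) :
    Bornology.IsBounded Ω := by
  have h : Ω ⊆ ⋃ i, Metric.closedBall (x i) H := fun y hy => by
    obtain ⟨i, hi⟩ := hX.fill y hy
    exact Set.mem_iUnion.2 ⟨i, hi⟩
  exact ((Bornology.isBounded_iUnion).2 fun i => Metric.isBounded_closedBall).subset h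

/-- The frontier of a convex set is a null set, so positive volume forces a nonempty interior. -/
theorem exists_closedBall_subset (hΩ : Convex ℝ Ω) (hvol : 0 < MeasureTheory.volume Ω) :
    ∃ z₀ : Pt d, ∃ ρ : ℝ, 0 < ρ ∧ Metric.closedBall z₀ ρ ⊆ Ω := by
  have hint : (interior Ω).Nonempty := by
    rw [Set.nonempty_iff_ne_empty]
    intro h
    have h1 : Ω ⊆ frontier Ω := by
      rw [frontier, h, Set.sdiff_empty]
      exact subset_closure
    exact hvol.ne' (MeasureTheory.measure_mono_null h1 (hΩ.addHaar_frontier _))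
  obtain ⟨z₀, hz₀⟩ := hint
  obtain ⟨ρ, hρ, hsub⟩ := Metric.nhds_basis_closedBall.mem_iff.1 (mem_interior_iff_mem_nhds.1 hz₀)
  exact ⟨z₀, ρ, hρ, hsub⟩

theorem exists_localization (q : ℕ) (hΩ : Convex ℝ Ω) (hvol : 0 < MeasureTheory.volume Ω)
    (c : ℝ≥0) (τ : ℕ) :
    ∃ C₁ C₂ : ℝ, 0 < C₁ ∧ 0 < C₂ ∧ ∀ (N : ℕ) (x : Fin N → Pt d),
      IsQuasiUniform Ω c x → ∀ T : ClusterTree N, T.IsClusterTree → T.IsSplitTree x τ →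
      ∀ Q : T.Transforms (mq d q), T.IsQR x q Q →
      ∀ (p : T.Node) (k : Fin (p.subtree.numSamplets (mq d q))),
        C₁ * (2 : ℝ) ^ (-(p.level : ℝ) / d) ≤ diam x (supp (p.samplets Q k)) ∧
        diam x (supp (p.samplets Q k)) ≤ C₂ * (2 : ℝ) ^ (-(p.level : ℝ) / d) := by
  by_cases hcase : 0 < d ∧ Bornology.IsBounded Ω
  · obtain ⟨hd, hb⟩ := hcase
    obtain ⟨z₀, ρ, hρ, hball⟩ := exists_closedBall_subset hΩ hvol
    obtain ⟨D, hD⟩ := Metric.isBounded_iff.1 hb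
    obtain ⟨C₁, C₂, h₁, h₂, h⟩ := exists_localization_of_isSpread hd q τ
      (le_max_right (c : ℝ) 1) hρ (lt_max_of_lt_right one_pos : 0 < max D 1) hball
      fun y hy z hz => (hD hy hz).trans (le_max_left _ _)
    refine ⟨C₁, C₂, h₁, h₂, fun N x hX T hT hs Q hQ p k => ?_⟩
    obtain ⟨a, -, b, -, hab⟩ := ClusterTree.exists_ne_mem_supp (p.valid hT.1) (p.isQR hQ) k
    obtain ⟨δ, hδ⟩ := hX.exists_isSpread hΩ hab
    exact h N x δ hδ T hT hs Q hQ p k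
  -- There are no samplets in this case: a samplet requires two distinct points, hence `d > 0`, and
  -- the finite fill distance then makes `Ω` bounded.
  · refine ⟨1, 1, one_pos, one_pos, fun N x hX T hT _ Q hQ p k => absurd ?_ hcase⟩
    obtain ⟨a, -, b, -, hab⟩ := ClusterTree.exists_ne_mem_supp (p.valid hT.1) (p.isQR hQ) k
    obtain ⟨δ, hδ⟩ := hX.exists_isSpread hΩ hab
    refine ⟨Nat.pos_of_ne_zero ?_, hδ.isBounded⟩
    rintro rfl
    exact hab (hX.injective (Subsingleton.elim _ _))

end Localization

end Samplet

/-! ### The theorem -/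

theorem theorem4p2p13 {d : ℕ} (q : ℕ) (Ω : Set (Samplet.Pt d)) :
    -- any points in `Ω`, any cluster tree and any QR decompositions
    (∀ (N : ℕ) (x : Fin N → Samplet.Pt d), (∀ i, x i ∈ Ω) → Function.Injective x →
      ∀ T : Samplet.ClusterTree N, T.IsClusterTree →
      ∀ Q : T.Transforms (Samplet.mq d q), T.IsQR x q Q →
        -- multiresolution analysis with detail spaces
        (∀ J : ℕ, T.IsBalanced J →
          (∀ j < J, Samplet.ClusterTree.scalingSpace Q j
            ≤ Samplet.ClusterTree.scalingSpace Q (j + 1)) ∧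
          Samplet.ClusterTree.scalingSpace Q J = ⊤ ∧
          ∀ j < J,
            Disjoint (Samplet.ClusterTree.scalingSpace Q j)
              (Samplet.ClusterTree.detailSpace Q j) ∧
            Samplet.ClusterTree.scalingSpace Q j ⟂ Samplet.ClusterTree.detailSpace Q j ∧
            Samplet.ClusterTree.scalingSpace Q j ⊔ Samplet.ClusterTree.detailSpace Q j
              = Samplet.ClusterTree.scalingSpace Q (j + 1)) ∧
        -- orthonormal basis
        (Orthonormal ℝ (Samplet.ClusterTree.sampletBasis Q) ∧
          Submodule.span ℝ (Set.range (Samplet.ClusterTree.sampletBasis Q)) = ⊤) ∧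
        -- vanishing moments
        (∀ (p : T.Node) (k : Fin (p.subtree.numSamplets (Samplet.mq d q)))
          (P : MvPolynomial (Fin d) ℝ), P.totalDegree ≤ q →
          Samplet.pairing x (fun z => MvPolynomial.eval (fun i => z i) P) (p.samplets Q k) = 0) ∧
        -- support in the cluster
        (∀ (p : T.Node) (k : Fin (p.subtree.numSamplets (Samplet.mq d q))),
          Samplet.supp (p.samplets Q k) ⊆ p.cluster) ∧
        -- coefficient vectors
        (∀ (p : T.Node) (k : Fin (p.subtree.numSamplets (Samplet.mq d q))) (v : Finset (Fin N)),
          Samplet.supp (p.samplets Q k) ⊆ v →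
          ∑ i, |p.samplets Q k i| ≤ √(v.card : ℝ)) ∧
        -- samplet coefficients of smooth functions
        (IsOpen Ω → Convex ℝ Ω →
          ∀ f : Samplet.Pt d → ℝ, ContDiffOn ℝ ((q + 1 : ℕ) : WithTop ℕ∞) f Ω →
          ∀ (p : T.Node) (k : Fin (p.subtree.numSamplets (Samplet.mq d q)))
            (v : Finset (Fin N)), Samplet.supp (p.samplets Q k) ⊆ v →
          ENNReal.ofReal |Samplet.pairing x f (p.samplets Q k)| ≤
            ENNReal.ofReal (((d : ℝ) / 2) ^ (q + 1) *
                (Samplet.diam x v ^ (q + 1) / ((q + 1).factorial : ℝ))) *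
              Samplet.cNorm (q + 1) Ω f *
              ENNReal.ofReal (∑ i, |p.samplets Q k i|))) ∧
    -- localization for quasi-uniform points
    (Convex ℝ Ω → 0 < MeasureTheory.volume Ω → ∀ (c : NNReal) (τ : ℕ),
      ∃ C₁ C₂ : ℝ, 0 < C₁ ∧ 0 < C₂ ∧
        ∀ (N : ℕ) (x : Fin N → Samplet.Pt d), Samplet.IsQuasiUniform Ω c x →
        ∀ T : Samplet.ClusterTree N, T.IsClusterTree → T.IsSplitTree x τ →
        ∀ Q : T.Transforms (Samplet.mq d q), T.IsQR x q Q →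
        ∀ (p : T.Node) (k : Fin (p.subtree.numSamplets (Samplet.mq d q))),
          C₁ * (2 : ℝ) ^ (-(p.level : ℝ) / d) ≤ Samplet.diam x (Samplet.supp (p.samplets Q k)) ∧
          Samplet.diam x (Samplet.supp (p.samplets Q k)) ≤
            C₂ * (2 : ℝ) ^ (-(p.level : ℝ) / d)) := by
  refine ⟨fun N x hx hinj T hT Q hQ => ⟨fun J hJ => ?_, ?_, fun p k P hP => ?_, fun p k => ?_,
    fun p k v hv => ?_, fun ho hc f hf p k v hv => ?_⟩, fun hc hvol c τ => ?_⟩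
  · have h := fun j hj => Samplet.ClusterTree.scalingSpace_isOrtho_and_sup hT.1 hQ hJ (j := j) hj
    refine ⟨fun j hj => (h j hj).2 ▸ le_sup_left, ?_, fun j hj =>
      ⟨(h j hj).1.disjoint, (h j hj).1, (h j hj).2⟩⟩
    rw [eq_top_iff, ← Samplet.ClusterTree.supportedIn_univ, ← hT.2]
    exact Samplet.ClusterTree.supportedIn_le_scalingSpace hJ Q
  · exact ⟨Samplet.ClusterTree.orthonormal_sampletBasis hT.1 hQ,
      Samplet.ClusterTree.span_sampletBasis hT.2 hQ⟩
  · exact Samplet.ClusterTree.pairing_eval_samplets (p.isQR hQ) k hP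
  · exact Samplet.supp_subset_iff.2 (Samplet.ClusterTree.samplets_mem_supportedIn Q p k)
  · exact Samplet.ClusterTree.sum_abs_le_sqrt_card hv ((p.orthonormal_samplets hT.1 hQ).1 k)
  · exact Samplet.ClusterTree.abs_pairing_samplets_le hx (p.valid hT.1) (p.isQR hQ) ho hc hf k hv
  · exact Samplet.exists_localization q hc hvol c τ
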